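/- Let $T$ be a rooted tree with $n\ge 1$ vertices $V$, ordered towards the root: $u\prec v$ iff $v$ is a proper ancestor of $u$. Weighted data on $T$ are functions $y:V\to\mathbb{R}$ and $w:V\to[0,\infty)$. A function $f:V\to\mathbb{R}$ is isotonic if $f(u)\le f(v)$ whenever $u\prec v$, and an $L_\infty$ isotonic regression of $(y,w)$ is an isotonic $f$ that minimizes $\max_{v\in V} w(v)\,|y(v)-f(v)|$ among all isotonic functions on $V$. Let time be the number of steps of a program on a real RAM with exact real arithmetic ($+,-,\cdot,/$ and comparisons), integer arithmetic on bounded words, and no conversion of reals into integers, where the tree is given by the array of parents of its vertices (labelled $0,\dots,n-1$ in any order, the root being its own parent), the data by arrays holding $y$ and $w$, and the result is to be written to a further array, initially $0$. **Theorem.** Given weighted data $(y,w)$ on a rooted tree of $n$ vertices, an $L_\infty$ isotonic regression of the data can be determined in $\Theta(n)$ time. That is, there are one program and constants $K, C$ such that, for all $n\ge1$, all rooted trees of $n$ vertices and all weighted data on them, the program, storing no integers larger than $Kn$, outputs an $L_\infty$ isotonic regression after at most $Cn$ steps; and, conversely, every program that always outputs an $L_\infty$ isotonic regression (with any word bound that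 depends on $n$ only) needs, on every rooted tree of $n$ vertices, at least $n$ steps for some weighted data. -/

import Mathlib

namespace LinftyIso

/-! ### Isotonic regression on a directed graph -/

/-- `u ≺ v` in the directed graph with edge relation `E`: there is a (nonempty) path
from `u` to `v`. -/
def Precedes {V : Type*} (E : V → V → Prop) (u v : V) : Prop :=
  Relation.TransGen E u v

/-- A real function on the vertices is isotonic if `u ≺ v` implies `f u ≤ f v`. -/
def IsIsotonic {V : Type*} (E : V → V → Prop) (f : V → ℝ) : Prop :=
  ∀ u v, Precedes E u v → f u ≤ f v

/-- The weighted `L_∞` error `max_v w(v) |y(v) - f(v)|`. It is only used for finite nonempty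
vertex sets, where the supremum is a maximum. -/
noncomputable def linftyError {V : Type*} (y w f : V → ℝ) : ℝ :=
  ⨆ v, w v * |y v - f v|

/-- `f` is an `L_∞` isotonic regression of the weighted data `(y, w)`: it is isotonic, and it
minimizes the weighted `L_∞` error among all isotonic functions. -/
def IsLinftyIsotonicRegression {V : Type*} (E : V → V → Prop) (y w f : V → ℝ) : Prop :=
  IsIsotonic E f ∧ ∀ g, IsIsotonic E g → linftyError y w f ≤ linftyError y w g

/-! ### Rooted trees -/

/-- A rooted tree with vertex set `Fin n`, given by its parent map: the root is its own parent,
and every vertex reaches the root by going from parent to parent. (In particular the root is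
the only vertex that is its own parent.) The labelling of the vertices is arbitrary. -/
structure ParentTree (n : ℕ) where
  root : Fin n
  parent : Fin n → Fin n
  parent_root : parent root = root
  reaches_root : ∀ v, ∃ k : ℕ, parent^[k] v = root

/-- The edges of the tree, directed towards the root: one edge from each vertex other than
the root to its parent. -/
def ParentTree.Edge {n : ℕ} (T : ParentTree n) (u v : Fin n) : Prop :=
  u ≠ T.root ∧ T.parent u = v

/-! ### The machine model: a real RAM with bounded integer words

Programs work on integer registers, real registers, integer arrays and real arrays. A fixed
program mentions only finitely many registers and arrays; array cells are addressed by computed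
integers. Real numbers are exact; they admit the four arithmetic operations and comparison, and
nothing converts a real number into an integer. -/

/-- The contents of the memory: integer registers, real registers, integer arrays, real arrays. -/
structure Mem where
  ireg : ℕ → ℕ
  rreg : ℕ → ℝ
  iarr : ℕ → ℕ → ℕ
  rarr : ℕ → ℕ → ℝ

/-- Integer expressions; subtraction is truncated at `0` and division rounds down. -/
inductive IExp where
  | const (k : ℕ)
  | reg (x : ℕ)
  | arr (a : ℕ) (i : IExp)
  | add (e₁ e₂ : IExp)
  | sub (e₁ e₂ : IExp)
  | mul (e₁ e₂ : IExp)
  | div (e₁ e₂ : IExp)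

/-- Real expressions. -/
inductive RExp where
  | ofInt (e : IExp)
  | reg (x : ℕ)
  | arr (a : ℕ) (i : IExp)
  | add (e₁ e₂ : RExp)
  | sub (e₁ e₂ : RExp)
  | mul (e₁ e₂ : RExp)
  | div (e₁ e₂ : RExp)

/-- Conditions. -/
inductive BExp where
  | ilt (e₁ e₂ : IExp)
  | ieq (e₁ e₂ : IExp)
  | rlt (e₁ e₂ : RExp)
  | not (b : BExp)
  | and (b₁ b₂ : BExp)

/-- The value of an integer expression. -/
def IExp.eval (m : Mem) : IExp → ℕ
  | .const k => k
  | .reg x => m.ireg x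
  | .arr a i => m.iarr a (i.eval m)
  | .add e₁ e₂ => e₁.eval m + e₂.eval m
  | .sub e₁ e₂ => e₁.eval m - e₂.eval m
  | .mul e₁ e₂ => e₁.eval m * e₂.eval m
  | .div e₁ e₂ => e₁.eval m / e₂.eval m

/-- The value of a real expression; a quotient by `0` has the value `0` (a program can also test
for this case by comparison). -/
noncomputable def RExp.eval (m : Mem) : RExp → ℝ
  | .ofInt e => (e.eval m : ℝ)
  | .reg x => m.rreg x
  | .arr a i => m.rarr a (i.eval m)
  | .add e₁ e₂ => e₁.eval m + e₂.eval m
  | .sub e₁ e₂ => e₁.eval m - e₂.eval m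
  | .mul e₁ e₂ => e₁.eval m * e₂.eval m
  | .div e₁ e₂ => e₁.eval m / e₂.eval m

/-- The truth of a condition. -/
def BExp.Holds (m : Mem) : BExp → Prop
  | .ilt e₁ e₂ => e₁.eval m < e₂.eval m
  | .ieq e₁ e₂ => e₁.eval m = e₂.eval m
  | .rlt e₁ e₂ => e₁.eval m < e₂.eval m
  | .not b => ¬ b.Holds m
  | .and b₁ b₂ => b₁.Holds m ∧ b₂.Holds m

/-- The time to evaluate an integer expression: one step for each constant, memory access and
operation in it. -/
def IExp.cost : IExp → ℕ
  | .const _ => 1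
  | .reg _ => 1
  | .arr _ i => i.cost + 1
  | .add e₁ e₂ => e₁.cost + e₂.cost + 1
  | .sub e₁ e₂ => e₁.cost + e₂.cost + 1
  | .mul e₁ e₂ => e₁.cost + e₂.cost + 1
  | .div e₁ e₂ => e₁.cost + e₂.cost + 1

/-- The time to evaluate a real expression. -/
def RExp.cost : RExp → ℕ
  | .ofInt e => e.cost + 1
  | .reg _ => 1
  | .arr _ i => i.cost + 1
  | .add e₁ e₂ => e₁.cost + e₂.cost + 1
  | .sub e₁ e₂ => e₁.cost + e₂.cost + 1
  | .mul e₁ e₂ => e₁.cost + e₂.cost + 1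
  | .div e₁ e₂ => e₁.cost + e₂.cost + 1

/-- The time to evaluate a condition. -/
def BExp.cost : BExp → ℕ
  | .ilt e₁ e₂ => e₁.cost + e₂.cost + 1
  | .ieq e₁ e₂ => e₁.cost + e₂.cost + 1
  | .rlt e₁ e₂ => e₁.cost + e₂.cost + 1
  | .not b => b.cost + 1
  | .and b₁ b₂ => b₁.cost + b₂.cost + 1

/-- Commands. `call k` runs the `k`-th procedure of the program; procedures work on the common
memory and may call each other and themselves. -/
inductive Cmd where
  | skip
  | setI (x : ℕ) (e : IExp)
  | setR (x : ℕ) (e : RExp)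
  | storeI (a : ℕ) (i : IExp) (e : IExp)
  | storeR (a : ℕ) (i : IExp) (e : RExp)
  | seq (c₁ c₂ : Cmd)
  | ite (b : BExp) (c₁ c₂ : Cmd)
  | loop (b : BExp) (c : Cmd)
  | call (k : ℕ)

/-- A program: a list of procedures and a main command. -/
structure Prog where
  procs : List Cmd
  main : Cmd

/-- `Exec W ps c m t m'`: with the procedures `ps` and word bound `W`, the command `c`, started
in memory `m`, halts after `t` steps in memory `m'`. An attempt to store an integer greater
than `W` blocks the execution, as does a call of a procedure that does not exist. -/
inductive Exec (W : ℕ) (ps : List Cmd) : Cmd → Mem → ℕ → Mem → Prop where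
  | skip (m : Mem) : Exec W ps .skip m 1 m
  | setI (m : Mem) (x : ℕ) (e : IExp) (h : e.eval m ≤ W) :
      Exec W ps (.setI x e) m (e.cost + 1)
        { m with ireg := Function.update m.ireg x (e.eval m) }
  | setR (m : Mem) (x : ℕ) (e : RExp) :
      Exec W ps (.setR x e) m (e.cost + 1)
        { m with rreg := Function.update m.rreg x (e.eval m) }
  | storeI (m : Mem) (a : ℕ) (i e : IExp) (h : e.eval m ≤ W) :
      Exec W ps (.storeI a i e) m (i.cost + e.cost + 1)
        { m with iarr := Function.update m.iarr a
                  (Function.update (m.iarr a) (i.eval m) (e.eval m)) }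
  | storeR (m : Mem) (a : ℕ) (i : IExp) (e : RExp) :
      Exec W ps (.storeR a i e) m (i.cost + e.cost + 1)
        { m with rarr := Function.update m.rarr a
                  (Function.update (m.rarr a) (i.eval m) (e.eval m)) }
  | seq {c₁ c₂ : Cmd} {m₁ m₂ m₃ : Mem} {t₁ t₂ : ℕ}
      (h₁ : Exec W ps c₁ m₁ t₁ m₂) (h₂ : Exec W ps c₂ m₂ t₂ m₃) :
      Exec W ps (.seq c₁ c₂) m₁ (t₁ + t₂) m₃
  | ite_true {b : BExp} {c₁ c₂ : Cmd} {m m' : Mem} {t : ℕ}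
      (hb : b.Holds m) (h : Exec W ps c₁ m t m') :
      Exec W ps (.ite b c₁ c₂) m (b.cost + 1 + t) m'
  | ite_false {b : BExp} {c₁ c₂ : Cmd} {m m' : Mem} {t : ℕ}
      (hb : ¬ b.Holds m) (h : Exec W ps c₂ m t m') :
      Exec W ps (.ite b c₁ c₂) m (b.cost + 1 + t) m'
  | loop_true {b : BExp} {c : Cmd} {m₁ m₂ m₃ : Mem} {t₁ t₂ : ℕ}
      (hb : b.Holds m₁) (h₁ : Exec W ps c m₁ t₁ m₂)
      (h₂ : Exec W ps (.loop b c) m₂ t₂ m₃) :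
      Exec W ps (.loop b c) m₁ (b.cost + 1 + t₁ + t₂) m₃
  | loop_false {b : BExp} {c : Cmd} {m : Mem} (hb : ¬ b.Holds m) :
      Exec W ps (.loop b c) m (b.cost + 1) m
  | call {k : ℕ} {c : Cmd} {m m' : Mem} {t : ℕ}
      (hk : ps[k]? = some c) (h : Exec W ps c m t m') :
      Exec W ps (.call k) m (t + 1) m'

/-! ### Input and output of the regression problem -/

/-- The initial memory: integer register `0` holds `n`, integer array `0` the parents, real
arrays `0` and `1` the values `y` and the weights `w`; everything else is `0`. -/
noncomputable def input {n : ℕ} (T : ParentTree n) (y w : Fin n → ℝ) : Mem where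
  ireg x := if x = 0 then n else 0
  rreg _ := 0
  iarr a i := if h : i < n then (if a = 0 then (T.parent ⟨i, h⟩ : ℕ) else 0) else 0
  rarr a i := if h : i < n then
      (if a = 0 then y ⟨i, h⟩ else if a = 1 then w ⟨i, h⟩ else 0) else 0

/-- The result of a computation: the first `n` cells of real array `2`. -/
def output (n : ℕ) (m : Mem) (v : Fin n) : ℝ := m.rarr 2 v

/-- `P.Halts W T y w t f`: with word bound `W`, on the given rooted tree and weighted data, the
program `P` halts after exactly `t` steps with the result `f`. -/
def Prog.Halts (P : Prog) (W : ℕ) {n : ℕ} (T : ParentTree n) (y w : Fin n → ℝ)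
    (t : ℕ) (f : Fin n → ℝ) : Prop :=
  ∃ m, Exec W P.procs P.main (input T y w) t m ∧ output n m = f

/-- With words bounded by `W n` on trees of `n` vertices, the program `P` computes an `L_∞`
isotonic regression of every weighted data on every rooted tree, the order running towards
the root. -/
def Prog.Solves (P : Prog) (W : ℕ → ℕ) : Prop :=
  ∀ (n : ℕ) (T : ParentTree n) (y w : Fin n → ℝ), (∀ v, 0 ≤ w v) →
    ∃ t f, P.Halts (W n) T y w t f ∧ IsLinftyIsotonicRegression T.Edge y w f

end LinftyIso

/-! Upper bound. An isotonic function of error at most `ε` exists iff `l v ≤ u p` whenever `p` is a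
proper ancestor of `v`, where `l v = y v - ε / w v` and `u p = y p + ε / w p`; vertices of weight
`0` get harmless constant bounds instead. This is `Feas`. Given `ε`, it is tested in linear time by
pushing the lower bounds towards the root (`Propagated.feas_iff`). Once the least feasible `ε` is
known, the pushed lower bounds are themselves a regression (`isRegression_of_propagated`). It
remains to find that `ε` in linear time.

The search keeps an interval `[a, b]` containing the optimum and a shrinking tree whose bounds `A -
S ε` and `B + R ε` are linear in `ε` and describe feasibility on `[a, b]` (`Bracket`). Vertices are
paired: a leaf with a sibling, a leaf with its parent, or an only child with its parent. A pair can
be merged into one vertex with the larger lower bound and, unless the source is a leaf, the smaller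
upper bound (`Contracted.feas_iff`). A source that is a child of its target also has a direct
constraint with it; this says that `ε` is at least some number, and it is absorbed by raising `a`
(`Bracket.contract`).

A merge keeps the bounds linear only if the two lines of the pair do not cross inside `(a, b)`.
Hence the crossing points of all pairs are listed, and five times an approximate median of those
still inside is tested for feasibility, which removes at least a quarter of them each time
(`narrow_runs`). Since a maximal pairing has at least a quarter of the vertices as targets
(`TreeList.length_le_four_mul`) and at least half of the pairs become mergeable, a round reduces the
tree to at most `7/8` of its size in linear time (`round_runs`); the times of the rounds form a
geometric series. With one vertex left there are no constraints, so `a` is the optimum.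

The approximate median comes from sorting short blocks, keeping every other element, and doubling
the block length after every two halvings. The cost of the insertion sorts is then a geometric
series too, and the errors in rank add up to at most a quarter (`Sample.quarter`, `Sample.median`).

Lower bound. If all values and weights are `1`, the only regression is constantly `1`, while the
output cells start at `0`; a step changes at most one cell (`Exec.card_changed_le`).

In the rounds, integer arrays `1` and `2` hold the list of vertices and their parents, `3` to `7`
the pairing and the merged vertices; real arrays `3`, `4`, `5`, `6` hold `A`, `S`, `B`, `R`, and `7`
the crossings; real registers `0`, `1`, `2` hold `a`, `b` and the error to be tested. Links to
vertices are stored as `x + 1`, with `0` for none. -/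

namespace LinftyIso

/-! ### Total correctness with time bounds -/

/-- The command halts within time `T` in a memory satisfying `Q`, calling no procedures. -/
def Runs (W : ℕ) (c : Cmd) (m : Mem) (T : ℕ) (Q : Mem → Prop) : Prop :=
  ∃ t m', Exec W [] c m t m' ∧ t ≤ T ∧ Q m'

/-- The integer registers a command may write. -/
def Cmd.wI : Cmd → List ℕ
  | .setI x _ => [x]
  | .seq c d => c.wI ++ d.wI
  | .ite _ c d => c.wI ++ d.wI
  | .loop _ c => c.wI
  | _ => []

/-- The real registers a command may write. -/
def Cmd.wR : Cmd → List ℕ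
  | .setR x _ => [x]
  | .seq c d => c.wR ++ d.wR
  | .ite _ c d => c.wR ++ d.wR
  | .loop _ c => c.wR
  | _ => []

/-- The integer arrays a command may write. -/
def Cmd.wIA : Cmd → List ℕ
  | .storeI a _ _ => [a]
  | .seq c d => c.wIA ++ d.wIA
  | .ite _ c d => c.wIA ++ d.wIA
  | .loop _ c => c.wIA
  | _ => []

/-- The real arrays a command may write. -/
def Cmd.wRA : Cmd → List ℕ
  | .storeR a _ _ => [a]
  | .seq c d => c.wRA ++ d.wRA
  | .ite _ c d => c.wRA ++ d.wRA
  | .loop _ c => c.wRA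
  | _ => []

/-- `m'` differs from `m` only in places that `c` may write. -/
structure Frame (c : Cmd) (m m' : Mem) : Prop where
  ireg : ∀ x, x ∉ c.wI → m'.ireg x = m.ireg x
  rreg : ∀ x, x ∉ c.wR → m'.rreg x = m.rreg x
  iarr : ∀ x, x ∉ c.wIA → m'.iarr x = m.iarr x
  rarr : ∀ x, x ∉ c.wRA → m'.rarr x = m.rarr x

theorem Frame.refl (c : Cmd) (m : Mem) : Frame c m m :=
  ⟨fun _ _ => rfl, fun _ _ => rfl, fun _ _ => rfl, fun _ _ => rfl⟩

theorem Frame.trans {c : Cmd} {m₁ m₂ m₃ : Mem} (h₁ : Frame c m₁ m₂) (h₂ : Frame c m₂ m₃) :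
    Frame c m₁ m₃ :=
  ⟨fun x h => (h₂.ireg x h).trans (h₁.ireg x h), fun x h => (h₂.rreg x h).trans (h₁.rreg x h),
   fun x h => (h₂.iarr x h).trans (h₁.iarr x h), fun x h => (h₂.rarr x h).trans (h₁.rarr x h)⟩

theorem Frame.mono {c d : Cmd} {m m' : Mem} (h : Frame c m m') (hI : c.wI ⊆ d.wI)
    (hR : c.wR ⊆ d.wR) (hIA : c.wIA ⊆ d.wIA) (hRA : c.wRA ⊆ d.wRA) : Frame d m m' :=
  ⟨fun x hx => h.ireg x fun h' => hx (hI h'), fun x hx => h.rreg x fun h' => hx (hR h'),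
   fun x hx => h.iarr x fun h' => hx (hIA h'), fun x hx => h.rarr x fun h' => hx (hRA h')⟩

/-- Each rule writes only the place it names, and calls are impossible because there are no
procedures. With this, a specification has to mention only what changes; everything else is
recovered by deciding membership in the lists of written places. -/
theorem Exec.frame {W : ℕ} {c : Cmd} {m m' : Mem} {t : ℕ} (h : Exec W [] c m t m') :
    Frame c m m' := by
  induction h with
  | skip m => exact Frame.refl _ _
  | setI m x e h =>
    refine ⟨fun y hy => ?_, fun _ _ => rfl, fun _ _ => rfl, fun _ _ => rfl⟩
    simp only [Cmd.wI, List.mem_singleton] at hy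
    simp [hy]
  | setR m x e =>
    refine ⟨fun _ _ => rfl, fun y hy => ?_, fun _ _ => rfl, fun _ _ => rfl⟩
    simp only [Cmd.wR, List.mem_singleton] at hy
    simp [hy]
  | storeI m a i e h =>
    refine ⟨fun _ _ => rfl, fun _ _ => rfl, fun y hy => ?_, fun _ _ => rfl⟩
    simp only [Cmd.wIA, List.mem_singleton] at hy
    simp [hy]
  | storeR m a i e =>
    refine ⟨fun _ _ => rfl, fun _ _ => rfl, fun _ _ => rfl, fun y hy => ?_⟩
    simp only [Cmd.wRA, List.mem_singleton] at hy
    simp [hy]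
  | seq _ _ ih₁ ih₂ =>
    exact (ih₁.mono (by simp [Cmd.wI]) (by simp [Cmd.wR]) (by simp [Cmd.wIA])
      (by simp [Cmd.wRA])).trans (ih₂.mono (by simp [Cmd.wI]) (by simp [Cmd.wR])
      (by simp [Cmd.wIA]) (by simp [Cmd.wRA]))
  | ite_true _ _ ih =>
    exact ih.mono (by simp [Cmd.wI]) (by simp [Cmd.wR]) (by simp [Cmd.wIA]) (by simp [Cmd.wRA])
  | ite_false _ _ ih =>
    exact ih.mono (by simp [Cmd.wI]) (by simp [Cmd.wR]) (by simp [Cmd.wIA]) (by simp [Cmd.wRA])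
  | loop_true _ _ _ ih₁ ih₂ =>
    exact (ih₁.mono (by simp [Cmd.wI]) (by simp [Cmd.wR]) (by simp [Cmd.wIA])
      (by simp [Cmd.wRA])).trans ih₂
  | loop_false _ => exact Frame.refl _ _
  | call hk _ _ => simp at hk

theorem Runs.frame {W : ℕ} {c : Cmd} {m : Mem} {T : ℕ} {Q : Mem → Prop} (h : Runs W c m T Q) :
    Runs W c m T fun m' => Q m' ∧ Frame c m m' := by
  obtain ⟨t, m', h, ht, hq⟩ := h
  exact ⟨t, m', h, ht, hq, h.frame⟩

theorem Runs.mono {W : ℕ} {c : Cmd} {m : Mem} {T T' : ℕ} {Q Q' : Mem → Prop}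
    (h : Runs W c m T Q) (hT : T ≤ T') (hQ : ∀ m', Q m' → Frame c m m' → Q' m') :
    Runs W c m T' Q' := by
  obtain ⟨t, m', h, ht, hq⟩ := h
  exact ⟨t, m', h, ht.trans hT, hQ _ hq h.frame⟩

theorem Runs.seq {W : ℕ} {c d : Cmd} {m : Mem} {T₁ T₂ : ℕ} {Q Q' : Mem → Prop}
    (h₁ : Runs W c m T₁ Q) (h₂ : ∀ m', Q m' → Frame c m m' → Runs W d m' T₂ Q') :
    Runs W (.seq c d) m (T₁ + T₂) Q' := by
  obtain ⟨t, m', h, ht, hq⟩ := h₁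
  obtain ⟨t', m'', h', ht', hq'⟩ := h₂ m' hq h.frame
  exact ⟨_, _, .seq h h', by omega, hq'⟩

theorem Runs.setI {W : ℕ} {x : ℕ} {e : IExp} {m : Mem} {Q : Mem → Prop} (hW : e.eval m ≤ W)
    (hQ : Q { m with ireg := Function.update m.ireg x (e.eval m) }) :
    Runs W (.setI x e) m (e.cost + 1) Q :=
  ⟨_, _, .setI m x e hW, le_rfl, hQ⟩

theorem Runs.setR {W : ℕ} {x : ℕ} {e : RExp} {m : Mem} {Q : Mem → Prop}
    (hQ : Q { m with rreg := Function.update m.rreg x (e.eval m) }) :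
    Runs W (.setR x e) m (e.cost + 1) Q :=
  ⟨_, _, .setR m x e, le_rfl, hQ⟩

theorem Runs.ite {W : ℕ} {b : BExp} {c d : Cmd} {m : Mem} {T : ℕ} {Q : Mem → Prop}
    (h₁ : b.Holds m → Runs W c m T Q) (h₂ : ¬ b.Holds m → Runs W d m T Q) :
    Runs W (.ite b c d) m (b.cost + 1 + T) Q := by
  by_cases hb : b.Holds m
  · obtain ⟨t, m', h, ht, hq⟩ := h₁ hb
    exact ⟨_, _, .ite_true hb h, by omega, hq⟩
  · obtain ⟨t, m', h, ht, hq⟩ := h₂ hb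
    exact ⟨_, _, .ite_false hb h, by omega, hq⟩

/-- The loop rule: the potential `Φ` pays for all the iterations. -/
theorem Runs.loop {W : ℕ} {b : BExp} {c : Cmd} {m : Mem} (I : Mem → Prop) (Φ : Mem → ℕ)
    (h0 : I m) (hend : ∀ m', I m' → ¬ b.Holds m' → b.cost + 1 ≤ Φ m')
    (hstep : ∀ m', I m' → Frame c m m' → b.Holds m' → ∃ T, Runs W c m' T fun m'' =>
      I m'' ∧ Φ m'' + T + b.cost + 1 ≤ Φ m') :
    Runs W (.loop b c) m (Φ m) fun m' => I m' ∧ ¬ b.Holds m' := by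
  -- Strong induction on the value of the potential, which drops strictly in every iteration because
  -- the test alone costs at least one step.
  suffices H : ∀ k m', Φ m' = k → I m' → Frame c m m' →
      Runs W (.loop b c) m' k fun m' => I m' ∧ ¬ b.Holds m' from
    H _ m rfl h0 (Frame.refl _ _)
  intro k
  induction k using Nat.strong_induction_on with
  | _ k ih =>
    intro m' hk hI hF
    by_cases hb : b.Holds m'
    · obtain ⟨T, t, m'', h, ht, hI', hΦ⟩ := hstep m' hI hF hb
      obtain ⟨t', m₃, h', ht', hq⟩ := ih (Φ m'') (by omega) m'' rfl hI' (hF.trans h.frame)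
      exact ⟨_, _, .loop_true hb h h', by omega, hq⟩
    · exact ⟨_, _, .loop_false hb, hk ▸ hend m' hI hb, hI, hb⟩

/-! ### Loop-free commands -/

/-- The weakest precondition of a command without loops and calls. -/
def Cmd.wp (W : ℕ) : Cmd → (Mem → Prop) → Mem → Prop
  | .skip, Q, m => Q m
  | .setI x e, Q, m =>
    e.eval m ≤ W ∧ Q { m with ireg := Function.update m.ireg x (e.eval m) }
  | .setR x e, Q, m => Q { m with rreg := Function.update m.rreg x (e.eval m) }
  | .storeI a i e, Q, m => e.eval m ≤ W ∧ Q { m with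
      iarr := Function.update m.iarr a (Function.update (m.iarr a) (i.eval m) (e.eval m)) }
  | .storeR a i e, Q, m => Q { m with
      rarr := Function.update m.rarr a (Function.update (m.rarr a) (i.eval m) (e.eval m)) }
  | .seq c d, Q, m => c.wp W (d.wp W Q) m
  | .ite b c d, Q, m => (b.Holds m → c.wp W Q m) ∧ (¬ b.Holds m → d.wp W Q m)
  | .loop _ _, _, _ => False
  | .call _, _, _ => False

/-- An upper bound of the running time of a command without loops and calls. -/
def Cmd.time : Cmd → ℕ
  | .skip => 1
  | .setI _ e => e.cost + 1
  | .setR _ e => e.cost + 1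
  | .storeI _ i e => i.cost + e.cost + 1
  | .storeR _ i e => i.cost + e.cost + 1
  | .seq c d => c.time + d.time
  | .ite b c d => b.cost + 1 + (c.time + d.time)
  -- No bound is claimed for loops and calls: their `Cmd.wp` is `False`.
  | .loop _ _ => 0
  | .call _ => 0

theorem Cmd.runs_of_wp {W : ℕ} {c : Cmd} : ∀ {Q : Mem → Prop} {m : Mem}, c.wp W Q m →
    Runs W c m c.time Q := by
  induction c with
  | skip => exact fun h => ⟨_, _, .skip _, le_rfl, h⟩
  | setI x e => exact fun h => Runs.setI h.1 h.2
  | setR x e => exact fun h => Runs.setR h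
  | storeI a i e => exact fun h => ⟨_, _, .storeI _ a i e h.1, le_rfl, h.2⟩
  | storeR a i e => exact fun h => ⟨_, _, .storeR _ a i e, le_rfl, h⟩
  | seq c d ihc ihd => exact fun h => (ihc h).seq fun m' h' _ => ihd h'
  | ite b c d ihc ihd =>
    exact fun h => Runs.ite (fun hb => (ihc (h.1 hb)).mono (by omega) fun _ h _ => h)
      (fun hb => (ihd (h.2 hb)).mono (by omega) fun _ h _ => h)
  | loop b c => exact fun h => h.elim
  | call k => exact fun h => h.elim

/-! ### Counting loops -/

/-- `for i < n do c`, where `i` and `n` are integer registers. -/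
def Cmd.forLoop (i n : ℕ) (c : Cmd) : Cmd :=
  .seq (.setI i (.const 0))
    (.loop (.ilt (.reg i) (.reg n)) (.seq c (.setI i (.add (.reg i) (.const 1)))))

theorem Runs.forLoop {W i r k T : ℕ} {c : Cmd} {m : Mem} (I : ℕ → Mem → Prop)
    (hr : m.ireg r = k) (hW : k ≤ W) (hi : i ∉ c.wI) (hn : r ∉ c.wI) (hir : r ≠ i)
    (hI : ∀ j m' x, I j m' → I j { m' with ireg := Function.update m'.ireg i x })
    (h0 : I 0 m)
    (hstep : ∀ j m', j < k → I j m' → Frame (.forLoop i r c) m m' → m'.ireg i = j →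
      m'.ireg r = k → Runs W c m' T (I (j + 1))) :
    Runs W (.forLoop i r c) m ((k + 1) * (T + 10)) (I k) := by
  have hset : Runs W (.setI i (.const 0)) m 2 fun m' => I 0 m' ∧ m'.ireg i = 0 :=
    Runs.setI (by simp [IExp.eval]) ⟨hI _ _ _ h0, by simp [IExp.eval]⟩
  have := hset.seq (d := (.loop (.ilt (.reg i) (.reg r))
    (.seq c (.setI i (.add (.reg i) (.const 1)))))) (T₂ := (k + 1) * (T + 8)) (Q' := I k) ?_
  · refine this.mono ?_ fun _ h _ => h
    nlinarith
  intro m' ⟨h0', hi0⟩ hF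
  have hr' : m'.ireg r = k := by
    rw [hF.ireg r (by simpa [Cmd.wI] using hir), hr]
  -- Each iteration pays `T` for the body and `4 + 4` for the test and the increment of the counter;
  -- the extra summand `1` pays for the last test.
  refine (Runs.loop (fun m'' => ∃ j ≤ k, I j m'' ∧ m''.ireg i = j ∧ m''.ireg r = k)
    (fun m'' => (k - m''.ireg i + 1) * (T + 8)) ⟨0, by omega, h0', hi0, hr'⟩ ?_ ?_).mono
    (by simp [hi0]) ?_
  · rintro m'' ⟨j, hj, -, hij, -⟩ -
    simp only [BExp.cost, IExp.cost]
    nlinarith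
  · rintro m'' ⟨j, hj, hIj, hij, hrj⟩ hF' hb
    simp only [BExp.Holds, IExp.eval, hij, hrj] at hb
    have hfr : Frame (.forLoop i r c) m m'' := by
      refine (hF.mono ?_ ?_ ?_ ?_).trans (hF'.mono ?_ ?_ ?_ ?_) <;>
        simp [Cmd.forLoop, Cmd.wI, Cmd.wR, Cmd.wIA, Cmd.wRA]
    refine ⟨T + 4, ((hstep j m'' hb hIj hfr hij hrj).frame.seq (T₂ := 4) (Q' := fun m₃ =>
      ∃ j' ≤ k, I j' m₃ ∧ m₃.ireg i = j' ∧ m₃.ireg r = k ∧ j' = j + 1) ?_).mono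
      (by omega) ?_⟩
    · rintro m₃ ⟨h1, h2⟩ -
      have e1 : m₃.ireg i = j := by rw [h2.ireg i hi, hij]
      have e2 : m₃.ireg r = k := by rw [h2.ireg r hn, hrj]
      refine Runs.setI (by simp only [IExp.eval, e1]; omega) ⟨j + 1, hb, hI _ _ _ h1, ?_, ?_, rfl⟩
      · simp [IExp.eval, e1]
      · simp [hir, e2]
    · rintro m₃ ⟨j', hj', h1, h2, h3, rfl⟩ -
      refine ⟨⟨_, hj', h1, h2, h3⟩, ?_⟩
      simp only [h2, hij, BExp.cost, IExp.cost]
      have : k - j = (k - (j + 1)) + 1 := by omega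
      rw [this]
      nlinarith
  · rintro m'' ⟨⟨j, hj, h1, h2, h3⟩, hb⟩ -
    simp only [BExp.Holds, IExp.eval, h2, h3] at hb
    have : j = k := by omega
    exact this ▸ h1

/-! ### Trees as lists of vertices, children before parents -/

/-- `L` lists the vertices of a rooted tree with parent map `par`, children before parents; the
root is its own parent. -/
structure TreeList (par : ℕ → ℕ) (L : List ℕ) : Prop where
  nodup : L.Nodup
  closed : ∀ v ∈ L, par v ∈ L
  ordered : L.Pairwise fun x y => par y ≠ x
  root : ∃ r ∈ L, ∀ v ∈ L, par v = v ↔ v = r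

/-- The vertex `x` has no children. -/
def Leaf (par : ℕ → ℕ) (L : List ℕ) (x : ℕ) : Prop :=
  ∀ y ∈ L, par y = x → y = x

/-- The lower bounds `l` and the upper bounds `u` (of proper ancestors) admit a common function
that increases towards the root. -/
def Feas (L : List ℕ) (par : ℕ → ℕ) (l u : ℕ → ℝ) : Prop :=
  ∃ g : ℕ → ℝ, ∀ v ∈ L, l v ≤ g v ∧ (par v ≠ v → g v ≤ g (par v) ∧ g v ≤ u (par v))

theorem Feas.mono {L : List ℕ} {par : ℕ → ℕ} {l u l' u' : ℕ → ℝ} (h : Feas L par l u)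
    (hl : ∀ v ∈ L, l' v ≤ l v) (hu : ∀ v, u v ≤ u' v) : Feas L par l' u' := by
  obtain ⟨g, hg⟩ := h
  exact ⟨g, fun v hv => ⟨(hl v hv).trans (hg v hv).1, fun hp =>
    ⟨((hg v hv).2 hp).1, ((hg v hv).2 hp).2.trans (hu _)⟩⟩⟩

theorem feas_congr {L : List ℕ} {par par' : ℕ → ℕ} {l u l' u' : ℕ → ℝ}
    (hc : ∀ v ∈ L, par v ∈ L) (hp : ∀ v ∈ L, par v = par' v) (hl : ∀ v ∈ L, l v = l' v)
    (hu : ∀ v ∈ L, u v = u' v) : Feas L par l u ↔ Feas L par' l' u' := by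
  refine exists_congr fun g => forall₂_congr fun v hv => ?_
  rw [hl v hv, hu _ (hc v hv), hp v hv]

theorem TreeList.congr {par par' : ℕ → ℕ} {L : List ℕ} (h : TreeList par L)
    (hp : ∀ v ∈ L, par v = par' v) : TreeList par' L := by
  refine ⟨h.nodup, fun v hv => hp v hv ▸ h.closed v hv, ?_, ?_⟩
  · exact h.ordered.imp_of_mem fun _ hb hab => hp _ hb ▸ hab
  · obtain ⟨r, hr, h'⟩ := h.root
    exact ⟨r, hr, fun v hv => hp v hv ▸ h' v hv⟩

theorem TreeList.child_before {par : ℕ → ℕ} {L P Q : List ℕ} {v : ℕ} (h : TreeList par L)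
    (hL : L = P ++ v :: Q) {y : ℕ} (hy : y ∈ L) (hyv : par y = v) (hne : y ≠ v) : y ∈ P := by
  subst hL
  have := h.ordered
  rw [List.pairwise_append, List.pairwise_cons] at this
  rcases List.mem_append.1 hy with h' | h'
  · exact h'
  · rcases List.mem_cons.1 h' with h' | h'
    · exact absurd h' hne
    · exact absurd hyv (this.2.1.1 y h')

/-- The position in the list serves as a height: it increases strictly along edges, which excludes
cycles. -/
theorem TreeList.idxOf_lt {par : ℕ → ℕ} {L : List ℕ} (h : TreeList par L) {v : ℕ} (hv : v ∈ L)
    (hp : par v ≠ v) : L.idxOf v < L.idxOf (par v) := by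
  have h1 := List.idxOf_lt_length_iff.2 hv
  have h2 := List.idxOf_lt_length_iff.2 (h.closed v hv)
  by_contra hcon
  rcases (not_lt.1 hcon).lt_or_eq with h3 | h3
  · have := List.pairwise_iff_getElem.1 h.ordered _ _ h2 h1 h3
    rw [List.getElem_idxOf, List.getElem_idxOf] at this
    exact this rfl
  · exact hp ((List.idxOf_inj (h.closed v hv)).1 h3)

theorem TreeList.par_par_ne {par : ℕ → ℕ} {L : List ℕ} (h : TreeList par L) {v : ℕ} (hv : v ∈ L)
    (hp : par v ≠ v) : par (par v) ≠ v := by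
  intro h'
  have h1 := h.idxOf_lt hv hp
  have h2 := h.idxOf_lt (h.closed v hv) (by rw [h']; exact hp.symm)
  rw [h'] at h2
  omega

/-! ### Contraction -/

/-- `src t = x + 1` says that the vertex `x` is to be merged into `t`; `x` is a leaf and sibling
of `t`, or a leaf child of `t`, or the only child of `t`. -/
structure Pairing (par : ℕ → ℕ) (L : List ℕ) (src : ℕ → ℕ) : Prop where
  source : ∀ t ∈ L, ∀ x, src t = x + 1 → x ∈ L ∧ x ≠ t ∧ par x ≠ x ∧ src x = 0
  inj : ∀ t ∈ L, ∀ t' ∈ L, src t = src t' → src t ≠ 0 → t = t'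
  shape : ∀ t ∈ L, ∀ x, src t = x + 1 →
    (Leaf par L x ∧ par x = par t ∧ par t ≠ t) ∨
    (par x = t ∧ (Leaf par L x ∨ ∀ y ∈ L, par y = t → y ≠ t → y = x))

/-- The merges of the pairs whose target satisfies `res` have been carried out. -/
structure Contracted (par : ℕ → ℕ) (L : List ℕ) (src : ℕ → ℕ) (res dead : ℕ → Prop)
    (par' : ℕ → ℕ) (L' : List ℕ) : Prop where
  dead_iff : ∀ x ∈ L, dead x ↔ ∃ t ∈ L, src t = x + 1 ∧ res t
  par_live : ∀ v ∈ L, ¬ dead v → ¬ dead (par v) → par' v = par v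
  par_dead : ∀ v ∈ L, ¬ dead v → dead (par v) → par' v = par (par v)
  mem : ∀ v, v ∈ L' ↔ v ∈ L ∧ ¬ dead v
  sub : L'.Sublist L

section
variable {par par' src : ℕ → ℕ} {L L' : List ℕ} {res dead : ℕ → Prop}

/-- A vertex with a child is not a leaf, so if it has been merged, it was the only child of its
target. Hence a survivor whose parent died can be attached to its grandparent. -/
theorem Contracted.par_of_dead (hT : TreeList par L) (hP : Pairing par L src)
    (hC : Contracted par L src res dead par' L') {v : ℕ} (hv : v ∈ L) (hne : par v ≠ v)
    (hd : dead (par v)) : par (par v) ∈ L ∧ src (par (par v)) = par v + 1 ∧ res (par (par v)) ∧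
      ∀ y ∈ L, par y = par (par v) → y ≠ par (par v) → y = par v := by
  obtain ⟨t, ht, hs, hr⟩ := (hC.dead_iff _ (hT.closed v hv)).1 hd
  rcases hP.shape t ht _ hs with ⟨h, -⟩ | ⟨h, h' | h'⟩
  · exact absurd (h v hv rfl).symm hne
  · exact absurd (h' v hv rfl).symm hne
  · rw [h]
    exact ⟨ht, hs, hr, h'⟩

/-- A source is never a target, so merges do not chain and all of them can be carried out at once.
-/
theorem Contracted.not_dead_of_src (hP : Pairing par L src)
    (hC : Contracted par L src res dead par' L') {t : ℕ} (ht : t ∈ L) (h : src t ≠ 0) :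
    ¬ dead t := by
  intro hd
  obtain ⟨t', ht', hs, -⟩ := (hC.dead_iff t ht).1 hd
  exact h (hP.source t' ht' t hs).2.2.2

/-- The new parent of a survivor is its old parent or its old grandparent. Both come later in the
list, so the order is inherited by the sublist; the root is no source and survives. -/
theorem Contracted.treeList (hT : TreeList par L) (hP : Pairing par L src)
    (hC : Contracted par L src res dead par' L') : TreeList par' L' := by
  refine ⟨hT.nodup.sublist hC.sub, ?_, ?_, ?_⟩
  · intro v hv
    obtain ⟨hv, hd⟩ := (hC.mem v).1 hv
    rw [hC.mem]
    by_cases hp : dead (par v)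
    · have hne : par v ≠ v := fun h => hd (h ▸ hp)
      obtain ⟨h1, h2, -⟩ := hC.par_of_dead hT hP hv hne hp
      rw [hC.par_dead v hv hd hp]
      exact ⟨h1, hC.not_dead_of_src hP h1 (by omega)⟩
    · rw [hC.par_live v hv hd hp]
      exact ⟨hT.closed v hv, hp⟩
  · have : L.Pairwise fun x y => par y ≠ x ∧ (par y ≠ y → par (par y) ≠ par y →
        par (par y) ≠ x) := by
      rw [List.pairwise_iff_getElem]
      intro i j hi hj hij
      refine ⟨List.pairwise_iff_getElem.1 hT.ordered _ _ hi hj hij, fun h1 h2 h3 => ?_⟩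
      have e1 := hT.idxOf_lt (List.getElem_mem hj) h1
      have e2 := hT.idxOf_lt (hT.closed _ (List.getElem_mem hj)) h2
      rw [h3, hT.nodup.idxOf_getElem] at e2
      rw [hT.nodup.idxOf_getElem] at e1
      omega
    refine (this.sublist hC.sub).imp_of_mem ?_
    intro x y hx hy ⟨h1, h2⟩
    obtain ⟨hy, hd⟩ := (hC.mem y).1 hy
    by_cases hp : dead (par y)
    · have hne : par y ≠ y := fun h => hd (h ▸ hp)
      obtain ⟨h3, h4, -⟩ := hC.par_of_dead hT hP hy hne hp
      rw [hC.par_dead y hy hd hp]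
      exact h2 hne fun h => (hP.source _ h3 _ h4).2.1 h.symm
    · rw [hC.par_live y hy hd hp]
      exact h1
  · obtain ⟨r, hr, h⟩ := hT.root
    have hrr := (h r hr).2 rfl
    have hrd : ¬ dead r := by
      intro hd
      obtain ⟨t, ht, hs, -⟩ := (hC.dead_iff r hr).1 hd
      exact (hP.source t ht r hs).2.2.1 hrr
    refine ⟨r, (hC.mem r).2 ⟨hr, hrd⟩, fun v hv => ?_⟩
    obtain ⟨hv, hd⟩ := (hC.mem v).1 hv
    by_cases hp : dead (par v)
    · have hne : par v ≠ v := fun h => hd (h ▸ hp)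
      rw [hC.par_dead v hv hd hp]
      refine ⟨fun h' => absurd h' (hT.par_par_ne hv hne), fun h' => ?_⟩
      rw [h', hrr, hrr]
    · rw [hC.par_live v hv hd hp]
      exact h v hv

/-- A merged vertex has the same surviving proper ancestors as its target, so only the larger lower
bound matters. The upper bound of a source matters only to its descendants: a leaf has none, and
those of an only child are also below the target, which may therefore take the smaller upper bound.
The one constraint that disappears is the one between a source and the target that is its parent; it
is stated separately. -/
theorem Contracted.feas_iff (hT : TreeList par L) (hP : Pairing par L src)
    (hC : Contracted par L src res dead par' L') {l u l' u' : ℕ → ℝ}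
    (hres : ∀ t ∈ L, res t → src t ≠ 0)
    (hl0 : ∀ t ∈ L, ¬ res t → l' t = l t)
    (hl1 : ∀ t ∈ L, ∀ x, src t = x + 1 → res t → l' t = max (l x) (l t))
    (hu0 : ∀ t ∈ L, ¬ res t → u' t = u t)
    (hu1 : ∀ t ∈ L, ∀ x, src t = x + 1 → res t → Leaf par L x → u' t = u t)
    (hu2 : ∀ t ∈ L, ∀ x, src t = x + 1 → res t → ¬ Leaf par L x → u' t = min (u x) (u t)) :
    Feas L par l u ↔ (∀ t ∈ L, ∀ x, src t = x + 1 → res t → par x = t → l x ≤ u t) ∧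
      Feas L' par' l' u' := by
  classical
  constructor
  · rintro ⟨g, hg⟩
    -- The target takes the larger of the two values. If the source was its child, this is the old
    -- value.
    refine ⟨fun t ht x hs hr hp => ?_, fun t => if res t then max (g (src t - 1)) (g t) else g t,
      fun v hv => ?_⟩
    · obtain ⟨hx, hne, hx', -⟩ := hP.source t ht x hs
      have := hg x hx
      rw [hp] at this
      exact this.1.trans (this.2 (Ne.symm hne)).2
    obtain ⟨hv, hd⟩ := (hC.mem v).1 hv
    dsimp only
    constructor
    · by_cases hr : res v
      · obtain ⟨x, hx⟩ := Nat.exists_eq_succ_of_ne_zero (hres v hv hr)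
        rw [hl1 v hv x hx hr, if_pos hr, hx]
        exact max_le_max (hg x (hP.source v hv x hx).1).1 (hg v hv).1
      · rw [hl0 v hv hr, if_neg hr]
        exact (hg v hv).1
    · intro hne
      have hpv : par v ≠ v := by
        intro h
        rw [hC.par_live v hv hd (by rwa [h])] at hne
        exact hne h
      have hg' : ∀ t, g t ≤ if res t then max (g (src t - 1)) (g t) else g t := by
        intro t
        split_ifs
        · exact le_max_right _ _
        · exact le_rfl
      -- Even the raised value at `v` stays below the value and the upper bound of the old parent of
      -- `v`, because the source was a child of that parent or a child of `v`.
      have key : (if res v then max (g (src v - 1)) (g v) else g v) ≤ g (par v) ∧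
          (if res v then max (g (src v - 1)) (g v) else g v) ≤ u (par v) := by
        have h1 := (hg v hv).2 hpv
        split_ifs with hr
        · obtain ⟨x, hx⟩ := Nat.exists_eq_succ_of_ne_zero (hres v hv hr)
          obtain ⟨hxL, -, hxx, -⟩ := hP.source v hv x hx
          have h2 := (hg x hxL).2 hxx
          have hx' : src v - 1 = x := by omega
          rw [hx']
          rcases hP.shape v hv x hx with ⟨-, h3, -⟩ | ⟨h3, -⟩
          · rw [h3] at h2
            exact ⟨max_le h2.1 h1.1, max_le h2.2 h1.2⟩
          · rw [h3] at h2
            exact ⟨max_le (h2.1.trans h1.1) h1.1, max_le (h2.1.trans h1.2) h1.2⟩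
        · exact h1
      by_cases hp : dead (par v)
      · obtain ⟨h1, h2, h3, h4⟩ := hC.par_of_dead hT hP hv hpv hp
        have hpL := hT.closed v hv
        have h5 := (hg _ hpL).2 (hP.source _ h1 _ h2).2.2.1
        rw [hC.par_dead v hv hd hp]
        refine ⟨(key.1.trans h5.1).trans (hg' _), ?_⟩
        rw [hu2 _ h1 _ h2 h3 fun h => hpv (h v hv rfl).symm]
        exact le_min key.2 (key.1.trans h5.2)
      · rw [hC.par_live v hv hd hp]
        refine ⟨key.1.trans (hg' _), key.2.trans_eq ?_⟩
        have hpL := hT.closed v hv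
        by_cases hr : res (par v)
        · obtain ⟨x, hx⟩ := Nat.exists_eq_succ_of_ne_zero (hres _ hpL hr)
          by_cases hl : Leaf par L x
          · exact (hu1 _ hpL x hx hr hl).symm
          · rcases hP.shape _ hpL x hx with ⟨h3, -⟩ | ⟨h3, h3' | h3'⟩
            · exact absurd h3 hl
            · exact absurd h3' hl
            -- A source that is not a leaf is the only child of its target, so the child `v` would
            -- be that source, and dead.
            · have : v = x := h3' v hv rfl (Ne.symm hpv)
              exact absurd ((hC.dead_iff v hv).2 ⟨par v, hpL, by rw [hx, this], hr⟩) hd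
        · exact (hu0 _ hpL hr).symm
  · rintro ⟨hc, g', hg'⟩
    have hu : ∀ t ∈ L, u' t ≤ u t := by
      intro t ht
      by_cases hr : res t
      · obtain ⟨x, hx⟩ := Nat.exists_eq_succ_of_ne_zero (hres t ht hr)
        by_cases hl : Leaf par L x
        · exact (hu1 t ht x hx hr hl).le
        · exact (hu2 t ht x hx hr hl).trans_le (min_le_right _ _)
      · exact (hu0 t ht hr).le
    have htgt : ∀ x, ∃ t, x ∈ L → dead x → t ∈ L ∧ src t = x + 1 ∧ res t := by
      intro x
      by_cases h : x ∈ L ∧ dead x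
      · obtain ⟨t, ht⟩ := (hC.dead_iff x h.1).1 h.2
        exact ⟨t, fun _ _ => ht⟩
      · exact ⟨0, fun h1 h2 => absurd ⟨h1, h2⟩ h⟩
    choose tgt htgt using htgt
    -- A source takes the value of its target. If the target is its parent, the value is capped by
    -- the upper bound there, since `Feas` does not bound the value of a vertex by its own upper
    -- bound; below a common parent no cap is needed.
    set g : ℕ → ℝ := fun v => if dead v then
      (if par v = tgt v then min (g' (tgt v)) (u (tgt v)) else g' (tgt v)) else g' v with hgdef
    have key : ∀ v ∈ L, ¬ dead v → par v ≠ v → g' v ≤ g (par v) ∧ g' v ≤ u (par v) := by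
      intro v hv hd hpv
      have hvL' := hg' v ((hC.mem v).2 ⟨hv, hd⟩)
      have hpL := hT.closed v hv
      by_cases hp : dead (par v)
      · obtain ⟨h1, h2, h3, h4⟩ := hC.par_of_dead hT hP hv hpv hp
        obtain ⟨h5, h6, h7⟩ := htgt _ hpL hp
        have h8 : tgt (par v) = par (par v) :=
          hP.inj _ h5 _ h1 (by rw [h6, h2]) (by omega)
        rw [hC.par_dead v hv hd hp] at hvL'
        have h9 := hvL'.2 (hT.par_par_ne hv hpv)
        rw [hu2 _ h1 _ h2 h3 fun h => hpv (h v hv rfl).symm] at h9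
        simp only [hgdef, if_pos hp, h8, if_true]
        exact ⟨le_min h9.1 (h9.2.trans (min_le_right _ _)), h9.2.trans (min_le_left _ _)⟩
      · rw [hC.par_live v hv hd hp] at hvL'
        simp only [hgdef, if_neg hp]
        exact ⟨(hvL'.2 hpv).1, (hvL'.2 hpv).2.trans (hu _ hpL)⟩
    refine ⟨g, fun v hv => ?_⟩
    by_cases hd : dead v
    · obtain ⟨h1, h2, h3⟩ := htgt v hv hd
      have htd : ¬ dead (tgt v) := hC.not_dead_of_src hP h1 (by omega)
      have hl : l v ≤ g' (tgt v) := by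
        have := (hg' _ ((hC.mem _).2 ⟨h1, htd⟩)).1
        rw [hl1 _ h1 v h2 h3] at this
        exact (le_max_left _ _).trans this
      by_cases hp : par v = tgt v
      · have hgv : g v = min (g' (tgt v)) (u (tgt v)) := by simp only [hgdef, if_pos hd, if_pos hp]
        have hgt : g (tgt v) = g' (tgt v) := by simp only [hgdef, if_neg htd]
        rw [hp, hgv, hgt]
        exact ⟨le_min hl (hc _ h1 v h2 h3 hp), fun _ => ⟨min_le_left _ _, min_le_right _ _⟩⟩
      · have hgv : g v = g' (tgt v) := by simp only [hgdef, if_pos hd, if_neg hp]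
        rcases hP.shape _ h1 v h2 with ⟨-, h4, h5⟩ | ⟨h4, -⟩
        · rw [hgv, h4]
          exact ⟨hl, fun _ => key _ h1 htd h5⟩
        · exact absurd h4 hp
    · have hgv : g v = g' v := by simp only [hgdef, if_neg hd]
      rw [hgv]
      refine ⟨?_, key v hv hd⟩
      have h1 := (hg' v ((hC.mem v).2 ⟨hv, hd⟩)).1
      by_cases hr : res v
      · obtain ⟨x, hx⟩ := Nat.exists_eq_succ_of_ne_zero (hres v hv hr)
        rw [hl1 v hv x hx hr] at h1
        exact (le_max_right _ _).trans h1
      · rwa [hl0 v hv hr] at h1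

/-- Distinct resolved targets have distinct sources, and each of these dies. -/
theorem Contracted.length_add_le (hT : TreeList par L) (hP : Pairing par L src)
    (hC : Contracted par L src res dead par' L') (hres : ∀ t ∈ L, res t → src t ≠ 0)
    [DecidablePred res] : L'.length + L.countP (fun t => res t) ≤ L.length := by
  classical
  have h1 : L'.length = L'.toFinset.card :=
    (List.toFinset_card_of_nodup (hT.nodup.sublist hC.sub)).symm
  have h2 : L.length = L.toFinset.card := (List.toFinset_card_of_nodup hT.nodup).symm
  have h3 : L.countP (fun t => res t) = (L.filter fun t => res t).toFinset.card := by
    rw [List.countP_eq_length_filter, List.toFinset_card_of_nodup (hT.nodup.filter _)]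
  have h4 : (L.filter fun t => res t).toFinset.card ≤ (L.toFinset.filter fun x => dead x).card := by
    refine Finset.card_le_card_of_injOn (fun t => src t - 1) ?_ ?_
    · intro t ht
      simp only [List.coe_toFinset, List.mem_filter, decide_eq_true_eq, Set.mem_ofPred_eq] at ht
      obtain ⟨x, hx⟩ := Nat.exists_eq_succ_of_ne_zero (hres t ht.1 ht.2)
      have hx' : src t - 1 = x := by omega
      have hxL := (hP.source t ht.1 x hx).1
      simp only [Finset.coe_filter, List.mem_toFinset, Set.mem_ofPred_eq, hx']
      exact ⟨hxL, (hC.dead_iff x hxL).2 ⟨t, ht.1, hx, ht.2⟩⟩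
    · intro t ht t' ht' h
      simp only [List.coe_toFinset, List.mem_filter, decide_eq_true_eq, Set.mem_ofPred_eq] at ht ht'
      have a1 := hres t ht.1 ht.2
      have a2 := hres t' ht'.1 ht'.2
      dsimp only at h
      exact hP.inj t ht.1 t' ht'.1 (by omega) a1
  have h5 : L'.toFinset = L.toFinset.filter fun x => ¬ dead x := by
    ext v
    simp [hC.mem]
  rw [h1, h2, h3, h5]
  have := Finset.card_filter_add_card_filter_not (s := L.toFinset) (fun x => dead x)
  omega

/-- A pairing that cannot be extended covers a quarter of the vertices. -/
theorem TreeList.length_le_four_mul (hT : TreeList par L) (h2 : 2 ≤ L.length)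
    (hleaf : ∀ v ∈ L, par v ≠ v → Leaf par L v → src v ≠ 0 ∨ ∃ t ∈ L, src t = v + 1)
    (hunary : ∀ v ∈ L, src v = 0 → ∀ c ∈ L, par c = v → c ≠ v →
      (∀ y ∈ L, par y = v → y ≠ v → y = c) → src c ≠ 0 ∧ ¬ Leaf par L c) :
    L.length ≤ 4 * L.countP fun t => src t ≠ 0 := by
  classical
  obtain ⟨r, hr, hroot⟩ := hT.root
  set F := L.toFinset with hF
  have hmem : ∀ v, v ∈ F ↔ v ∈ L := fun v => List.mem_toFinset
  have hcard : F.card = L.length := List.toFinset_card_of_nodup hT.nodup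
  set ch : ℕ → Finset ℕ := fun v => F.filter fun y => par y = v ∧ y ≠ v with hch
  have hmch : ∀ v y, y ∈ ch v ↔ y ∈ L ∧ par y = v ∧ y ≠ v := fun v y => by simp [hch, hmem]
  -- Every vertex but the root is a child of exactly one vertex.
  have hsum : ∑ v ∈ F, (ch v).card + 1 = L.length := by
    have : (F.erase r).card = ∑ v ∈ F, ((F.erase r).filter fun y => par y = v).card :=
      Finset.card_eq_sum_card_fiberwise fun y hy => by
        have := Finset.mem_of_mem_erase hy
        exact (hmem _).2 (hT.closed y ((hmem y).1 this))
    have h3 : ∑ v ∈ F, ((F.erase r).filter fun y => par y = v).card = ∑ v ∈ F, (ch v).card := by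
      refine Finset.sum_congr rfl fun v _ => congrArg _ ?_
      ext y
      simp only [Finset.mem_filter, Finset.mem_erase, hmem, hmch]
      constructor
      · rintro ⟨⟨h1, h2⟩, h3⟩
        exact ⟨h2, h3, fun h => h1 ((hroot y h2).1 (h ▸ h3))⟩
      · rintro ⟨h1, h2, h3⟩
        exact ⟨⟨fun h => h3 (by rw [← h2, (hroot y h1).2 h]), h1⟩, h2⟩
    have h4 := Finset.card_erase_add_one ((hmem r).2 hr)
    omega
  have hleaf_iff : ∀ v, Leaf par L v ↔ (ch v).card = 0 := by
    intro v
    rw [Finset.card_eq_zero, Finset.eq_empty_iff_forall_notMem]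
    simp only [hmch]
    exact ⟨fun h y hy => hy.2.2 (h y hy.1 hy.2.1), fun h y h1 h2 => by
      by_contra h3
      exact h y ⟨h1, h2, h3⟩⟩
  have hr0 : ¬ Leaf par L r := by
    intro hl
    have hall : ∀ v ∈ L, v = r := by
      by_contra hcon
      push Not at hcon
      obtain ⟨v, hv, hvr⟩ := hcon
      -- The last vertex of the list other than the root has a parent that comes later still, which
      -- can only be the root; so the root is not a leaf.
      obtain ⟨w, hw, hmax⟩ := Finset.exists_max_image (F.erase r) (fun v => L.idxOf v)
        ⟨v, Finset.mem_erase.2 ⟨hvr, (hmem v).2 hv⟩⟩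
      obtain ⟨hwr, hwL⟩ := Finset.mem_erase.1 hw
      rw [hmem] at hwL
      have hpw : par w ≠ w := fun h => hwr ((hroot w hwL).1 h)
      by_cases h : par w = r
      · exact hwr (hl w hwL h)
      · have h3 := hmax (par w) (Finset.mem_erase.2 ⟨h, (hmem _).2 (hT.closed w hwL)⟩)
        have h4 := hT.idxOf_lt hwL hpw
        omega
    have : F ⊆ {r} := fun v hv => Finset.mem_singleton.2 (hall v ((hmem v).1 hv))
    have := Finset.card_le_card this
    rw [Finset.card_singleton] at this
    omega
  set T := F.filter fun t => src t ≠ 0 with hTdef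
  have hq : L.countP (fun t => src t ≠ 0) = T.card := by
    rw [List.countP_eq_length_filter, ← List.toFinset_card_of_nodup (hT.nodup.filter _)]
    congr 1
    ext t
    simp [hTdef, hmem]
  set lf := F.filter fun v => (ch v).card = 0 with hlf
  set un := F.filter fun v => (ch v).card = 1 with hun
  set TL := T.filter fun v => (ch v).card = 0 with hTL
  set TN := T.filter fun v => ¬ (ch v).card = 0 with hTN
  have hTcard : TL.card + TN.card = T.card := Finset.card_filter_add_card_filter_not _
  -- Summing `2 ≤ #children + 2 [leaf] + [one child]` over the vertices, where the numbers of
  -- children add up to `L.length - 1`.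
  have hcount : L.length + 1 ≤ 2 * lf.card + un.card := by
    have h3 : ∑ v ∈ F, 2 ≤ ∑ v ∈ F, ((ch v).card + 2 * (if (ch v).card = 0 then 1 else 0)
        + (if (ch v).card = 1 then 1 else 0)) := by
      refine Finset.sum_le_sum fun v _ => ?_
      split_ifs <;> omega
    rw [Finset.sum_add_distrib, Finset.sum_add_distrib, ← Finset.mul_sum, ← Finset.card_filter,
      ← Finset.card_filter, Finset.sum_const, smul_eq_mul] at h3
    rw [hcard] at h3
    change _ ≤ _ + 2 * lf.card + un.card at h3
    omega
  -- Every leaf is the source of a target or is itself a target without children.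
  have hlf_le : lf.card ≤ T.card + TL.card := by
    have : lf ⊆ (T.image fun t => src t - 1) ∪ TL := by
      intro v hv
      simp only [hlf, Finset.mem_filter, hmem] at hv
      have hl := (hleaf_iff v).2 hv.2
      have hvr : par v ≠ v := fun h => hr0 ((hroot v hv.1).1 h ▸ hl)
      rcases hleaf v hv.1 hvr hl with h | ⟨t, ht, hs⟩
      · refine Finset.mem_union_right _ ?_
        simp only [hTL, hTdef, Finset.mem_filter, hmem]
        exact ⟨⟨hv.1, h⟩, hv.2⟩
      · refine Finset.mem_union_left _ (Finset.mem_image.2 ⟨t, ?_, by omega⟩)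
        simp only [hTdef, Finset.mem_filter, hmem]
        exact ⟨ht, by omega⟩
    exact (Finset.card_le_card this).trans ((Finset.card_union_le _ _).trans
      (Nat.add_le_add_right Finset.card_image_le _))
  -- A vertex with one child is a target that has children, or its only child is such a target.
  have hun_le : un.card ≤ TN.card + TN.card := by
    have : un ⊆ TN ∪ TN.image par := by
      intro v hv
      simp only [hun, Finset.mem_filter, hmem] at hv
      by_cases hs : src v = 0
      · obtain ⟨c, hc⟩ := Finset.card_eq_one.1 hv.2
        have h3 := (hmch v c).1 (hc ▸ Finset.mem_singleton_self c)
        obtain ⟨h4, h5⟩ := hunary v hv.1 hs c h3.1 h3.2.1 h3.2.2 fun y h6 h7 h8 =>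
          Finset.mem_singleton.1 (hc ▸ (hmch v y).2 ⟨h6, h7, h8⟩)
        refine Finset.mem_union_right _ (Finset.mem_image.2 ⟨c, ?_, h3.2.1⟩)
        simp only [hTN, hTdef, Finset.mem_filter, hmem]
        exact ⟨⟨h3.1, h4⟩, fun h => h5 ((hleaf_iff c).2 h)⟩
      · refine Finset.mem_union_left _ ?_
        simp only [hTN, hTdef, Finset.mem_filter, hmem]
        exact ⟨⟨hv.1, hs⟩, by omega⟩
    exact (Finset.card_le_card this).trans ((Finset.card_union_le _ _).trans
      (Nat.add_le_add_left Finset.card_image_le _))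
  -- Now `L.length + 1 ≤ 2 (T + TL) + 2 TN = 4 T` in cardinalities.
  rw [hq]
  omega

end

/-! ### Lower and upper bounds depending on the error -/

/-- The lower bounds `A v - S v * ε`. -/
def lo (A S : ℕ → ℝ) (ε : ℝ) (v : ℕ) : ℝ := A v - S v * ε

/-- The upper bounds `B v + R v * ε`. -/
def up (B R : ℕ → ℝ) (ε : ℝ) (v : ℕ) : ℝ := B v + R v * ε

theorem line_le_of_endpoints {p q p' q' a b ε : ℝ} (ha : p + q * a ≤ p' + q' * a)
    (hb : p + q * b ≤ p' + q' * b) (h1 : a ≤ ε) (h2 : ε ≤ b) : p + q * ε ≤ p' + q' * ε := by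
  rcases le_total q q' with h | h
  · nlinarith [mul_le_mul_of_nonneg_left h1 (sub_nonneg.2 h)]
  · nlinarith [mul_le_mul_of_nonneg_left h2 (sub_nonneg.2 h)]

/-- If neither line lies below the other at both ends, their difference has strictly opposite signs
there, and the quotient is its zero. -/
theorem crossing_mem {p q p' q' a b : ℝ} (hab : a ≤ b)
    (h1 : ¬ (p + q * a ≤ p' + q' * a ∧ p + q * b ≤ p' + q' * b))
    (h2 : ¬ (p' + q' * a ≤ p + q * a ∧ p' + q' * b ≤ p + q * b)) :
    a < (p' - p) / (q - q') ∧ (p' - p) / (q - q') < b := by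
  by_cases ha : p + q * a ≤ p' + q' * a
  · have hb : p' + q' * b < p + q * b := not_le.1 fun h => h1 ⟨ha, h⟩
    have ha' : p + q * a < p' + q' * a := not_le.1 fun h => h2 ⟨h, hb.le⟩
    have hq : 0 < q - q' := by
      by_contra hq
      nlinarith [mul_nonneg (sub_nonneg.2 hab) (sub_nonneg.2 (not_lt.1 hq))]
    rw [lt_div_iff₀ hq, div_lt_iff₀ hq]
    constructor <;> nlinarith
  · have ha' := not_le.1 ha
    have hb : p + q * b < p' + q' * b := not_le.1 fun h => h2 ⟨ha'.le, h⟩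
    have hq : 0 < q' - q := by
      by_contra hq
      nlinarith [mul_nonneg (sub_nonneg.2 hab) (sub_nonneg.2 (not_lt.1 hq))]
    have : (p' - p) / (q - q') = (p - p') / (q' - q) := by
      rw [← neg_sub p p', ← neg_sub q' q, neg_div_neg_eq]
    rw [this, lt_div_iff₀ hq, div_lt_iff₀ hq]
    constructor <;> nlinarith

/-- Since both slopes are nonnegative, the constraint only gets weaker as `ε` grows and amounts to a
threshold. If both slopes vanish, it does not depend on `ε` and is settled by `hb`; the quotient by
zero is then `0`, a threshold that is met anyway. -/
theorem lo_le_up_iff {A S B R b ε : ℝ} (hS : 0 ≤ S) (hR : 0 ≤ R) (hε : 0 ≤ ε)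
    (hb : A - S * b ≤ B + R * b) : A - S * ε ≤ B + R * ε ↔ (A - B) / (S + R) ≤ ε := by
  rcases (add_nonneg hS hR).lt_or_eq with h | h
  · rw [div_le_iff₀ h]
    constructor <;> intro h' <;> nlinarith
  · have h1 : S = 0 := by linarith
    have h2 : R = 0 := by linarith
    subst h1 h2
    simp only [zero_mul, sub_zero, add_zero, div_zero] at hb ⊢
    exact ⟨fun _ => hε, fun _ => hb⟩

/-- The least `ε ≥ 0` with `G ε` lies in `[a, b]`, and on this interval `G` is the feasibility
of the given bounds. -/
structure Bracket (G : ℝ → Prop) (a b : ℝ) (par : ℕ → ℕ) (L : List ℕ) (A S B R : ℕ → ℝ) :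
    Prop where
  tree : TreeList par L
  nonneg : 0 ≤ a
  le : a ≤ b
  holds : G b
  not_holds : ∀ ε, 0 ≤ ε → ε < a → ¬ G ε
  iff_feas : ∀ ε, a ≤ ε → ε ≤ b → (G ε ↔ Feas L par (lo A S ε) (up B R ε))
  S_nonneg : ∀ v ∈ L, 0 ≤ S v
  R_nonneg : ∀ v ∈ L, 0 ≤ R v

section
variable {G : ℝ → Prop} {a b : ℝ} {par : ℕ → ℕ} {L : List ℕ} {A S B R : ℕ → ℝ}

theorem Bracket.of_feas (h : Bracket G a b par L A S B R) {z : ℝ} (h1 : a ≤ z) (h2 : z ≤ b)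
    (hz : Feas L par (lo A S z) (up B R z)) : Bracket G a z par L A S B R :=
  ⟨h.tree, h.nonneg, h1, (h.iff_feas z h1 h2).2 hz, h.not_holds,
    fun ε e1 e2 => h.iff_feas ε e1 (e2.trans h2), h.S_nonneg, h.R_nonneg⟩

/-- By monotonicity the infeasibility of `z` excludes all smaller errors. The point `z` itself stays
in the closed interval, which does no harm. -/
theorem Bracket.of_not_feas (hG : ∀ ε ε', 0 ≤ ε → ε ≤ ε' → G ε → G ε')
    (h : Bracket G a b par L A S B R) {z : ℝ} (h1 : a ≤ z) (h2 : z ≤ b)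
    (hz : ¬ Feas L par (lo A S z) (up B R z)) : Bracket G z b par L A S B R :=
  ⟨h.tree, h.nonneg.trans h1, h2, h.holds,
    fun ε e1 e2 hε => hz ((h.iff_feas z h1 h2).1 (hG ε z e1 e2.le hε)),
    fun ε e1 e2 => h.iff_feas ε (h1.trans e1) e2, h.S_nonneg, h.R_nonneg⟩

/-- A single vertex has no proper ancestor, so no constraint is left and the left end is feasible.
-/
theorem Bracket.holds_left (h : Bracket G a b par L A S B R) (hL : L.length ≤ 1) : G a := by
  refine (h.iff_feas a le_rfl h.le).2 ⟨lo A S a, fun v hv => ⟨le_rfl, fun hp => ?_⟩⟩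
  have h1 := h.tree.idxOf_lt hv hp
  have h2 := List.idxOf_lt_length_iff.2 (h.tree.closed v hv)
  omega

theorem Bracket.congr {par' : ℕ → ℕ} {A' S' B' R' : ℕ → ℝ} (h : Bracket G a b par L A S B R)
    (hp : ∀ v ∈ L, par v = par' v) (hA : ∀ v ∈ L, A v = A' v) (hS : ∀ v ∈ L, S v = S' v)
    (hB : ∀ v ∈ L, B v = B' v) (hR : ∀ v ∈ L, R v = R' v) : Bracket G a b par' L A' S' B' R' := by
  refine ⟨h.tree.congr hp, h.nonneg, h.le, h.holds, h.not_holds, fun ε e1 e2 => ?_,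
    fun v hv => hS v hv ▸ h.S_nonneg v hv, fun v hv => hR v hv ▸ h.R_nonneg v hv⟩
  rw [h.iff_feas ε e1 e2]
  refine feas_congr h.tree.closed hp (fun v hv => ?_) fun v hv => ?_
  · rw [lo, lo, hA v hv, hS v hv]
  · rw [up, up, hB v hv, hR v hv]

/-- The lower bounds of `x` and `t` compare in the same way at `a` and at `b`, and `A', S'` is the
larger one. -/
def LoMax (A S : ℕ → ℝ) (a b : ℝ) (x t : ℕ) (A' S' : ℝ) : Prop :=
  (lo A S a x ≤ lo A S a t ∧ lo A S b x ≤ lo A S b t ∧ A' = A t ∧ S' = S t) ∨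
  (lo A S a t ≤ lo A S a x ∧ lo A S b t ≤ lo A S b x ∧ A' = A x ∧ S' = S x)

/-- The upper bounds of `x` and `t` compare in the same way at `a` and at `b`, and `B', R'` is the
smaller one. -/
def UpMin (B R : ℕ → ℝ) (a b : ℝ) (x t : ℕ) (B' R' : ℝ) : Prop :=
  (up B R a t ≤ up B R a x ∧ up B R b t ≤ up B R b x ∧ B' = B t ∧ R' = R t) ∨
  (up B R a x ≤ up B R a t ∧ up B R b x ≤ up B R b t ∧ B' = B x ∧ R' = R x)

theorem lo_le_of_endpoints {x t : ℕ} {ε : ℝ} (ha : lo A S a x ≤ lo A S a t)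
    (hb : lo A S b x ≤ lo A S b t) (h1 : a ≤ ε) (h2 : ε ≤ b) : lo A S ε x ≤ lo A S ε t := by
  have := @line_le_of_endpoints (A x) (-S x) (A t) (-S t) a b ε
    (by simp only [lo] at ha; linarith) (by simp only [lo] at hb; linarith) h1 h2
  simp only [lo]
  linarith

theorem LoMax.eq {A' S' : ℕ → ℝ} {x t : ℕ} {ε : ℝ} (h : LoMax A S a b x t (A' t) (S' t))
    (h1 : a ≤ ε) (h2 : ε ≤ b) : lo A' S' ε t = max (lo A S ε x) (lo A S ε t) := by
  rcases h with ⟨ha, hb, hA, hS⟩ | ⟨ha, hb, hA, hS⟩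
  · rw [max_eq_right (lo_le_of_endpoints ha hb h1 h2)]
    simp only [lo, hA, hS]
  · rw [max_eq_left (lo_le_of_endpoints ha hb h1 h2)]
    simp only [lo, hA, hS]

theorem UpMin.eq {B' R' : ℕ → ℝ} {x t : ℕ} {ε : ℝ} (h : UpMin B R a b x t (B' t) (R' t))
    (h1 : a ≤ ε) (h2 : ε ≤ b) : up B' R' ε t = min (up B R ε x) (up B R ε t) := by
  rcases h with ⟨ha, hb, hB, hR⟩ | ⟨ha, hb, hB, hR⟩
  · have : up B R ε t ≤ up B R ε x := line_le_of_endpoints ha hb h1 h2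
    rw [min_eq_right this]
    simp only [up, hB, hR]
  · have : up B R ε x ≤ up B R ε t := line_le_of_endpoints ha hb h1 h2
    rw [min_eq_left this]
    simp only [up, hB, hR]

/-- Each constraint between a source and the parent it is merged into is a threshold for `ε`. The
new left end is the largest of these thresholds and `a`: below it one constraint fails, and from it
on all of them hold and can be forgotten. -/
theorem Bracket.contract {src par' : ℕ → ℕ} {L' : List ℕ} {res dead : ℕ → Prop}
    {A' S' B' R' : ℕ → ℝ} {a' : ℝ} (h : Bracket G a b par L A S B R) (hP : Pairing par L src)
    (hC : Contracted par L src res dead par' L')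
    (hres : ∀ t ∈ L, res t → src t ≠ 0)
    (h0 : ∀ t ∈ L, ¬ res t → A' t = A t ∧ S' t = S t ∧ B' t = B t ∧ R' t = R t)
    (hlo : ∀ t ∈ L, ∀ x, src t = x + 1 → res t → LoMax A S a b x t (A' t) (S' t))
    (hup1 : ∀ t ∈ L, ∀ x, src t = x + 1 → res t → Leaf par L x → B' t = B t ∧ R' t = R t)
    (hup2 : ∀ t ∈ L, ∀ x, src t = x + 1 → res t → ¬ Leaf par L x →
      UpMin B R a b x t (B' t) (R' t))
    (ha : a ≤ a')
    (ha1 : ∀ t ∈ L, ∀ x, src t = x + 1 → res t → par x = t →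
      (A x - B t) / (S x + R t) ≤ a')
    (ha2 : a' = a ∨ ∃ t ∈ L, ∃ x, src t = x + 1 ∧ res t ∧ par x = t ∧
      a' = (A x - B t) / (S x + R t)) :
    Bracket G a' b par' L' A' S' B' R' := by
  have key : ∀ ε, a ≤ ε → ε ≤ b → (G ε ↔
      (∀ t ∈ L, ∀ x, src t = x + 1 → res t → par x = t → lo A S ε x ≤ up B R ε t) ∧
      Feas L' par' (lo A' S' ε) (up B' R' ε)) := by
    intro ε e1 e2
    rw [h.iff_feas ε e1 e2]
    refine hC.feas_iff h.tree hP hres ?_ ?_ ?_ ?_ ?_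
    · intro t ht hr
      simp only [lo, (h0 t ht hr).1, (h0 t ht hr).2.1]
    · intro t ht x hx hr
      exact (hlo t ht x hx hr).eq e1 e2
    · intro t ht hr
      simp only [up, (h0 t ht hr).2.2.1, (h0 t ht hr).2.2.2]
    · intro t ht x hx hr hl
      simp only [up, (hup1 t ht x hx hr hl).1, (hup1 t ht x hx hr hl).2]
    · intro t ht x hx hr hl
      exact (hup2 t ht x hx hr hl).eq e1 e2
  -- Feasibility at `b` shows that no threshold exceeds `b`, and it supplies the case of vanishing
  -- slopes in `lo_le_up_iff`.
  have hb := ((key b h.le le_rfl).1 h.holds).1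
  have hiff : ∀ t ∈ L, ∀ x, src t = x + 1 → res t → par x = t → ∀ ε, 0 ≤ ε →
      (lo A S ε x ≤ up B R ε t ↔ (A x - B t) / (S x + R t) ≤ ε) := by
    intro t ht x hx hr hp ε hε
    exact lo_le_up_iff (h.S_nonneg x (hP.source t ht x hx).1) (h.R_nonneg t ht) hε
      (hb t ht x hx hr hp)
  have hb0 := h.nonneg.trans h.le
  refine ⟨hC.treeList h.tree hP, h.nonneg.trans ha, ?_, h.holds, ?_, ?_, ?_, ?_⟩
  · rcases ha2 with rfl | ⟨t, ht, x, hx, hr, hp, rfl⟩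
    · exact h.le
    · exact (hiff t ht x hx hr hp b hb0).1 (hb t ht x hx hr hp)
  · intro ε hε hlt hGε
    rcases lt_or_ge ε a with hεa | hεa
    · exact h.not_holds ε hε hεa hGε
    · rcases ha2 with rfl | ⟨t, ht, x, hx, hr, hp, rfl⟩
      · exact absurd hlt (not_lt.2 hεa)
      · have hεb : ε ≤ b :=
          hlt.le.trans ((hiff t ht x hx hr hp b hb0).1 (hb t ht x hx hr hp))
        have := ((key ε hεa hεb).1 hGε).1 t ht x hx hr hp
        exact absurd hlt (not_lt.2 ((hiff t ht x hx hr hp ε hε).1 this))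
  · intro ε e1 e2
    rw [key ε (ha.trans e1) e2]
    refine ⟨fun h => h.2, fun hF => ⟨fun t ht x hx hr hp => ?_, hF⟩⟩
    exact (hiff t ht x hx hr hp ε ((h.nonneg.trans ha).trans e1)).2
      ((ha1 t ht x hx hr hp).trans e1)
  · intro v hv
    have hv := ((hC.mem v).1 hv).1
    by_cases hr : res v
    · obtain ⟨x, hx⟩ := Nat.exists_eq_succ_of_ne_zero (hres v hv hr)
      rcases hlo v hv x hx hr with ⟨-, -, -, e⟩ | ⟨-, -, -, e⟩ <;> rw [e]
      · exact h.S_nonneg v hv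
      · exact h.S_nonneg x (hP.source v hv x hx).1
    · rw [(h0 v hv hr).2.1]
      exact h.S_nonneg v hv
  · intro v hv
    have hv := ((hC.mem v).1 hv).1
    by_cases hr : res v
    · obtain ⟨x, hx⟩ := Nat.exists_eq_succ_of_ne_zero (hres v hv hr)
      by_cases hl : Leaf par L x
      · rw [(hup1 v hv x hx hr hl).2]
        exact h.R_nonneg v hv
      rcases hup2 v hv x hx hr hl with ⟨-, -, -, e⟩ | ⟨-, -, -, e⟩ <;> rw [e]
      · exact h.R_nonneg v hv
      · exact h.R_nonneg x (hP.source v hv x hx).1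
    · rw [(h0 v hv hr).2.2.2]
      exact h.R_nonneg v hv

/-! ### Propagation of the lower bounds towards the root -/

/-- `f` is bounded below by `l` and increases along the edges from `P`, and it is below all
functions with these properties on `L`. -/
structure Propagated (par : ℕ → ℕ) (L P : List ℕ) (l f : ℕ → ℝ) : Prop where
  ge : ∀ v ∈ L, l v ≤ f v
  le_par : ∀ v ∈ P, par v ≠ v → f v ≤ f (par v)
  least : ∀ g : ℕ → ℝ, (∀ v ∈ L, l v ≤ g v ∧ (par v ≠ v → g v ≤ g (par v))) →
    ∀ v ∈ L, f v ≤ g v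

theorem Propagated.nil (l : ℕ → ℝ) : Propagated par L [] l l :=
  ⟨fun _ _ => le_rfl, fun v hv => absurd hv (by simp), fun _ hg v hv => (hg v hv).1⟩

theorem Propagated.congr {P : List ℕ} {l f f' : ℕ → ℝ} (h : Propagated par L P l f)
    (hf : ∀ v ∈ L, f v = f' v) (hP : P ⊆ L) (hc : ∀ v ∈ L, par v ∈ L) :
    Propagated par L P l f' :=
  ⟨fun v hv => hf v hv ▸ h.ge v hv, fun v hv hp => by
    rw [← hf v (hP hv), ← hf _ (hc v (hP hv))]; exact h.le_par v hv hp,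
    fun g hg v hv => hf v hv ▸ h.least g hg v hv⟩

theorem TreeList.par_not_mem (h : TreeList par L) {P Q : List ℕ} {v : ℕ}
    (hL : L = P ++ v :: Q) : par v ∉ P := by
  intro hp
  have := h.ordered
  rw [hL, List.pairwise_append] at this
  exact this.2.2 _ hp v (by simp) rfl

/-- Children come before parents, so `par v` is not in `P`. Raising its value can only help the
edges that end there, and spoils no edge that starts in `P`. -/
theorem Propagated.step (h : TreeList par L) {P Q : List ℕ} {v : ℕ} {l f : ℕ → ℝ}
    (hL : L = P ++ v :: Q) (hf : Propagated par L P l f) :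
    Propagated par L (P ++ [v]) l
      (if f (par v) < f v then Function.update f (par v) (f v) else f) := by
  have hv : v ∈ L := by simp [hL]
  have hvP : v ∉ P := by
    have := h.nodup
    rw [hL, List.nodup_append] at this
    exact fun h' => this.2.2 v h' v (by simp) rfl
  have hnp := h.par_not_mem hL
  split_ifs with hlt
  -- The root needs no separate treatment: at its own parent the strict comparison fails.
  · have hpv : par v ≠ v := fun h => by rw [h] at hlt; exact lt_irrefl _ hlt
    refine ⟨fun x hx => ?_, fun x hx hp => ?_, fun g hg x hx => ?_⟩
    · rw [Function.update_apply]
      split_ifs with hxp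
      · rw [hxp]
        exact (hf.ge _ (h.closed v hv)).trans hlt.le
      · exact hf.ge x hx
    · rcases List.mem_append.1 hx with hx | hx
      · have hxp : x ≠ par v := fun h => hnp (h ▸ hx)
        rw [Function.update_of_ne hxp, Function.update_apply]
        split_ifs with hxp'
        · have := hf.le_par x hx hp
          rw [hxp'] at this
          exact this.trans hlt.le
        · exact hf.le_par x hx hp
      · rw [List.mem_singleton] at hx
        subst hx
        rw [Function.update_of_ne hpv.symm, Function.update_self]
    · rw [Function.update_apply]
      split_ifs with hxp
      · rw [hxp]
        exact (hf.least g hg v hv).trans ((hg v hv).2 hpv)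
      · exact hf.least g hg x hx
  · refine ⟨hf.ge, fun x hx hp => ?_, hf.least⟩
    rcases List.mem_append.1 hx with hx | hx
    · exact hf.le_par x hx hp
    · rw [List.mem_singleton] at hx
      subst hx
      exact not_lt.1 hlt

/-- The propagated function lies below every admissible one, so if any function respects the upper
bounds, this one does. -/
theorem Propagated.feas_iff {l u f : ℕ → ℝ} (hf : Propagated par L L l f) :
    Feas L par l u ↔ ∀ v ∈ L, par v ≠ v → f v ≤ u (par v) := by
  constructor
  · rintro ⟨g, hg⟩ v hv hp
    exact (hf.least g (fun v hv => ⟨(hg v hv).1, fun hp => ((hg v hv).2 hp).1⟩) v hv).trans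
      ((hg v hv).2 hp).2
  · exact fun h => ⟨f, fun v hv => ⟨hf.ge v hv, fun hp => ⟨hf.le_par v hv hp, h v hv hp⟩⟩⟩

end

/-! ### The bounds given by weighted data -/

section
variable {n : ℕ}

/-- The parent map of a rooted tree on the natural numbers. -/
def ParentTree.par (T : ParentTree n) (i : ℕ) : ℕ :=
  if h : i < n then T.parent ⟨i, h⟩ else 0

theorem ParentTree.par_coe (T : ParentTree n) (v : Fin n) : T.par v = T.parent v := by
  simp [ParentTree.par]

theorem ParentTree.parent_eq_self_iff (T : ParentTree n) (v : Fin n) :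
    T.parent v = v ↔ v = T.root := by
  constructor
  · intro h
    obtain ⟨k, hk⟩ := T.reaches_root v
    rw [← hk, Function.iterate_fixed h]
  · rintro rfl
    exact T.parent_root

/-- Data on the vertices as a function on the natural numbers. -/
noncomputable def extend (y : Fin n → ℝ) (i : ℕ) : ℝ := if h : i < n then y ⟨i, h⟩ else 0

theorem extend_coe (y : Fin n → ℝ) (v : Fin n) : extend y v = y v := by simp [extend]

/-- The value at vertices of positive weight, and `c` at vertices of weight `0`. -/
noncomputable def dataVal (y w : Fin n → ℝ) (c : ℝ) (i : ℕ) : ℝ :=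
  if 0 < extend w i then extend y i else c

/-- The inverse weight at vertices of positive weight, and `0` at vertices of weight `0`. -/
noncomputable def dataSlope (w : Fin n → ℝ) (i : ℕ) : ℝ :=
  if 0 < extend w i then 1 / extend w i else 0

/-- There is an isotonic function of error at most `ε`, stated by means of lower and upper
bounds. -/
def DataFeas (T : ParentTree n) (y w : Fin n → ℝ) (c d : ℝ) (L : List ℕ) (ε : ℝ) : Prop :=
  Feas L T.par (lo (dataVal y w c) (dataSlope w) ε) (up (dataVal y w d) (dataSlope w) ε)

variable {T : ParentTree n} {y w : Fin n → ℝ} {c d : ℝ} {L : List ℕ}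

theorem dataSlope_nonneg (i : ℕ) : 0 ≤ dataSlope w i := by
  unfold dataSlope
  split_ifs with h
  · positivity
  · exact le_rfl

theorem DataFeas.mono {ε ε' : ℝ} (h : ε ≤ ε') (hF : DataFeas T y w c d L ε) :
    DataFeas T y w c d L ε' := by
  refine Feas.mono hF (fun v _ => ?_) fun v => ?_
  · simp only [lo]
    linarith [mul_le_mul_of_nonneg_left h (dataSlope_nonneg (w := w) v)]
  · simp only [up]
    linarith [mul_le_mul_of_nonneg_left h (dataSlope_nonneg (w := w) v)]

theorem lo_data_le (hcd : c ≤ d) (hd : ∀ v, y v ≤ d) {ε : ℝ} (hε : 0 ≤ ε) (v : Fin n) :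
    lo (dataVal y w c) (dataSlope w) ε v ≤ d := by
  have := mul_nonneg (dataSlope_nonneg (w := w) v) hε
  simp only [lo, dataVal, extend_coe]
  split_ifs
  · linarith [hd v]
  · linarith

/-- The constant function `d` misses each value by at most `d - c`. This gives the right end of the
initial interval. -/
theorem dataFeas_of_large (hcd : c ≤ d) (hc : ∀ v, c ≤ y v) (hd : ∀ v, y v ≤ d) {W : ℝ}
    (hW : 0 ≤ W) (hw : ∀ v, w v ≤ W) (hL : ∀ v ∈ L, v < n) :
    DataFeas T y w c d L ((d - c) * W) := by
  have hdc := sub_nonneg.2 hcd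
  refine ⟨fun _ => d, fun v hv => ⟨lo_data_le hcd hd (mul_nonneg hdc hW) ⟨v, hL v hv⟩,
    fun _ => ⟨le_rfl, ?_⟩⟩⟩
  obtain ⟨p, hp⟩ : ∃ p : Fin n, T.par v = p := ⟨T.parent ⟨v, hL v hv⟩, by
    rw [← ParentTree.par_coe]⟩
  simp only [up, dataVal, dataSlope, hp, extend_coe]
  split_ifs with h
  · have : d - c ≤ 1 / w p * ((d - c) * W) := by
      rw [div_mul_eq_mul_div, one_mul, le_div_iff₀ h]
      exact mul_le_mul_of_nonneg_left (hw p) hdc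
    linarith [hc p]
  · simp

theorem le_linftyError (f : Fin n → ℝ) (v : Fin n) : w v * |y v - f v| ≤ linftyError y w f :=
  le_ciSup (f := fun v => w v * |y v - f v|) (Set.finite_range _).bddAbove v

theorem linftyError_nonneg (hw : ∀ v, 0 ≤ w v) (f : Fin n → ℝ) : 0 ≤ linftyError y w f :=
  Real.iSup_nonneg fun v => mul_nonneg (hw v) (abs_nonneg _)

theorem mul_abs_le_iff {w x ε : ℝ} (hw : 0 < w) : w * |x| ≤ ε ↔ |x| ≤ 1 / w * ε := by
  rw [div_mul_eq_mul_div, one_mul, le_div_iff₀ hw, mul_comm]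

theorem dataFeas_of_isotonic (hcd : c ≤ d) (hc : ∀ v, c ≤ y v) (hd : ∀ v, y v ≤ d)
    (hw : ∀ v, 0 ≤ w v) (hL : ∀ v ∈ L, v < n) {g : Fin n → ℝ} (hg : IsIsotonic T.Edge g) :
    DataFeas T y w c d L (linftyError y w g) := by
  set ε := linftyError y w g with hε
  have hε0 : 0 ≤ ε := linftyError_nonneg hw g
  have habs : ∀ v, 0 < w v → |y v - g v| ≤ 1 / w v * ε := fun v hv =>
    (mul_abs_le_iff hv).1 (le_linftyError g v)
  -- Clamping to `[c, d]`, an interval that contains all values, preserves isotonicity and increases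
  -- no deviation; it also enforces the artificial bounds `c` and `d` at vertices of weight `0`.
  refine ⟨fun i => max c (min (extend g i) d), fun i hi => ?_⟩
  obtain ⟨v, rfl⟩ : ∃ v : Fin n, i = v := ⟨⟨i, hL i hi⟩, rfl⟩
  simp only [T.par_coe, extend_coe]
  constructor
  · simp only [lo, dataVal, dataSlope, extend_coe]
    split_ifs with h
    · have h1 := (abs_le.1 (habs v h)).2
      have h2 : 0 ≤ 1 / w v * ε := by positivity
      exact le_max_of_le_right (le_min (by linarith) (by linarith [hd v]))
    · simp
  · intro hne
    have hne' : T.parent v ≠ v := fun h => hne (congrArg Fin.val h)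
    have hgp : g v ≤ g (T.parent v) := hg _ _ (Relation.TransGen.single
      ⟨fun h => hne' ((T.parent_eq_self_iff v).2 h), rfl⟩)
    have hmax : max c (min (g v) d) ≤ max c (min (g (T.parent v)) d) :=
      max_le_max le_rfl (min_le_min hgp le_rfl)
    refine ⟨hmax, hmax.trans ?_⟩
    simp only [up, dataVal, dataSlope, extend_coe]
    split_ifs with h
    · have h1 := (abs_le.1 (habs _ h)).1
      have h2 : 0 ≤ 1 / w (T.parent v) * ε := by positivity
      exact max_le (by linarith [hc (T.parent v)]) ((min_le_left _ _).trans (by linarith))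
    · simp only [zero_mul, add_zero]
      exact max_le hcd (min_le_right _ _)

/-- The least increasing function above the lower bounds at the optimal error `a` also stays below
the upper bounds, so its error is at most `a`; no isotonic function does better, by
`dataFeas_of_isotonic` and the minimality of `a`. -/
theorem isRegression_of_propagated (hcd : c ≤ d) (hc : ∀ v, c ≤ y v) (hd : ∀ v, y v ≤ d)
    (hw : ∀ v, 0 ≤ w v) (hL : ∀ v, v ∈ L ↔ v < n) {a : ℝ} (ha : 0 ≤ a)
    (hFa : DataFeas T y w c d L a) (hmin : ∀ ε, 0 ≤ ε → ε < a → ¬ DataFeas T y w c d L ε)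
    {f : ℕ → ℝ} (hf : Propagated T.par L L (lo (dataVal y w c) (dataSlope w) a) f) :
    IsLinftyIsotonicRegression T.Edge y w fun v => f v := by
  have hedge : ∀ v : Fin n, f v ≤ f (T.parent v) := by
    intro v
    by_cases h : T.par v = v
    · have : T.parent v = v := Fin.ext (by rw [← T.par_coe, h])
      rw [this]
    · rw [← T.par_coe]
      exact hf.le_par v ((hL v).2 v.2) h
  constructor
  · intro u v huv
    induction huv with
    | single h => obtain ⟨-, rfl⟩ := h; exact hedge _
    | tail _ h ih => obtain ⟨-, rfl⟩ := h; exact ih.trans (hedge _)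
  · intro g hg
    have hag : a ≤ linftyError y w g := by
      by_contra h
      exact hmin _ (linftyError_nonneg hw g) (not_le.1 h)
        (dataFeas_of_isotonic hcd hc hd hw (fun v hv => (hL v).1 hv) hg)
    refine le_trans ?_ hag
    have : Nonempty (Fin n) := ⟨T.root⟩
    refine ciSup_le fun v => ?_
    rcases (hw v).lt_or_eq with h | h
    · rw [mul_abs_le_iff h]
      have h1 := hf.ge v ((hL v).2 v.2)
      obtain ⟨g', hg'⟩ := hFa
      -- `Feas` bounds `g' i` by the upper bound of the parent but not of `i` itself. The capped
      -- function is still a competitor: it increases because `g' i` is below both the value and the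
      -- bound of the parent, and `lo ≤ up` holds at each vertex for `a ≥ 0`.
      have h2 := hf.least (fun i => min (g' i) (up (dataVal y w d) (dataSlope w) a i)) ?_ v
        ((hL v).2 v.2)
      · have h3 := h2.trans (min_le_right _ _)
        simp only [lo, up, dataVal, dataSlope, extend_coe, if_pos h] at h1 h3
        rw [abs_le]
        constructor <;> linarith
      · intro i hi
        refine ⟨le_min (hg' i hi).1 ?_, fun hp => ?_⟩
        · have := mul_nonneg (dataSlope_nonneg (w := w) i) ha
          simp only [lo, up, dataVal]
          split_ifs <;> linarith
        · exact le_min ((min_le_left _ _).trans ((hg' i hi).2 hp).1)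
            ((min_le_left _ _).trans ((hg' i hi).2 hp).2)
    · rw [← h, zero_mul]
      exact ha

end

/-! ### The lower bound -/

theorem Exec.deterministic {W : ℕ} {ps : List Cmd} {c : Cmd} {m m₁ m₂ : Mem} {t₁ t₂ : ℕ}
    (h₁ : Exec W ps c m t₁ m₁) (h₂ : Exec W ps c m t₂ m₂) : t₁ = t₂ ∧ m₁ = m₂ := by
  induction h₁ generalizing t₂ m₂ with
  | skip | setI | setR | storeI | storeR => cases h₂; exact ⟨rfl, rfl⟩
  | seq _ _ ih₁ ih₂ =>
    cases h₂ with
    | seq h h' =>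
      obtain ⟨rfl, rfl⟩ := ih₁ h
      obtain ⟨rfl, rfl⟩ := ih₂ h'
      exact ⟨rfl, rfl⟩
  | ite_true hb _ ih =>
    cases h₂ with
    | ite_true _ h => obtain ⟨rfl, rfl⟩ := ih h; exact ⟨rfl, rfl⟩
    | ite_false hb' => exact absurd hb hb'
  | ite_false hb _ ih =>
    cases h₂ with
    | ite_true hb' => exact absurd hb' hb
    | ite_false _ h => obtain ⟨rfl, rfl⟩ := ih h; exact ⟨rfl, rfl⟩
  | loop_true hb _ _ ih₁ ih₂ =>
    cases h₂ with
    | loop_true _ h h' =>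
      obtain ⟨rfl, rfl⟩ := ih₁ h
      obtain ⟨rfl, rfl⟩ := ih₂ h'
      exact ⟨rfl, rfl⟩
    | loop_false hb' => exact absurd hb hb'
  | loop_false hb =>
    cases h₂ with
    | loop_true hb' => exact absurd hb' hb
    | loop_false _ => exact ⟨rfl, rfl⟩
  | call hk _ ih =>
    cases h₂ with
    | call hk' h =>
      obtain rfl := Option.some.inj (hk.symm.trans hk')
      obtain ⟨rfl, rfl⟩ := ih h
      exact ⟨rfl, rfl⟩

/-- In `t` steps at most `t` cells of a real array change. -/
theorem Exec.card_changed_le {W : ℕ} {ps : List Cmd} {c : Cmd} {m m' : Mem} {t : ℕ}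
    (h : Exec W ps c m t m') (a : ℕ) (s : Finset ℕ) :
    (s.filter fun i => m'.rarr a i ≠ m.rarr a i).card ≤ t := by
  have htrans : ∀ m₁ m₂ m₃ : Mem, (s.filter fun i => m₃.rarr a i ≠ m₁.rarr a i).card ≤
      (s.filter fun i => m₂.rarr a i ≠ m₁.rarr a i).card +
        (s.filter fun i => m₃.rarr a i ≠ m₂.rarr a i).card := by
    intro m₁ m₂ m₃
    refine le_trans (Finset.card_le_card ?_) (Finset.card_union_le _ _)
    intro i
    simp only [Finset.mem_filter, Finset.mem_union]
    rintro ⟨hi, hne⟩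
    by_cases h : m₂.rarr a i = m₁.rarr a i
    · exact Or.inr ⟨hi, h ▸ hne⟩
    · exact Or.inl ⟨hi, h⟩
  induction h with
  | skip | setI | setR | storeI => simp
  | storeR m b i e =>
    refine le_trans (Finset.card_le_card (t := {i.eval m}) ?_) ?_
    · intro j
      simp only [Finset.mem_filter, Finset.mem_singleton]
      rintro ⟨-, hne⟩
      by_contra hj
      refine hne ?_
      rw [Function.update_apply]
      split_ifs with hb
      · rw [Function.update_of_ne hj, hb]
      · rfl
    · simp
  | seq _ _ ih₁ ih₂ => exact (htrans _ _ _).trans (Nat.add_le_add ih₁ ih₂)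
  | ite_true _ _ ih => exact ih.trans (Nat.le_add_left _ _)
  | ite_false _ _ ih => exact ih.trans (Nat.le_add_left _ _)
  | loop_true _ _ _ ih₁ ih₂ =>
    have := (htrans _ _ _).trans (Nat.add_le_add ih₁ ih₂)
    omega
  | loop_false => simp
  | call _ _ ih => exact ih.trans (Nat.le_add_right _ _)

theorem eq_of_isRegression_one {n : ℕ} {T : ParentTree n} {f : Fin n → ℝ}
    (h : IsLinftyIsotonicRegression T.Edge (fun _ => 1) (fun _ => 1) f) (v : Fin n) : f v = 1 := by
  have h1 := h.2 (fun _ => 1) fun _ _ _ => le_rfl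
  have h2 : linftyError (fun _ : Fin n => (1 : ℝ)) (fun _ => 1) (fun _ => 1) = 0 := by
    simp [linftyError]
  have h3 := le_linftyError (y := fun _ : Fin n => (1 : ℝ)) (w := fun _ => 1) f v
  rw [h2] at h1
  have h4 : |1 - f v| ≤ 0 := by linarith
  have := abs_nonpos_iff.1 h4
  linarith

/-- The only regression of constant data `1` with weights `1` is `1`, and all output cells start at
`0`, so `n` cells have to change. Determinism identifies the given run with the one that is known to
be correct. -/
theorem Prog.Solves.le_time {P : Prog} {W : ℕ → ℕ} (hP : P.Solves W) (n : ℕ) (T : ParentTree n)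
    {t : ℕ} {f : Fin n → ℝ} (h : P.Halts (W n) T (fun _ => 1) (fun _ => 1) t f) : n ≤ t := by
  obtain ⟨t', f', ⟨m', he', hf'⟩, hr⟩ := hP n T (fun _ => 1) (fun _ => 1) fun _ => zero_le_one
  obtain ⟨m, he, hf⟩ := h
  obtain ⟨rfl, rfl⟩ := he.deterministic he'
  have h1 := he.card_changed_le 2 (Finset.range n)
  rw [Finset.filter_true_of_mem, Finset.card_range] at h1
  · exact h1
  · intro i hi
    have h2 : m.rarr 2 i = 1 := by
      have := eq_of_isRegression_one hr ⟨i, Finset.mem_range.1 hi⟩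
      rwa [← hf'] at this
    rw [h2]
    simp [input]

/-! ### Approximate medians by sorting blocks and dropping every other element -/

open Classical in
/-- The number of the first `N` values that satisfy `p`. -/
noncomputable def cnt (p : ℝ → Prop) (Z : ℕ → ℝ) (N : ℕ) : ℕ :=
  ((Finset.range N).filter fun i => p (Z i)).card

theorem cnt_le (p : ℝ → Prop) (Z : ℕ → ℝ) (N : ℕ) : cnt p Z N ≤ N := by
  classical
  exact (Finset.card_filter_le _ _).trans_eq (Finset.card_range N)

theorem cnt_true (Z : ℕ → ℝ) (N : ℕ) : cnt (fun _ => True) Z N = N := by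
  simp [cnt]

theorem cnt_congr {p : ℝ → Prop} {Z Z' : ℕ → ℝ} {N : ℕ} (h : ∀ i < N, Z i = Z' i) :
    cnt p Z N = cnt p Z' N := by
  classical
  unfold cnt
  refine congrArg _ (Finset.filter_congr fun i hi => ?_)
  rw [h i (Finset.mem_range.1 hi)]

theorem cnt_succ (p : ℝ → Prop) [DecidablePred p] (Z : ℕ → ℝ) (N : ℕ) :
    cnt p Z (N + 1) = cnt p Z N + if p (Z N) then 1 else 0 := by
  unfold cnt
  rw [Finset.range_add_one, Finset.filter_insert]
  split_ifs
  · rw [Finset.card_insert_of_notMem (by simp)]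
  · rfl

theorem cnt_mono {p q : ℝ → Prop} {Z : ℕ → ℝ} {N : ℕ} (h : ∀ x, p x → q x) :
    cnt p Z N ≤ cnt q Z N := by
  classical
  refine Finset.card_le_card fun i => ?_
  simp only [Finset.mem_filter]
  exact fun hi => ⟨hi.1, h _ hi.2⟩

theorem cnt_add_cnt_not (p : ℝ → Prop) (Z : ℕ → ℝ) (N : ℕ) :
    cnt p Z N + cnt (fun x => ¬ p x) Z N = N := by
  classical
  have := (Finset.card_filter_add_card_filter_not (s := Finset.range N) fun i => p (Z i)).trans
    (Finset.card_range N)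
  unfold cnt
  convert this

theorem cnt_swap (p : ℝ → Prop) (Z : ℕ → ℝ) {i j N : ℕ} (hi : i < N) (hj : j < N) :
    cnt p (Function.update (Function.update Z i (Z j)) j (Z i)) N = cnt p Z N := by
  classical
  have hZ : Function.update (Function.update Z i (Z j)) j (Z i) = Z ∘ Equiv.swap i j := by
    funext k
    rw [Function.comp_apply, Equiv.swap_apply_def, Function.update_apply, Function.update_apply]
    split_ifs with h1 h2 <;> simp_all
  rw [hZ]
  refine Finset.card_nbij' (Equiv.swap i j) (Equiv.swap i j) ?_ ?_ ?_ ?_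
  · intro k hk
    simp only [Finset.coe_filter, Finset.mem_range, Set.mem_ofPred_eq, Function.comp_apply] at hk ⊢
    refine ⟨?_, hk.2⟩
    rw [Equiv.swap_apply_def]
    split_ifs <;> omega
  · intro k hk
    simp only [Finset.coe_filter, Finset.mem_range, Set.mem_ofPred_eq, Function.comp_apply,
      Equiv.swap_apply_self] at hk ⊢
    refine ⟨?_, hk.2⟩
    rw [Equiv.swap_apply_def]
    split_ifs <;> omega
  · intro k _
    simp
  · intro k _
    simp

/-- Each of the blocks of length `s` of the first `N` values is sorted. -/
def BlockSorted (s : ℕ) (Z : ℕ → ℝ) (N : ℕ) : Prop :=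
  ∀ i j, i ≤ j → j < N → i / s = j / s → Z i ≤ Z j

section
variable {p : ℝ → Prop} {Z : ℕ → ℝ} {s N : ℕ}

/-- For even `s`, an element and its neighbour that is to be kept lie in the same sorted block. -/
theorem two_mul_div_eq (hs : 2 ∣ s) (i : ℕ) : 2 * i / s = (2 * i + 1) / s := by
  obtain ⟨k, rfl⟩ := hs
  rw [← Nat.div_div_eq_div_mul, ← Nat.div_div_eq_div_mul]
  congr 1
  omega

/-- The kept element of each pair is the larger one; if it has the down-closed property, so does the
dropped one. -/
theorem two_mul_cnt_le (hp : ∀ x y, x ≤ y → p y → p x) (hs : 2 ∣ s) (hZ : BlockSorted s Z N) :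
    2 * cnt p (fun i => Z (2 * i + 1)) (N / 2) ≤ cnt p Z N := by
  classical
  set C := (Finset.range (N / 2)).filter fun i => p (Z (2 * i + 1)) with hC
  have h1 : (C.image fun i => 2 * i).card = C.card :=
    Finset.card_image_of_injective _ fun a b h => by simpa using h
  have h2 : (C.image fun i => 2 * i + 1).card = C.card :=
    Finset.card_image_of_injective _ fun a b h => by simpa using h
  have h3 : Disjoint (C.image fun i => 2 * i) (C.image fun i => 2 * i + 1) := by
    rw [Finset.disjoint_left]
    intro a ha hb
    obtain ⟨x, -, hx⟩ := Finset.mem_image.1 ha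
    obtain ⟨y, -, hy⟩ := Finset.mem_image.1 hb
    omega
  have h4 : (C.image fun i => 2 * i) ∪ (C.image fun i => 2 * i + 1) ⊆
      (Finset.range N).filter fun i => p (Z i) := by
    intro a ha
    simp only [Finset.mem_union, Finset.mem_image, hC, Finset.mem_filter, Finset.mem_range] at ha ⊢
    rcases ha with ⟨i, ⟨hi, hpi⟩, rfl⟩ | ⟨i, ⟨hi, hpi⟩, rfl⟩
    · exact ⟨by omega, hp _ _ (hZ _ _ (by omega) (by omega) (two_mul_div_eq hs i)) hpi⟩
    · exact ⟨by omega, hpi⟩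
  have h5 := Finset.card_le_card h4
  rw [Finset.card_union_of_disjoint h3, h1, h2] at h5
  change 2 * C.card ≤ ((Finset.range N).filter fun i => p (Z i)).card
  omega

/-- In a sorted block the elements with a down-closed property form an initial segment, so at most
one pair per block is split by its end. There are at most `N / s + 1` blocks. -/
theorem cnt_le_two_mul (hp : ∀ x y, x ≤ y → p y → p x) (hs : 2 ∣ s) (hZ : BlockSorted s Z N) :
    cnt p Z N ≤ 2 * cnt p (fun i => Z (2 * i + 1)) (N / 2) + (N / s + 1) := by
  classical
  set C := (Finset.range (N / 2)).filter fun i => p (Z (2 * i + 1)) with hC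
  -- The dropped elements that have the property although their kept neighbour lacks it or does not
  -- exist; at most one in each block.
  set E := (Finset.range N).filter fun j => j % 2 = 0 ∧ p (Z j) ∧ ¬ (j + 1 < N ∧ p (Z (j + 1)))
    with hE
  have h1 : (Finset.range N).filter (fun i => p (Z i)) ⊆
      ((C.image fun i => 2 * i) ∪ (C.image fun i => 2 * i + 1)) ∪ E := by
    intro a ha
    simp only [Finset.mem_union, Finset.mem_image, hC, hE, Finset.mem_filter,
      Finset.mem_range] at ha ⊢
    rcases Nat.mod_two_eq_zero_or_one a with h | h
    · by_cases h' : a + 1 < N ∧ p (Z (a + 1))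
      · refine Or.inl (Or.inl ⟨a / 2, ⟨by omega, ?_⟩, by omega⟩)
        have : 2 * (a / 2) + 1 = a + 1 := by omega
        rw [this]
        exact h'.2
      · exact Or.inr ⟨ha.1, h, ha.2, h'⟩
    · have : 2 * (a / 2) + 1 = a := by omega
      refine Or.inl (Or.inr ⟨a / 2, ⟨by omega, ?_⟩, this⟩)
      rw [this]
      exact ha.2
  have h2 : E.card ≤ N / s + 1 := by
    rw [← Finset.card_range (N / s + 1)]
    refine Finset.card_le_card_of_injOn (fun j => j / s) ?_ ?_
    · intro j hj
      simp only [hE, Finset.coe_filter, Finset.mem_range, Set.mem_ofPred_eq, Finset.coe_range,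
        Set.mem_Iio] at hj ⊢
      exact Nat.lt_succ_of_le (Nat.div_le_div_right hj.1.le)
    · have key : ∀ i j, i ∈ E → j ∈ E → i / s = j / s → i < j → False := by
        intro i j hi hj hij hlt
        simp only [hE, Finset.mem_filter, Finset.mem_range] at hi hj
        refine hi.2.2.2 ⟨by omega, hp _ _ (hZ (i + 1) j (by omega) hj.1 ?_) hj.2.2.1⟩
        have := two_mul_div_eq hs (i / 2)
        have e : 2 * (i / 2) = i := by omega
        rw [e] at this
        rw [← this, hij]
      intro i hi j hj hij
      rcases lt_trichotomy i j with h | h | h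
      · exact (key i j hi hj hij h).elim
      · exact h
      · exact (key j i hj hi hij.symm h).elim
  have h3 := Finset.card_le_card h1
  have h4 := Finset.card_union_le ((C.image fun i => 2 * i) ∪ (C.image fun i => 2 * i + 1)) E
  have h5 := Finset.card_union_le (C.image fun i => 2 * i) (C.image fun i => 2 * i + 1)
  have h6 : (C.image fun i => 2 * i).card ≤ C.card := Finset.card_image_le
  have h7 : (C.image fun i => 2 * i + 1).card ≤ C.card := Finset.card_image_le
  change ((Finset.range N).filter fun i => p (Z i)).card ≤ 2 * C.card + _
  omega

/-- The values `Z` are a sample of the values `X`: for each down-closed property, the number of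
values in `X` that have it is `M` times the number of such values in `Z`, up to a defect. -/
structure Sample (X : ℕ → ℝ) (N₀ : ℕ) (Z : ℕ → ℝ) (N : ℕ) (M E : ℝ) : Prop where
  nonneg : 0 ≤ M
  le : ∀ p : ℝ → Prop, (∀ x y, x ≤ y → p y → p x) → M * cnt p Z N ≤ cnt p X N₀
  ge : ∀ p : ℝ → Prop, (∀ x y, x ≤ y → p y → p x) → (cnt p X N₀ : ℝ) ≤ M * cnt p Z N + E

theorem Sample.congr_cnt {X Z' : ℕ → ℝ} {N₀ : ℕ} {M E : ℝ} (h : Sample X N₀ Z N M E)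
    (hc : ∀ p, cnt p Z' N = cnt p Z N) : Sample X N₀ Z' N M E :=
  ⟨h.nonneg, fun p hp => hc p ▸ h.le p hp, fun p hp => hc p ▸ h.ge p hp⟩

theorem Sample.half {X Z' : ℕ → ℝ} {N₀ : ℕ} {M E : ℝ} (h : Sample X N₀ Z N M E) (hs : 2 ∣ s)
    (hZ : BlockSorted s Z N) (hZ' : ∀ i < N / 2, Z' i = Z (2 * i + 1)) :
    Sample X N₀ Z' (N / 2) (2 * M) (E + M * (N / s + 1)) := by
  have hM := h.nonneg
  refine ⟨by linarith, fun p hp => ?_, fun p hp => ?_⟩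
  · rw [cnt_congr hZ']
    have h1 : (2 * cnt p (fun i => Z (2 * i + 1)) (N / 2) : ℝ) ≤ cnt p Z N := by
      exact_mod_cast two_mul_cnt_le hp hs hZ
    have h2 := h.le p hp
    nlinarith
  · rw [cnt_congr hZ']
    have h1 : (cnt p Z N : ℝ) ≤ 2 * cnt p (fun i => Z (2 * i + 1)) (N / 2) + ((N / s : ℕ) + 1) := by
      exact_mod_cast cnt_le_two_mul hp hs hZ
    have h2 := h.ge p hp
    have h3 : ((N / s : ℕ) : ℝ) ≤ N / s := Nat.cast_div_le
    nlinarith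

/-- Two rounds of dropping every other element. -/
theorem Sample.quarter {X Z₁ Z₂ Z₃ : ℕ → ℝ} {N₀ s₀ : ℕ} {M : ℝ} (hs : 2 ∣ s) (hs0 : 0 < s)
    (hsN : s < N) (h : Sample X N₀ Z N M (10 * N₀ * (1 / s₀ - 1 / s)))
    (hZ : BlockSorted s Z N) (hZ1 : ∀ i < N / 2, Z₁ i = Z (2 * i + 1))
    (hZ2 : ∀ p, cnt p Z₂ (N / 2) = cnt p Z₁ (N / 2)) (hZ2' : BlockSorted s Z₂ (N / 2))
    (hZ3 : ∀ i < N / 2 / 2, Z₃ i = Z₂ (2 * i + 1)) :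
    Sample X N₀ Z₃ (N / 2 / 2) (4 * M) (10 * N₀ * (1 / s₀ - 1 / (s + s : ℕ))) := by
  have hM := h.nonneg
  -- The property that always holds turns the counts into the numbers of elements.
  have hMN : M * N ≤ N₀ := by
    have := h.le (fun _ => True) fun _ _ _ _ => trivial
    rwa [cnt_true, cnt_true] at this
  have h1 := ((h.half hs hZ hZ1).congr_cnt hZ2).half hs hZ2' hZ3
  have hsR : (0 : ℝ) < s := by exact_mod_cast hs0
  have hsN' : (1 : ℝ) ≤ N / s := by
    rw [le_div_iff₀ hsR, one_mul]
    exact_mod_cast hsN.le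
  have h2 : ((N / 2 : ℕ) : ℝ) / s ≤ N / s / 2 := by
    have : ((N / 2 : ℕ) : ℝ) ≤ N / 2 := Nat.cast_div_le
    rw [div_right_comm]
    exact div_le_div_of_nonneg_right this hsR.le
  have h3 : M * (N / s) ≤ N₀ / s := by
    rw [← mul_div_assoc]
    exact div_le_div_of_nonneg_right hMN hsR.le
  refine ⟨by linarith, fun p hp => ?_, fun p hp => ?_⟩
  · have := h1.le p hp
    linarith
  · have h4 := h1.ge p hp
    -- The two halvings add at most `2 N₀ / s` and `3 N₀ / s` to the defect, and `10 (1 / s - 1 / (2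
    -- s)) = 5 / s`: the defects of all rounds telescope.
    have h5 : (10 : ℝ) * N₀ * (1 / s₀ - 1 / (s + s : ℕ)) =
        10 * N₀ * (1 / s₀ - 1 / s) + 5 * (N₀ / s) := by
      push_cast
      field_simp
      ring
    rw [h5]
    have h6 : M * (N / s + 1) ≤ 2 * (N₀ / s) := by nlinarith
    have h7 : 2 * M * (((N / 2 : ℕ) : ℝ) / s + 1) ≤ 3 * (N₀ / s) := by nlinarith
    linarith

/-- The median of a good sample splits the values evenly enough. -/
theorem Sample.median {X : ℕ → ℝ} {N₀ : ℕ} {M E : ℝ} (h : Sample X N₀ Z N M E)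
    (hE : 4 * E ≤ N₀) (hN : 0 < N) (hZ : BlockSorted s Z N) (hNs : N ≤ s) :
    4 * cnt (fun x => x < Z (N / 2)) X N₀ ≤ 3 * N₀ ∧
      4 * cnt (fun x => Z (N / 2) < x) X N₀ ≤ 3 * N₀ := by
  classical
  have hM := h.nonneg
  have hsort : ∀ i j, i ≤ j → j < N → Z i ≤ Z j := fun i j hij hj =>
    hZ i j hij hj (by rw [Nat.div_eq_of_lt (by omega), Nat.div_eq_of_lt (by omega)])
  have hMN := h.le (fun _ => True) fun _ _ _ _ => trivial
  have hMN' := h.ge (fun _ => True) fun _ _ _ _ => trivial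
  rw [cnt_true, cnt_true] at hMN hMN'
  have h1 : cnt (fun x => x < Z (N / 2)) Z N ≤ N / 2 := by
    refine (Finset.card_le_card (t := Finset.range (N / 2)) fun i => ?_).trans_eq
      (Finset.card_range _)
    simp only [Finset.mem_filter, Finset.mem_range]
    rintro ⟨hi, hlt⟩
    by_contra hcon
    exact absurd hlt (not_lt.2 (hsort _ _ (not_lt.1 hcon) hi))
  have h2 : N / 2 + 1 ≤ cnt (fun x => x ≤ Z (N / 2)) Z N := by
    refine (Finset.card_range _).symm.trans_le
      (Finset.card_le_card (s := Finset.range (N / 2 + 1)) fun i => ?_)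
    simp only [Finset.mem_filter, Finset.mem_range]
    exact fun hi => ⟨by omega, hsort _ _ (by omega) (by omega)⟩
  have h1' : (cnt (fun x => x < Z (N / 2)) Z N : ℝ) ≤ N / 2 :=
    (Nat.cast_le.2 h1).trans Nat.cast_div_le
  have h2' : (N : ℝ) ≤ 2 * cnt (fun x => x ≤ Z (N / 2)) Z N := by
    exact_mod_cast (by omega : N ≤ 2 * cnt (fun x => x ≤ Z (N / 2)) Z N)
  have h3 := h.ge (fun x => x < Z (N / 2)) fun x y hxy hy => hxy.trans_lt hy
  have h4 := h.le (fun x => x ≤ Z (N / 2)) fun x y hxy hy => hxy.trans hy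
  have h5 := cnt_add_cnt_not (fun x => x ≤ Z (N / 2)) X N₀
  simp only [not_le] at h5
  have h5' : (cnt (fun x => x ≤ Z (N / 2)) X N₀ : ℝ) + cnt (fun x => Z (N / 2) < x) X N₀ = N₀ := by
    exact_mod_cast h5
  -- Below the median lie at most `M N / 2 + E ≤ N₀ / 2 + N₀ / 4` values. Above it lie at most `N₀ -
  -- M N / 2`, where `M N ≥ N₀ - E ≥ 3 N₀ / 4`.
  constructor
  · have : (4 * cnt (fun x => x < Z (N / 2)) X N₀ : ℝ) ≤ 3 * N₀ := by nlinarith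
    exact_mod_cast this
  · have : (4 * cnt (fun x => Z (N / 2) < x) X N₀ : ℝ) ≤ 3 * N₀ := by nlinarith
    exact_mod_cast this

end

/-! ### Insertion sort of blocks -/

/-- The first `i + 1` values are sorted in blocks, but for the value at `j`, which may have to
move to the left. -/
structure Inserting (s : ℕ) (Z : ℕ → ℝ) (i j : ℕ) : Prop where
  le : j ≤ i
  sorted : ∀ a b, a ≤ b → b ≤ i → a / s = b / s → a ≠ j → b ≠ j → Z a ≤ Z b
  after : ∀ b, j < b → b ≤ i → j / s = b / s → Z j ≤ Z b

theorem Inserting.start {s : ℕ} {Z : ℕ → ℝ} {i : ℕ} (h : BlockSorted s Z i) :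
    Inserting s Z i i :=
  ⟨le_rfl, fun a b hab hb hs _ hbi => h a b hab (by omega) hs, fun b h1 h2 => by omega⟩

theorem pred_div_eq {s j : ℕ} (hs : 0 < s) (h : 0 < j - j / s * s) : (j - 1) / s = j / s :=
  le_antisymm (Nat.div_le_div_right (by omega))
    ((Nat.le_div_iff_mul_le hs).2 (by omega))

theorem Inserting.move {s : ℕ} {Z : ℕ → ℝ} {i j : ℕ} (hs : 0 < s) (h : Inserting s Z i j)
    (h1 : 0 < j - j / s * s) (h2 : Z j < Z (j - 1)) :
    Inserting s (Function.update (Function.update Z j (Z (j - 1))) (j - 1) (Z j)) i (j - 1) := by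
  have hj := h.le
  have hd := pred_div_eq hs h1
  refine ⟨by omega, fun a b hab hb hs' ha hb' => ?_, fun b hb hbi hs' => ?_⟩
  · rw [Function.update_of_ne ha, Function.update_of_ne hb', Function.update_apply,
      Function.update_apply]
    split_ifs with h3 h4 h4
    · exact le_rfl
    · exact h.sorted _ _ (by omega) hb (by rw [hd, ← h3, hs']) (by omega) h4
    · exact h.sorted _ _ (by omega) (by omega) (by rw [hd, ← h4, hs']) h3 (by omega)
    · exact h.sorted _ _ hab hb hs' h3 h4
  · rw [Function.update_self, Function.update_of_ne (by omega), Function.update_apply]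
    split_ifs with h3
    · exact h2.le
    · exact h.after b (by omega) hbi (by rw [← hd, hs'])

/-- The insertion stops at the left end of the block or next to a value that is not larger; that
value dominates everything before it in the block. -/
theorem Inserting.done {s : ℕ} {Z : ℕ → ℝ} {i j : ℕ} (hs : 0 < s) (h : Inserting s Z i j)
    (h1 : ¬ (0 < j - j / s * s ∧ Z j < Z (j - 1))) : BlockSorted s Z (i + 1) := by
  intro a b hab hb hs'
  by_cases haj : a = j
  · rcases hab.eq_or_lt with h2 | h2
    · rw [h2]
    · rw [haj]
      exact h.after b (by omega) (by omega) (by rw [← haj, hs'])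
  · by_cases hbj : b = j
    · have h2 : 0 < j - j / s * s := by
        have := Nat.div_mul_le_self a s
        rw [hs', hbj] at this
        omega
      have h3 : Z (j - 1) ≤ Z j := not_lt.1 fun h' => h1 ⟨h2, h'⟩
      have hj := h.le
      rw [hbj]
      refine le_trans ?_ h3
      exact h.sorted a (j - 1) (by omega) (by omega) (by rw [pred_div_eq hs h2, hs', hbj]) haj
        (by omega)
    · exact h.sorted a b hab (by omega) hs' haj hbj

infixr:60 ";;" => Cmd.seq

/-- Moves the value at `ireg 9` of real array `8` to its place in its block. -/
def insertLoop : Cmd :=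
  .loop (.and (.ilt (.const 0) (.sub (.reg 9) (.mul (.div (.reg 9) (.reg 8)) (.reg 8))))
      (.rlt (.arr 8 (.reg 9)) (.arr 8 (.sub (.reg 9) (.const 1)))))
    (.setR 7 (.arr 8 (.reg 9)) ;;
      .storeR 8 (.reg 9) (.arr 8 (.sub (.reg 9) (.const 1))) ;;
      .storeR 8 (.sub (.reg 9) (.const 1)) (.reg 7) ;;
      .setI 9 (.sub (.reg 9) (.const 1)))

/-- Sorts the blocks of length `ireg 8` of the first `ireg 10` values of real array `8`. -/
def sortBlocks : Cmd :=
  .forLoop 2 10 (.setI 9 (.reg 2) ;; insertLoop)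

theorem insertLoop_runs {W s N i : ℕ} {m : Mem} (hs : 0 < s) (hms : m.ireg 8 = s)
    (hi : m.ireg 9 = i) (hiN : i < N) (hNW : N ≤ W) (hZ : BlockSorted s (m.rarr 8) i) :
    Runs W insertLoop m ((s + 1) * 100) fun m' => BlockSorted s (m'.rarr 8) (i + 1) ∧
      ∀ p, cnt p (m'.rarr 8) N = cnt p (m.rarr 8) N := by
  -- The potential counts the places between the moving value and the start of its block.
  refine (Runs.loop (fun m' => Inserting s (m'.rarr 8) i (m'.ireg 9) ∧ m'.ireg 8 = s ∧
    ∀ p, cnt p (m'.rarr 8) N = cnt p (m.rarr 8) N)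
    (fun m' => (m'.ireg 9 - m'.ireg 9 / s * s + 1) * 100) ⟨hi ▸ Inserting.start (hi ▸ hZ), hms,
      fun _ => rfl⟩ ?_ ?_).mono ?_ ?_
  · intro m' _ _
    simp only [BExp.cost, IExp.cost, RExp.cost]
    omega
  · rintro m' ⟨hI, hs8, hc⟩ - hb
    simp only [BExp.Holds, IExp.eval, RExp.eval, hs8] at hb
    refine ⟨_, Cmd.runs_of_wp ?_⟩
    have hle := hI.le
    simp only [Cmd.wp, IExp.eval, RExp.eval, Function.update_self]
    have hmv := hI.move hs hb.1 hb.2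
    refine ⟨by omega, ⟨?_, ?_, ?_⟩, ?_⟩
    · simpa using hmv
    · simp [hs8]
    · intro p
      rw [← hc p]
      exact cnt_swap p (m'.rarr 8) (by omega) (by omega)
    · simp only [Cmd.time, BExp.cost, IExp.cost, RExp.cost]
      rw [pred_div_eq hs hb.1]
      omega
  · refine Nat.mul_le_mul_right _ (Nat.succ_le_succ ?_)
    have := Nat.mod_lt (m.ireg 9) hs
    have h2 := Nat.mod_add_div (m.ireg 9) s
    rw [mul_comm] at h2
    omega
  · rintro m' ⟨⟨hI, hs8, hc⟩, hb⟩ -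
    simp only [BExp.Holds, IExp.eval, RExp.eval, hs8] at hb
    exact ⟨hI.done hs hb, hc⟩

theorem sortBlocks_runs {W s N : ℕ} {m : Mem} (hs : 0 < s) (hms : m.ireg 8 = s)
    (hmN : m.ireg 10 = N) (hNW : N ≤ W) :
    Runs W sortBlocks m ((N + 1) * ((s + 1) * 100 + 12)) fun m' => BlockSorted s (m'.rarr 8) N ∧
      ∀ p, cnt p (m'.rarr 8) N = cnt p (m.rarr 8) N := by
  refine (Runs.forLoop (T := (s + 1) * 100 + 2) (fun j m' => BlockSorted s (m'.rarr 8) j ∧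
    ∀ p, cnt p (m'.rarr 8) N = cnt p (m.rarr 8) N) hmN hNW (by decide) (by decide) (by decide)
    (fun _ _ _ h => h) ?_ ?_).mono le_rfl fun _ h _ => h
  · exact ⟨fun i j _ hj => absurd hj (by omega), fun _ => rfl⟩
  · rintro j m' hj ⟨hS, hc⟩ hF h2 -
    have hs8 : m'.ireg 8 = s := by rw [hF.ireg 8 (by decide), hms]
    refine ((Runs.setI (Q := fun m₁ => m₁.ireg 9 = j ∧ m₁.ireg 8 = s ∧ m₁.rarr = m'.rarr)
      (by simp only [IExp.eval]; omega) ⟨by simp [IExp.eval, h2], by simp [hs8], rfl⟩).seq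
      (T₂ := (s + 1) * 100) fun m₁ ⟨h3, h4, h5⟩ _ => ?_).mono (by simp [IExp.cost]; omega)
      fun _ h _ => h
    refine (insertLoop_runs hs h4 h3 hj hNW (h5 ▸ hS)).mono le_rfl fun m₂ h _ => ⟨h.1, fun p => ?_⟩
    rw [h.2 p, h5, hc p]

/-! ### Reduction to a sorted sample and the approximate median -/

/-- Keeps every other value of real array `8`. -/
def halve : Cmd :=
  .setI 10 (.div (.reg 10) (.const 2)) ;;
  .forLoop 2 10 (.storeR 8 (.reg 2) (.arr 8 (.add (.add (.reg 2) (.reg 2)) (.const 1))))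

theorem halve_runs {W N : ℕ} {m : Mem} (hmN : m.ireg 10 = N) (hNW : N ≤ W) :
    Runs W halve m ((N + 2) * 30) fun m' => m'.ireg 10 = N / 2 ∧
      ∀ i < N / 2, m'.rarr 8 i = m.rarr 8 (2 * i + 1) := by
  refine ((Runs.setI (Q := fun m₁ => m₁.ireg 10 = N / 2 ∧ m₁.rarr = m.rarr)
    (by simp only [IExp.eval]; omega) ⟨by simp [IExp.eval, hmN], rfl⟩).seq
    (T₂ := (N / 2 + 1) * 20) fun m₁ ⟨h1, h2⟩ _ => ?_).mono (by simp [IExp.cost]; omega)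
    fun _ h _ => h
  -- Halving in place is safe: the cell `2 j + 1` that is read has not been overwritten when cell
  -- `j` is written.
  refine ((Runs.forLoop (T := 10) (fun j m' => (∀ i < j, m'.rarr 8 i = m.rarr 8 (2 * i + 1)) ∧
    ∀ i ≥ j, m'.rarr 8 i = m.rarr 8 i) h1 (by omega) (by decide) (by decide) (by decide)
    (fun _ _ _ h => h) ⟨fun i hi => absurd hi (by omega), fun i _ => by rw [h2]⟩ ?_)).mono le_rfl
    fun m' h hF => ⟨by rw [hF.ireg 10 (by decide), h1], h.1⟩
  rintro j m' hj ⟨h3, h4⟩ hF hj2 -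
  refine (Cmd.runs_of_wp ?_).mono (T := Cmd.time _) (by decide) fun _ h _ => h
  simp only [Cmd.wp, IExp.eval, RExp.eval, Function.update_self, hj2]
  refine ⟨fun i hi => ?_, fun i hi => ?_⟩
  · rcases Nat.lt_succ_iff_lt_or_eq.1 hi with hi | rfl
    · rw [Function.update_of_ne (by omega), h3 i hi]
    · rw [Function.update_self, h4 _ (by omega)]
      congr 1
      omega
  · rw [Function.update_of_ne (by omega), h4 i (by omega)]

/-- Reduces the first `ireg 10` values of real array `8` to a sorted sample. -/
def sampleLoop : Cmd :=
  .loop (.ilt (.reg 8) (.reg 10))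
    (sortBlocks ;; halve ;; sortBlocks ;; halve ;; .setI 8 (.add (.reg 8) (.reg 8)))

theorem sampleLoop_step {W s s₀ N N₀ : ℕ} {X : ℕ → ℝ} {M : ℝ} {m : Mem} (hs : 0 < s)
    (hs2 : 2 ∣ s) (hms : m.ireg 8 = s) (hmN : m.ireg 10 = N) (hNW : 2 * N ≤ W) (hsN : s < N)
    (hX : Sample X N₀ (m.rarr 8) N M (10 * N₀ * (1 / s₀ - 1 / s))) :
    Runs W (sortBlocks ;; halve ;; sortBlocks ;; halve ;; .setI 8 (.add (.reg 8) (.reg 8))) m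
      (N * s * 1000) fun m' => m'.ireg 8 = s + s ∧ m'.ireg 10 = N / 2 / 2 ∧
        Sample X N₀ (m'.rarr 8) (N / 2 / 2) (4 * M) (10 * N₀ * (1 / s₀ - 1 / (s + s : ℕ))) := by
  have hN : 1 ≤ N := by omega
  have htime : (N + 1) * ((s + 1) * 100 + 12) + ((N + 2) * 30 + ((N / 2 + 1) * ((s + 1) * 100 + 12)
      + ((N / 2 + 2) * 30 + 4))) ≤ N * s * 1000 := by
    obtain ⟨k, rfl⟩ : ∃ k, s = k + 1 := ⟨s - 1, by omega⟩
    obtain ⟨l, rfl⟩ : ∃ l, N = l + 1 := ⟨N - 1, by omega⟩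
    have h2 : (l + 1) / 2 ≤ l + 1 := Nat.div_le_self _ _
    have h3 : ((l + 1) / 2 + 1) * ((k + 1 + 1) * 100 + 12) ≤
      (l + 2) * ((k + 2) * 100 + 12) := Nat.mul_le_mul_right _ (by omega)
    nlinarith
  refine ((sortBlocks_runs hs hms hmN (by omega)).seq (T₂ := (N + 2) * 30 +
    ((N / 2 + 1) * ((s + 1) * 100 + 12) + ((N / 2 + 2) * 30 + 4)))
    fun m₁ ⟨b1, c1⟩ F1 => ?_).mono htime fun _ h _ => h
  have e1 : m₁.ireg 8 = s := by rw [F1.ireg 8 (by decide), hms]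
  have e2 : m₁.ireg 10 = N := by rw [F1.ireg 10 (by decide), hmN]
  refine (halve_runs e2 (by omega)).seq fun m₂ ⟨n2, z2⟩ F2 => ?_
  have e3 : m₂.ireg 8 = s := by rw [F2.ireg 8 (by decide), e1]
  refine (sortBlocks_runs hs e3 n2 (by omega)).seq fun m₃ ⟨b3, c3⟩ F3 => ?_
  have e4 : m₃.ireg 8 = s := by rw [F3.ireg 8 (by decide), e3]
  have e5 : m₃.ireg 10 = N / 2 := by rw [F3.ireg 10 (by decide), n2]
  refine (halve_runs e5 (by omega)).seq fun m₄ ⟨n4, z4⟩ F4 => ?_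
  have e6 : m₄.ireg 8 = s := by rw [F4.ireg 8 (by decide), e4]
  refine Runs.setI (by simp only [IExp.eval]; omega) ⟨?_, ?_, ?_⟩
  · simp [IExp.eval, e6]
  · simp [n4]
  · exact Sample.quarter hs2 hs hsN (hX.congr_cnt c1) b1 z2 c3 b3 z4

theorem sampleLoop_runs {W N₀ : ℕ} {m : Mem} (hms : m.ireg 8 = 40) (hmN : m.ireg 10 = N₀)
    (hN₀ : 0 < N₀) (hNW : 2 * N₀ ≤ W) :
    Runs W sampleLoop m (N₀ * 40 * 2010 + 4) fun m' => ∃ N s M E, m'.ireg 8 = s ∧ m'.ireg 10 = N ∧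
      0 < s ∧ 0 < N ∧ N ≤ s ∧ N * s ≤ N₀ * 40 ∧ N ≤ N₀ ∧
      Sample (m.rarr 8) N₀ (m'.rarr 8) N M E ∧ 4 * E ≤ N₀ := by
  -- An iteration costs about `1000 N s`; it quarters `N` and doubles `s`, so `N s` is at least
  -- halved and a potential of about `2000 N s` pays for everything.
  refine (Runs.loop (fun m' => ∃ N s M, m'.ireg 8 = s ∧ m'.ireg 10 = N ∧ 40 ≤ s ∧ 2 ∣ s ∧ 0 < N ∧
      N * s ≤ N₀ * 40 ∧ N ≤ N₀ ∧
      Sample (m.rarr 8) N₀ (m'.rarr 8) N M (10 * N₀ * (1 / (40 : ℕ) - 1 / s)))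
    (fun m' => m'.ireg 10 * m'.ireg 8 * 2010 + 4) ?_ ?_ ?_).mono ?_ ?_
  · exact ⟨N₀, 40, 1, hms, hmN, by omega, by omega, hN₀, le_rfl, le_rfl, zero_le_one,
      fun p _ => by simp, fun p _ => by simp⟩
  · intro m' _ _
    simp only [BExp.cost, IExp.cost]
    omega
  · rintro m' ⟨N, s, M, h8, h10, hs, hs2, hN, hNs, hNN, hS⟩ - hb
    simp only [BExp.Holds, IExp.eval, h8, h10] at hb
    refine ⟨_, (sampleLoop_step (by omega) hs2 h8 h10 (by omega) hb hS).mono le_rfl ?_⟩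
    rintro m'' ⟨g1, g2, g3⟩ -
    have hq : N / 2 / 2 * (s + s) ≤ N * s / 2 := by
      rw [Nat.le_div_iff_mul_le (by omega)]
      have : N / 2 / 2 * 4 ≤ N := by omega
      calc N / 2 / 2 * (s + s) * 2 = N / 2 / 2 * 4 * s := by ring
        _ ≤ N * s := Nat.mul_le_mul_right _ this
    refine ⟨⟨_, _, _, g1, g2, by omega, by omega, by omega, by omega, by omega, g3⟩, ?_⟩
    · rw [g1, g2, h8, h10]
      simp only [BExp.cost, IExp.cost]
      have : 1 ≤ N * s := Nat.mul_pos hN (by omega)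
      omega
  · rw [hms, hmN]
  · rintro m' ⟨⟨N, s, M, h8, h10, hs, hs2, hN, hNs, hNN, hS⟩, hb⟩ -
    simp only [BExp.Holds, IExp.eval, h8, h10] at hb
    -- The initial block length `40` is chosen for this: the total defect is at most `10 N₀ / 40 =
    -- N₀ / 4`.
    refine ⟨N, s, M, _, h8, h10, by omega, hN, by omega, hNs, hNN, hS, ?_⟩
    have : (0 : ℝ) ≤ 1 / s := by positivity
    have hN0 : (0 : ℝ) ≤ N₀ := by positivity
    push_cast
    nlinarith [mul_nonneg hN0 this]

/-- Sets `rreg 2` to an approximate median of the first `ireg 5` values of real array `7`. -/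
def pivot : Cmd :=
  .forLoop 2 5 (.storeR 8 (.reg 2) (.arr 7 (.reg 2))) ;;
  .setI 10 (.reg 5) ;;
  .setI 8 (.const 40) ;;
  sampleLoop ;;
  sortBlocks ;;
  .setR 2 (.arr 8 (.div (.reg 10) (.const 2)))

theorem pivot_runs {W N₀ : ℕ} {m : Mem} (hmN : m.ireg 5 = N₀) (hN₀ : 0 < N₀) (hNW : 2 * N₀ ≤ W)
    (hW : 40 ≤ W) :
    Runs W pivot m (N₀ * 100000) fun m' =>
      4 * cnt (fun x => x < m'.rreg 2) (m.rarr 7) N₀ ≤ 3 * N₀ ∧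
      4 * cnt (fun x => m'.rreg 2 < x) (m.rarr 7) N₀ ≤ 3 * N₀ := by
  refine ((Runs.forLoop (T := 5) (fun j m' => ∀ i < j, m'.rarr 8 i = m.rarr 7 i) hmN (by omega)
    (by decide) (by decide) (by decide) (fun _ _ _ h => h) (fun i hi => absurd hi (by omega))
    ?_).seq (T₂ := 2 + (2 + ((N₀ * 40 * 2010 + 4) + ((N₀ * 40 + N₀) * 100 + N₀ * 40 * 100
      + N₀ * 100 + 1000 + 10)))) fun m₁ z1 F1 => ?_).mono (by omega) fun _ h _ => h
  · rintro j m' hj hZ hF hj2 -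
    refine (Cmd.runs_of_wp ?_).mono (T := Cmd.time _) (by decide) fun _ h _ => h
    simp only [Cmd.wp, IExp.eval, RExp.eval, Function.update_self, hj2]
    intro i hi
    rw [hF.rarr 7 (by decide)]
    rcases Nat.lt_succ_iff_lt_or_eq.1 hi with hi | rfl
    · rw [Function.update_of_ne (by omega), hZ i hi]
    · rw [Function.update_self]
  have e1 : m₁.ireg 5 = N₀ := by rw [F1.ireg 5 (by decide), hmN]
  refine (Runs.setI (Q := fun m' => m'.ireg 10 = N₀ ∧ m'.rarr = m₁.rarr)
    (by simp only [IExp.eval]; omega) ⟨by simp [IExp.eval, e1], rfl⟩).seq fun m₂ ⟨e2, z2⟩ _ => ?_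
  refine (Runs.setI (Q := fun m' => m'.ireg 10 = N₀ ∧ m'.rarr = m₁.rarr ∧ m'.ireg 8 = 40)
    (by simp only [IExp.eval]; omega) ⟨by simp [e2], z2, by simp [IExp.eval]⟩).seq
    fun m₃ ⟨e3, z3, e3'⟩ _ => ?_
  refine (sampleLoop_runs e3' e3 hN₀ hNW).seq fun m₄ ⟨N, s, M, E, h8, h10, hs, hN, hNs, h40, hNN,
    hS, hE⟩ _ => ?_
  refine ((sortBlocks_runs hs h8 h10 (by omega)).seq (T₂ := 5) fun m₅ ⟨b5, c5⟩ F5 => ?_).mono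
    ?_ fun _ h _ => h
  · have e5 : m₅.ireg 10 = N := by rw [F5.ireg 10 (by decide), h10]
    refine Runs.setR ?_
    simp only [RExp.eval, IExp.eval, Function.update_self, e5]
    have := (hS.congr_cnt c5).median hE hN b5 hNs
    rw [z3] at this
    rwa [cnt_congr (Z := m₁.rarr 8) (Z' := m.rarr 7) z1, cnt_congr (Z := m₁.rarr 8) z1] at this
  · have h1 : N * s ≤ N₀ * 40 := h40
    have h2 : s ≤ N * s := Nat.le_mul_of_pos_left s hN
    have h3 : (N + 1) * ((s + 1) * 100 + 12) = 100 * (N * s) + 112 * N + 100 * s + 112 := by ring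
    rw [h3]
    generalize N * s = q at *
    omega

/-! ### The pairing of vertices -/

section
variable {par : ℕ → ℕ} {L P Q : List ℕ} {v : ℕ} {mu ch sl sr : ℕ → ℕ}

/-- Of each vertex `v`, one child in `P` is recorded as `ch v - 1`, and `mu v` tells whether there
are several. -/
structure ChildInv (par : ℕ → ℕ) (L P : List ℕ) (mu ch : ℕ → ℕ) : Prop where
  none : ∀ v ∈ L, ch v = 0 → ∀ y ∈ P, par y = v → y = v
  some : ∀ v ∈ L, ∀ c, ch v = c + 1 → c ∈ P ∧ par c = v ∧ c ≠ v
  single : ∀ v ∈ L, mu v = 0 → ∀ y ∈ P, par y = v → y ≠ v → ch v = y + 1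
  multiple : ∀ v ∈ L, mu v ≠ 0 → ∃ y ∈ P, ∃ y' ∈ P, par y = v ∧ par y' = v ∧ y ≠ v ∧ y' ≠ v ∧ y ≠ y'

theorem ChildInv.step_root (h : ChildInv par L P mu ch) (hv : par v = v) :
    ChildInv par L (P ++ [v]) mu ch := by
  have key : ∀ w y, y ∈ P ++ [v] → par y = w → y ≠ w → y ∈ P := by
    intro w y hy hp hne
    rcases List.mem_append.1 hy with hy | hy
    · exact hy
    · rw [List.mem_singleton] at hy
      subst hy
      exact absurd (hv.symm.trans hp) hne
  refine ⟨fun w hw h0 y hy hp => ?_, fun w hw c hc => ?_, fun w hw h0 y hy hp hne => ?_,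
    fun w hw h0 => ?_⟩
  · by_contra hne
    exact hne (h.none w hw h0 y (key w y hy hp hne) hp)
  · obtain ⟨h1, h2⟩ := h.some w hw c hc
    exact ⟨List.mem_append_left _ h1, h2⟩
  · exact h.single w hw h0 y (key w y hy hp hne) hp hne
  · obtain ⟨y, hy, y', hy', h1⟩ := h.multiple w hw h0
    exact ⟨y, List.mem_append_left _ hy, y', List.mem_append_left _ hy', h1⟩

theorem ChildInv.step (h : ChildInv par L P mu ch) (hvP : v ∉ P) (hv : par v ≠ v)
    (hpL : par v ∈ L) :
    ChildInv par L (P ++ [v]) (if ch (par v) = 0 then mu else Function.update mu (par v) 1)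
      (Function.update ch (par v) (v + 1)) := by
  have hvm : v ∈ P ++ [v] := by simp
  refine ⟨fun w hw h0 y hy hp => ?_, fun w hw c hc => ?_, fun w hw h0 y hy hp hne => ?_,
    fun w hw h0 => ?_⟩
  · rw [Function.update_apply] at h0
    split_ifs at h0 with hwp
    rcases List.mem_append.1 hy with hy | hy
    · exact h.none w hw h0 y hy hp
    · rw [List.mem_singleton] at hy
      subst hy
      exact absurd hp.symm hwp
  · rw [Function.update_apply] at hc
    split_ifs at hc with hwp
    · have : c = v := by omega
      subst this
      exact ⟨hvm, hwp.symm, fun h => hv (by rw [← hwp, h])⟩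
    · obtain ⟨h1, h2⟩ := h.some w hw c hc
      exact ⟨List.mem_append_left _ h1, h2⟩
  · have old : w ≠ par v → mu w = 0 → Function.update ch (par v) (v + 1) w = y + 1 := by
      intro hwp h0
      rw [Function.update_of_ne hwp]
      rcases List.mem_append.1 hy with hy | hy
      · exact h.single w hw h0 y hy hp hne
      · rw [List.mem_singleton] at hy
        subst hy
        exact absurd hp.symm hwp
    by_cases hwp : w = par v
    · rw [hwp, Function.update_self]
      split_ifs at h0 with h1
      · rcases List.mem_append.1 hy with hy | hy
        · rw [hwp] at hp hne
          exact absurd (h.none _ hpL h1 y hy hp) hne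
        · rw [List.mem_singleton.1 hy]
      · rw [hwp, Function.update_self] at h0
        exact absurd h0 one_ne_zero
    · refine old hwp ?_
      split_ifs at h0 with h1
      · exact h0
      · rwa [Function.update_of_ne hwp] at h0
  · have old : mu w ≠ 0 → ∃ y ∈ P ++ [v], ∃ y' ∈ P ++ [v], par y = w ∧ par y' = w ∧ y ≠ w ∧
        y' ≠ w ∧ y ≠ y' := by
      intro h0
      obtain ⟨y, hy, y', hy', h1⟩ := h.multiple w hw h0
      exact ⟨y, List.mem_append_left _ hy, y', List.mem_append_left _ hy', h1⟩
    split_ifs at h0 with h1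
    · exact old h0
    · rw [Function.update_apply] at h0
      split_ifs at h0 with hwp
      · obtain ⟨c, hc⟩ := Nat.exists_eq_succ_of_ne_zero h1
        obtain ⟨h2, h3, h4⟩ := h.some _ hpL c hc
        subst hwp
        exact ⟨c, List.mem_append_left _ h2, v, hvm, h3, rfl, h4, Ne.symm hv,
          fun h => hvP (h ▸ h2)⟩
      · exact old h0

/-- All children of `v` precede it in the list, so they have been recorded by the time `v` is
reached. -/
theorem ChildInv.leaf_iff (h : ChildInv par L P mu ch) (hT : TreeList par L)
    (hL : L = P ++ v :: Q) : Leaf par L v ↔ ch v = 0 := by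
  have hv : v ∈ L := by simp [hL]
  constructor
  · intro hl
    by_contra h0
    obtain ⟨c, hc⟩ := Nat.exists_eq_succ_of_ne_zero h0
    obtain ⟨h1, h2, h3⟩ := h.some v hv c hc
    exact h3 (hl c (by simp [hL, h1]) h2)
  · intro h0 y hy hp
    by_contra hne
    exact hne (h.none v hv h0 y (hT.child_before hL hy hp hne) hp)

/-- The state of the pairing when the vertices in `P` have been processed; `sl p - 1` is a leaf
child of `p` that waits for a partner. -/
structure PairInv (par : ℕ → ℕ) (L P : List ℕ) (sl sr : ℕ → ℕ) : Prop where
  slot : ∀ p ∈ L, p ∉ P → ∀ x, sl p = x + 1 → x ∈ P ∧ par x = p ∧ Leaf par L x ∧ sr x = 0 ∧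
    ∀ t ∈ L, sr t ≠ x + 1
  source : ∀ t ∈ L, ∀ x, sr t = x + 1 → t ∈ P ∧ x ∈ P ∧ x ≠ t ∧ par x ≠ x ∧ sr x = 0
  inj : ∀ t ∈ L, ∀ t' ∈ L, sr t = sr t' → sr t ≠ 0 → t = t'
  shape : ∀ t ∈ L, ∀ x, sr t = x + 1 →
    (Leaf par L x ∧ par x = par t ∧ par t ≠ t) ∨
    (par x = t ∧ (Leaf par L x ∨ ∀ y ∈ L, par y = t → y ≠ t → y = x))
  leaf : ∀ x ∈ P, par x ≠ x → Leaf par L x →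
    sr x ≠ 0 ∨ (∃ t ∈ L, sr t = x + 1) ∨ (par x ∉ P ∧ sl (par x) = x + 1)
  unary : ∀ w ∈ P, sr w = 0 → ∀ c ∈ L, par c = w → c ≠ w →
    (∀ y ∈ L, par y = w → y ≠ w → y = c) → sr c ≠ 0 ∧ ¬ Leaf par L c

theorem PairInv.nil (h1 : ∀ v ∈ L, sl v = 0) (h2 : ∀ v ∈ L, sr v = 0) :
    PairInv par L [] sl sr :=
  ⟨fun p hp _ x hx => by rw [h1 p hp] at hx; omega, fun t ht x hx => by rw [h2 t ht] at hx; omega,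
   fun t ht _ _ _ h0 => absurd (h2 t ht) h0, fun t ht x hx => by rw [h2 t ht] at hx; omega,
   fun x hx => absurd hx (by simp), fun x hx => absurd hx (by simp)⟩

theorem PairInv.pairing (h : PairInv par L L sl sr) : Pairing par L sr :=
  ⟨fun t ht x hx => ⟨(h.source t ht x hx).2.1, (h.source t ht x hx).2.2⟩, h.inj, h.shape⟩

theorem TreeList.not_mem_left (hT : TreeList par L) (hL : L = P ++ v :: Q) : v ∉ P := by
  have := hT.nodup
  rw [hL, List.nodup_append] at this
  exact fun h' => this.2.2 v h' v (by simp) rfl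

theorem PairInv.sr_eq_zero (h : PairInv par L P sl sr) (hv : v ∈ L) (hvP : v ∉ P) : sr v = 0 := by
  by_contra h0
  obtain ⟨c, hc⟩ := Nat.exists_eq_succ_of_ne_zero h0
  exact hvP (h.source v hv c hc).1

/-- A leaf that waits for a partner, or the root. -/
theorem PairInv.step_leaf (h : PairInv par L P sl sr) (hT : TreeList par L)
    (hL : L = P ++ v :: Q) (hl : Leaf par L v) {sl' : ℕ → ℕ}
    (hsl : (par v = v ∧ sl' = sl) ∨
      (par v ≠ v ∧ sl (par v) = 0 ∧ sl' = Function.update sl (par v) (v + 1))) :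
    PairInv par L (P ++ [v]) sl' sr := by
  have hv : v ∈ L := by simp [hL]
  have hvP := hT.not_mem_left hL
  have hPL : ∀ x ∈ P, x ∈ L := fun x hx => by simp [hL, hx]
  have hsr := h.sr_eq_zero hv hvP
  have hch : ∀ c ∈ L, par c = v → c = v := hl
  refine ⟨fun p hp hpP x hx => ?_, fun t ht x hx => ?_, h.inj, h.shape, fun x hx hne hlx => ?_,
    fun w hw h0 c hc hcw hne huniq => ?_⟩
  · have hpP' : p ∉ P := fun h' => hpP (List.mem_append_left _ h')
    have old : sl p = x + 1 → x ∈ P ++ [v] ∧ par x = p ∧ Leaf par L x ∧ sr x = 0 ∧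
        ∀ t ∈ L, sr t ≠ x + 1 := fun hx => by
      obtain ⟨h1, h2⟩ := h.slot p hp hpP' x hx
      exact ⟨List.mem_append_left _ h1, h2⟩
    rcases hsl with ⟨h1, rfl⟩ | ⟨h1, h2, rfl⟩
    · exact old hx
    · rw [Function.update_apply] at hx
      split_ifs at hx with hpv
      · have : x = v := by omega
        subst this
        exact ⟨by simp, hpv.symm, hl, hsr, fun t ht hx' => hvP (h.source t ht x hx').2.1⟩
      · exact old hx
  · obtain ⟨h1, h2, h3⟩ := h.source t ht x hx
    exact ⟨List.mem_append_left _ h1, List.mem_append_left _ h2, h3⟩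
  · rcases List.mem_append.1 hx with hx | hx
    · rcases h.leaf x hx hne hlx with h1 | h1 | ⟨h1, h2⟩
      · exact Or.inl h1
      · exact Or.inr (Or.inl h1)
      · have hxv : par x ≠ v := fun h' => hvP (hch x (hPL x hx) h' ▸ hx)
        refine Or.inr (Or.inr ⟨by simp [h1, hxv], ?_⟩)
        rcases hsl with ⟨-, rfl⟩ | ⟨-, h4, rfl⟩
        · exact h2
        · rw [Function.update_apply, if_neg]
          · exact h2
          · intro h'
            rw [h', h4] at h2
            omega
    · rw [List.mem_singleton] at hx
      subst hx
      rcases hsl with ⟨h1, -⟩ | ⟨h1, h2, rfl⟩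
      · exact absurd h1 hne
      · exact Or.inr (Or.inr ⟨by simp [hT.par_not_mem hL, h1], by simp⟩)
  · rcases List.mem_append.1 hw with hw | hw
    · exact h.unary w hw h0 c hc hcw hne huniq
    · rw [List.mem_singleton] at hw
      subst hw
      exact absurd (hch c hc hcw) hne

/-- A leaf is paired with the waiting sibling. -/
theorem PairInv.step_sibling (h : PairInv par L P sl sr) (hT : TreeList par L)
    (hL : L = P ++ v :: Q) (hl : Leaf par L v) (hne : par v ≠ v) (hs : sl (par v) ≠ 0) :
    PairInv par L (P ++ [v]) (Function.update sl (par v) 0)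
      (Function.update sr v (sl (par v))) := by
  have hv : v ∈ L := by simp [hL]
  have hvP := hT.not_mem_left hL
  have hPL : ∀ x ∈ P, x ∈ L := fun x hx => by simp [hL, hx]
  have hsr := h.sr_eq_zero hv hvP
  obtain ⟨x₀, hx₀⟩ := Nat.exists_eq_succ_of_ne_zero hs
  obtain ⟨g1, g2, g3, g4, g5⟩ := h.slot _ (hT.closed v hv) (hT.par_not_mem hL) x₀ hx₀
  have hx₀v : x₀ ≠ v := fun h' => hvP (h' ▸ g1)
  have hparx : par x₀ ≠ x₀ := fun h' => hT.par_not_mem hL (by rw [← g2, h']; exact g1)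
  have hup : ∀ t ≠ v, Function.update sr v (sl (par v)) t = sr t := fun t ht =>
    Function.update_of_ne ht _ _
  have hne_of_mem : ∀ x ∈ P, x ≠ v := fun x hx h' => hvP (h' ▸ hx)
  refine ⟨fun p hp hpP x hx => ?_, fun t ht x hx => ?_, fun t ht t' ht' heq h0 => ?_,
    fun t ht x hx => ?_, fun x hx hnx hlx => ?_, fun w hw h0 c hc hcw hnc huniq => ?_⟩
  · rw [Function.update_apply] at hx
    split_ifs at hx with hpv
    obtain ⟨h1, h2, h3, h4, h5⟩ := h.slot p hp (fun h' => hpP (List.mem_append_left _ h')) x hx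
    refine ⟨List.mem_append_left _ h1, h2, h3, by rw [hup x (hne_of_mem x h1), h4],
      fun t ht => ?_⟩
    by_cases htv : t = v
    · rw [htv, Function.update_self, hx₀]
      intro h'
      have : x₀ = x := by omega
      exact hpv (by rw [← h2, ← this, g2])
    · rw [hup t htv]
      exact h5 t ht
  · by_cases htv : t = v
    · rw [htv, Function.update_self, hx₀] at hx
      have : x = x₀ := by omega
      subst this htv
      exact ⟨by simp, List.mem_append_left _ g1, hx₀v, hparx, by rw [hup _ hx₀v, g4]⟩
    · rw [hup t htv] at hx
      obtain ⟨h1, h2, h3, h4, h5⟩ := h.source t ht x hx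
      exact ⟨List.mem_append_left _ h1, List.mem_append_left _ h2, h3, h4, by
        rw [hup x (hne_of_mem x h2), h5]⟩
  · by_cases htv : t = v
    · by_cases htv' : t' = v
      · rw [htv, htv']
      · rw [htv, Function.update_self, hup t' htv', hx₀] at heq
        exact absurd heq.symm (g5 t' ht')
    · by_cases htv' : t' = v
      · rw [htv', Function.update_self, hup t htv, hx₀] at heq
        exact absurd heq (g5 t ht)
      · rw [hup t htv] at heq h0
        rw [hup t' htv'] at heq
        exact h.inj t ht t' ht' heq h0
  · by_cases htv : t = v
    · rw [htv, Function.update_self, hx₀] at hx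
      have : x = x₀ := by omega
      subst this htv
      exact Or.inl ⟨g3, g2, hne⟩
    · rw [hup t htv] at hx
      exact h.shape t ht x hx
  · rcases List.mem_append.1 hx with hx | hx
    · rcases h.leaf x hx hnx hlx with h1 | ⟨t, ht, h1⟩ | ⟨h1, h2⟩
      · exact Or.inl (by rwa [hup x (hne_of_mem x hx)])
      · refine Or.inr (Or.inl ⟨t, ht, ?_⟩)
        rw [hup t (hne_of_mem t (h.source t ht x h1).1), h1]
      · by_cases hpp : par x = par v
        · exact Or.inr (Or.inl ⟨v, hv, by rw [Function.update_self, ← hpp, h2]⟩)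
        · refine Or.inr (Or.inr ⟨?_, by rw [Function.update_of_ne hpp, h2]⟩)
          have hxv : par x ≠ v := fun h' => hne_of_mem x hx (hl x (hPL x hx) h')
          simp [h1, hxv]
    · rw [List.mem_singleton] at hx
      subst hx
      exact Or.inl (by rwa [Function.update_self])
  · rcases List.mem_append.1 hw with hw | hw
    · rw [hup w (hne_of_mem w hw)] at h0
      have hcv : c ≠ v := fun h' => hT.par_not_mem hL (by rw [← h', hcw]; exact hw)
      rw [hup c hcv]
      exact h.unary w hw h0 c hc hcw hnc huniq
    · rw [List.mem_singleton] at hw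
      subst hw
      exact absurd (hl c hc hcw) hnc

/-- A vertex with children is paired with a waiting child or with its only child, if possible. -/
theorem PairInv.step_inner (h : PairInv par L P sl sr) (hc : ChildInv par L P mu ch)
    (hT : TreeList par L) (hL : L = P ++ v :: Q) (h0 : ch v ≠ 0) {z : ℕ}
    (hz : z = if sl v = 0 then if mu v = 0 ∧ sr (ch v - 1) = 0 then ch v else 0 else sl v) :
    PairInv par L (P ++ [v]) sl (Function.update sr v z) := by
  have hv : v ∈ L := by simp [hL]
  have hvP := hT.not_mem_left hL
  have hPL : ∀ x ∈ P, x ∈ L := fun x hx => by simp [hL, hx]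
  have hsr := h.sr_eq_zero hv hvP
  have hup : ∀ t ≠ v, Function.update sr v z t = sr t := fun t ht =>
    Function.update_of_ne ht _ _
  have hne_of_mem : ∀ x ∈ P, x ≠ v := fun x hx h' => hvP (h' ▸ hx)
  have hnl : ¬ Leaf par L v := fun h' => h0 ((hc.leaf_iff hT hL).1 h')
  obtain ⟨c₀, hc₀⟩ := Nat.exists_eq_succ_of_ne_zero h0
  obtain ⟨k1, k2, k3⟩ := hc.some v hv c₀ hc₀
  have hmu : mu v = 0 → ∀ y ∈ L, par y = v → y ≠ v → y = c₀ := by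
    intro hm y hy hp hne
    have := hc.single v hv hm y (hT.child_before hL hy hp hne) hp hne
    omega
  -- The facts about a new source.
  have new : ∀ x, z = x + 1 → x ∈ P ∧ par x = v ∧ sr x = 0 ∧ (∀ t ∈ L, sr t ≠ x + 1) ∧
      (Leaf par L x ∨ ∀ y ∈ L, par y = v → y ≠ v → y = x) := by
    intro x hx
    rw [hz] at hx
    split_ifs at hx with h1 h2
    · have : x = c₀ := by omega
      subst this
      have hs0 : sr x = 0 := by
        have := h2.2
        rwa [hc₀, Nat.succ_sub_one] at this
      refine ⟨k1, k2, hs0, fun t ht hst => ?_, Or.inr (hmu h2.1)⟩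
      -- If the only child of `v` were already a source, its target would be a sibling, which does
      -- not exist, or `v`, which has no source yet.
      rcases h.shape t ht x hst with ⟨-, h4, h5⟩ | ⟨h4, -⟩
      · have h6 := hmu h2.1 t ht (by rw [← h4, k2]) (fun h' => h5 (by rw [← h4, k2, h']))
        exact (h.source t ht x hst).2.2.1 h6.symm
      · rw [k2] at h4
        subst h4
        omega
    · obtain ⟨g1, g2, g3, g4, g5⟩ := h.slot v hv hvP x hx
      exact ⟨g1, g2, g4, g5, Or.inl g3⟩
  refine ⟨fun p hp hpP x hx => ?_, fun t ht x hx => ?_, fun t ht t' ht' heq h0 => ?_,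
    fun t ht x hx => ?_, fun x hx hnx hlx => ?_, fun w hw h0 c hcL hcw hnc huniq => ?_⟩
  · obtain ⟨h1, h2, h3, h4, h5⟩ := h.slot p hp (fun h' => hpP (List.mem_append_left _ h')) x hx
    refine ⟨List.mem_append_left _ h1, h2, h3, by rw [hup x (hne_of_mem x h1), h4],
      fun t ht => ?_⟩
    by_cases htv : t = v
    · rw [htv, Function.update_self]
      intro h'
      have := (new x h').2.1
      exact hpP (by rw [← h2, this]; simp)
    · rw [hup t htv]
      exact h5 t ht
  · by_cases htv : t = v
    · rw [htv, Function.update_self] at hx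
      obtain ⟨g1, g2, g3, -⟩ := new x hx
      subst htv
      have hxv := hne_of_mem x g1
      exact ⟨by simp, List.mem_append_left _ g1, hxv, by rw [g2]; exact hxv.symm,
        by rw [hup _ hxv, g3]⟩
    · rw [hup t htv] at hx
      obtain ⟨h1, h2, h3, h4, h5⟩ := h.source t ht x hx
      exact ⟨List.mem_append_left _ h1, List.mem_append_left _ h2, h3, h4, by
        rw [hup x (hne_of_mem x h2), h5]⟩
  · by_cases htv : t = v
    · by_cases htv' : t' = v
      · rw [htv, htv']
      · rw [htv, Function.update_self] at heq h0
        rw [hup t' htv'] at heq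
        obtain ⟨x, hx⟩ := Nat.exists_eq_succ_of_ne_zero h0
        exact absurd (heq.symm.trans hx) ((new x hx).2.2.2.1 t' ht')
    · by_cases htv' : t' = v
      · rw [hup t htv] at heq h0
        rw [htv', Function.update_self] at heq
        obtain ⟨x, hx⟩ := Nat.exists_eq_succ_of_ne_zero h0
        exact absurd hx ((new x (heq.symm.trans hx)).2.2.2.1 t ht)
      · rw [hup t htv] at heq h0
        rw [hup t' htv'] at heq
        exact h.inj t ht t' ht' heq h0
  · by_cases htv : t = v
    · rw [htv, Function.update_self] at hx
      obtain ⟨g1, g2, g3, g4, g5⟩ := new x hx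
      subst htv
      exact Or.inr ⟨g2, g5⟩
    · rw [hup t htv] at hx
      exact h.shape t ht x hx
  · rcases List.mem_append.1 hx with hx | hx
    · rcases h.leaf x hx hnx hlx with h1 | ⟨t, ht, h1⟩ | ⟨h1, h2⟩
      · exact Or.inl (by rwa [hup x (hne_of_mem x hx)])
      · refine Or.inr (Or.inl ⟨t, ht, ?_⟩)
        rw [hup t (hne_of_mem t (h.source t ht x h1).1), h1]
      · by_cases hpp : par x = v
        · refine Or.inr (Or.inl ⟨v, hv, ?_⟩)
          rw [hpp] at h2
          rw [Function.update_self, hz, if_neg (by omega), h2]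
        · exact Or.inr (Or.inr ⟨by simp [h1, hpp], h2⟩)
    · rw [List.mem_singleton] at hx
      subst hx
      exact absurd hlx hnl
  · rcases List.mem_append.1 hw with hw | hw
    · rw [hup w (hne_of_mem w hw)] at h0
      have hcv : c ≠ v := fun h' => hT.par_not_mem hL (by rw [← h', hcw]; exact hw)
      rw [hup c hcv]
      exact h.unary w hw h0 c hcL hcw hnc huniq
    · rw [List.mem_singleton] at hw
      subst hw
      rw [Function.update_self] at h0
      rw [hup c hnc]
      have hm : mu w = 0 := by
        by_contra hm
        obtain ⟨y, hy, y', hy', e1, e2, e3, e4, e5⟩ := hc.multiple w hv hm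
        exact e5 ((huniq y (hPL y hy) e1 e3).trans (huniq y' (hPL y' hy') e2 e4).symm)
      have hcc : c = c₀ := hmu hm c hcL hcw hnc
      rw [hz] at h0
      split_ifs at h0 with h1 h2
      · exact absurd h0 (by omega)
      · have hsc : sr c ≠ 0 := by
          intro h'
          refine h2 ⟨hm, ?_⟩
          rw [hc₀, Nat.succ_sub_one, ← hcc, h']
        -- The only child `c` of `w` is already a target. It is no leaf, because its source is not a
        -- sibling and hence a child of `c`.
        refine ⟨hsc, fun hl => ?_⟩
        obtain ⟨y, hy⟩ := Nat.exists_eq_succ_of_ne_zero hsc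
        obtain ⟨-, e2, e3, e4, -⟩ := h.source c hcL y hy
        rcases h.shape c hcL y hy with ⟨-, e5, e6⟩ | ⟨e5, -⟩
        · exact e3 (huniq y (hPL y e2) (by rw [e5, hcw]) (hne_of_mem y e2))
        · exact e3 (hl y (hPL y e2) e5)
      · exact absurd h0 h1

end

/-! ### Loops over a list of vertices -/

/-- The array holds the list `L` in its first cells. -/
def InArr (f : ℕ → ℕ) (L : List ℕ) : Prop := ∀ j v, L[j]? = some v → f j = v

theorem InArr.append {f : ℕ → ℕ} {P : List ℕ} (h : InArr f P) (v : ℕ) :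
    InArr (Function.update f P.length v) (P ++ [v]) := by
  intro j w hj
  rcases lt_trichotomy j P.length with hlt | rfl | hlt
  · rw [List.getElem?_append_left hlt] at hj
    rw [Function.update_of_ne hlt.ne]
    exact h j w hj
  · rw [List.getElem?_append_right le_rfl, Nat.sub_self] at hj
    rw [Function.update_self]
    simpa using hj
  · rw [List.getElem?_eq_none (by simp; omega)] at hj
    cases hj

/-- `for v in L do c`, where the list `L` is held by integer array `la`, its length by integer
register `r`, and `v` by integer register `3`. -/
def Cmd.forList (la r : ℕ) (c : Cmd) : Cmd :=
  .forLoop 2 r (.setI 3 (.arr la (.reg 2)) ;; c)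

theorem Runs.forList {W la r T : ℕ} {c : Cmd} {m : Mem} {L : List ℕ} (I : List ℕ → Mem → Prop)
    (hr : m.ireg r = L.length) (hL : InArr (m.iarr la) L) (hW : L.length ≤ W)
    (hLW : ∀ v ∈ L, v ≤ W) (h2 : 2 ∉ c.wI) (hrc : r ∉ c.wI) (hr2 : r ≠ 2) (hr3 : r ≠ 3)
    (hla : la ∉ c.wIA)
    (hI2 : ∀ P m' x, I P m' → I P { m' with ireg := Function.update m'.ireg 2 x })
    (hI3 : ∀ P m' x, I P m' → I P { m' with ireg := Function.update m'.ireg 3 x })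
    (h0 : I [] m)
    (hstep : ∀ P v Q m', L = P ++ v :: Q → I P m' → Frame (.forList la r c) m m' →
      m'.ireg 3 = v → Runs W c m' T (I (P ++ [v]))) :
    Runs W (.forList la r c) m ((L.length + 1) * (T + 13)) (I L) := by
  have := Runs.forLoop (i := 2) (c := .setI 3 (.arr la (.reg 2)) ;; c) (T := 3 + T)
    (fun j m' => I (L.take j) m') hr hW ?_ ?_ hr2 (fun j => hI2 _) (by simpa using h0) ?_
  · refine this.mono (by nlinarith) fun m' h _ => by simpa using h
  · simpa [Cmd.wI] using h2
  · simpa [Cmd.wI] using ⟨hr3, hrc⟩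
  · intro j m' hj hI hF hj2 hjr
    have hla' : m'.iarr la = m.iarr la := hF.iarr la (by simpa [Cmd.forLoop, Cmd.wIA] using hla)
    have hv : L[j]? = some L[j] := List.getElem?_eq_getElem hj
    have hval : m'.iarr la j = L[j] := by rw [hla']; exact hL j _ hv
    have hsplit : L = L.take j ++ L[j] :: L.drop (j + 1) := by
      rw [← List.drop_eq_getElem_cons hj, List.take_append_drop]
    refine (Runs.setI (Q := fun m₁ => I (L.take j) m₁ ∧ m₁.ireg 3 = L[j]) ?_ ?_).seq ?_
    · simp only [IExp.eval, hj2, hval]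
      exact hLW _ (List.getElem_mem hj)
    · simp only [IExp.eval, hj2, hval, Function.update_self, and_true]
      exact hI3 _ _ _ hI
    · rintro m₁ ⟨h1, h2⟩ hF'
      rw [← List.take_append_getElem hj]
      refine hstep _ _ _ m₁ hsplit h1 (hF.trans (hF'.mono ?_ ?_ ?_ ?_)) h2 <;>
        simp [Cmd.forLoop, Cmd.wI, Cmd.wR, Cmd.wIA, Cmd.wRA]

/-- The memory holds the list `L` in integer array `1`, its length in integer register `1`, and
the words are large enough for the vertices and for some counting. -/
structure Rep (W : ℕ) (m : Mem) (L : List ℕ) : Prop where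
  len : m.ireg 1 = L.length
  arr : InArr (m.iarr 1) L
  lt : ∀ v ∈ L, v < W
  size : 4 * L.length + 40 ≤ W

theorem Rep.of_frame {W : ℕ} {m m' : Mem} {L : List ℕ} {c : Cmd} (h : Rep W m L)
    (hF : Frame c m m') (h1 : 1 ∉ c.wI) (h2 : 1 ∉ c.wIA) : Rep W m' L :=
  ⟨by rw [hF.ireg 1 h1, h.len], by rw [hF.iarr 1 h2]; exact h.arr, h.lt, h.size⟩

theorem Rep.forList {W T : ℕ} {c : Cmd} {m : Mem} {L : List ℕ} (h : Rep W m L)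
    (I : List ℕ → Mem → Prop) (h2 : 2 ∉ c.wI) (h1 : 1 ∉ c.wI) (hla : 1 ∉ c.wIA)
    (hI2 : ∀ P m' x, I P m' → I P { m' with ireg := Function.update m'.ireg 2 x })
    (hI3 : ∀ P m' x, I P m' → I P { m' with ireg := Function.update m'.ireg 3 x })
    (h0 : I [] m)
    (hstep : ∀ P v Q m', L = P ++ v :: Q → I P m' → Frame (.forList 1 1 c) m m' →
      m'.ireg 3 = v → Runs W c m' T (I (P ++ [v]))) :
    Runs W (.forList 1 1 c) m ((L.length + 1) * (T + 13)) (I L) :=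
  Runs.forList I h.len h.arr (by have := h.size; omega) (fun v hv => (h.lt v hv).le) h2 h1
    (by decide) (by decide) hla hI2 hI3 h0 hstep

/-! ### Preparing and pairing -/

/-- Clears the integer arrays `3`, …, `7` on the list. -/
def clear : Cmd :=
  .forList 1 1 (.storeI 3 (.reg 3) (.const 0) ;; .storeI 4 (.reg 3) (.const 0) ;;
    .storeI 5 (.reg 3) (.const 0) ;; .storeI 6 (.reg 3) (.const 0) ;;
    .storeI 7 (.reg 3) (.const 0))

theorem clear_runs {W : ℕ} {m : Mem} {L : List ℕ} (h : Rep W m L) :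
    Runs W clear m ((L.length + 1) * 50) fun m' => ∀ v ∈ L, m'.iarr 3 v = 0 ∧ m'.iarr 4 v = 0 ∧
      m'.iarr 5 v = 0 ∧ m'.iarr 6 v = 0 ∧ m'.iarr 7 v = 0 := by
  refine (h.forList (T := 37) (fun P m' => ∀ v ∈ P, m'.iarr 3 v = 0 ∧ m'.iarr 4 v = 0 ∧
    m'.iarr 5 v = 0 ∧ m'.iarr 6 v = 0 ∧ m'.iarr 7 v = 0) (by decide) (by decide) (by decide)
    (fun _ _ _ h => h) (fun _ _ _ h => h) (by simp) ?_).mono le_rfl fun _ h _ => h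
  rintro P v Q m' hL hI - hv
  refine (Cmd.runs_of_wp ?_).mono (T := Cmd.time _) (by decide) fun _ h _ => h
  simp only [Cmd.wp, IExp.eval, zero_le, true_and, hv]
  intro w hw
  simp only [Function.update_apply, Nat.reduceEqDiff, if_false, if_true]
  rcases List.mem_append.1 hw with hw | hw
  · obtain ⟨h1, h2, h3, h4, h5⟩ := hI w hw
    simp [h1, h2, h3, h4, h5]
  · rw [List.mem_singleton] at hw
    simp [hw]

/-- Finds a partner for the vertex in integer register `3`, whose parent is in integer
register `4`. -/
def pairBody₁ : Cmd :=
  .ite (.ieq (.arr 4 (.reg 3)) (.const 0))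
    (.ite (.ieq (.reg 4) (.reg 3)) .skip
      (.ite (.ieq (.arr 5 (.reg 4)) (.const 0))
        (.storeI 5 (.reg 4) (.add (.reg 3) (.const 1)))
        (.storeI 6 (.reg 3) (.arr 5 (.reg 4)) ;; .storeI 5 (.reg 4) (.const 0))))
    (.ite (.ieq (.arr 5 (.reg 3)) (.const 0))
      (.ite (.and (.ieq (.arr 3 (.reg 3)) (.const 0))
          (.ieq (.arr 6 (.sub (.arr 4 (.reg 3)) (.const 1))) (.const 0)))
        (.storeI 6 (.reg 3) (.arr 4 (.reg 3))) (.storeI 6 (.reg 3) (.const 0)))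
      (.storeI 6 (.reg 3) (.arr 5 (.reg 3))))

/-- Records the vertex in integer register `3` as a child of its parent. -/
def pairBody₂ : Cmd :=
  .ite (.ieq (.reg 4) (.reg 3)) .skip
    (.ite (.ieq (.arr 4 (.reg 4)) (.const 0)) .skip (.storeI 3 (.reg 4) (.const 1)) ;;
      .storeI 4 (.reg 4) (.add (.reg 3) (.const 1)))

/-- Pairs the vertices of the list: `iarr 6 t - 1` is the vertex to be merged into `t`. -/
def pairUp : Cmd :=
  .forList 1 1 (.setI 4 (.arr 2 (.reg 3)) ;; pairBody₁ ;; pairBody₂)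

section
variable {W : ℕ} {m : Mem} {L P Q : List ℕ} {par : ℕ → ℕ}

theorem pairBody₁_runs {v : ℕ} (hT : TreeList par L) (hLW : ∀ v ∈ L, v < W)
    (hL : L = P ++ v :: Q) (h3 : m.ireg 3 = v) (h4 : m.ireg 4 = par v)
    (hC : ChildInv par L P (m.iarr 3) (m.iarr 4)) (hP : PairInv par L P (m.iarr 5) (m.iarr 6)) :
    Runs W pairBody₁ m pairBody₁.time fun m' =>
      PairInv par L (P ++ [v]) (m'.iarr 5) (m'.iarr 6) := by
  have hv : v ∈ L := by simp [hL]
  have hvP := hT.not_mem_left hL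
  have hsr := hP.sr_eq_zero hv hvP
  have hleaf := hC.leaf_iff hT hL
  have hPL : ∀ x ∈ P, x ∈ L := fun x hx => by simp [hL, hx]
  -- Links are stored as `c + 1`; this is why vertices are required to be strictly below the word
  -- bound.
  have hch : m.iarr 4 v ≤ W := by
    rcases Nat.eq_zero_or_pos (m.iarr 4 v) with h | h
    · omega
    · obtain ⟨c, hc⟩ := Nat.exists_eq_succ_of_ne_zero h.ne'
      have := hLW c (hPL c (hC.some v hv c hc).1)
      omega
  have hslot : ∀ p ∈ L, p ∉ P → m.iarr 5 p ≤ W := by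
    intro p hp hpP
    rcases Nat.eq_zero_or_pos (m.iarr 5 p) with h | h
    · omega
    · obtain ⟨c, hc⟩ := Nat.exists_eq_succ_of_ne_zero h.ne'
      have := hLW c (hPL c (hP.slot p hp hpP c hc).1)
      omega
  refine Cmd.runs_of_wp ?_
  simp only [pairBody₁, Cmd.wp, BExp.Holds, IExp.eval, h3, h4, zero_le, true_and]
  refine ⟨fun h0 => ⟨fun hr => ?_, fun hr => ⟨fun hs => ⟨?_, ?_⟩, fun hs => ⟨?_, ?_⟩⟩⟩,
    fun h0 => ⟨fun hs => ⟨fun hm => ⟨hch, ?_⟩, fun hm => ?_⟩, fun hs => ⟨hslot v hv hvP, ?_⟩⟩⟩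
  · exact hP.step_leaf hT hL (hleaf.2 h0) (Or.inl ⟨hr, rfl⟩)
  · exact hLW v hv
  · exact hP.step_leaf hT hL (hleaf.2 h0) (Or.inr ⟨hr, hs, by simp⟩)
  · exact hslot _ (hT.closed v hv) (hT.par_not_mem hL)
  · have := hP.step_sibling hT hL (hleaf.2 h0) hr hs
    simpa [Function.update_of_ne] using this
  · have := hP.step_inner hC hT hL h0 (by rw [if_pos hs, if_pos hm])
    simpa [Function.update_of_ne] using this
  · have := hP.step_inner hC hT hL h0 (by rw [if_pos hs, if_neg hm])
    simpa [Function.update_of_ne] using this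
  · have := hP.step_inner hC hT hL h0 (by rw [if_neg hs])
    simpa [Function.update_of_ne] using this

theorem pairBody₂_runs {v : ℕ} (hT : TreeList par L) (hLW : ∀ v ∈ L, v < W)
    (hL : L = P ++ v :: Q) (h3 : m.ireg 3 = v) (h4 : m.ireg 4 = par v)
    (hC : ChildInv par L P (m.iarr 3) (m.iarr 4)) :
    Runs W pairBody₂ m pairBody₂.time fun m' => ChildInv par L (P ++ [v]) (m'.iarr 3) (m'.iarr 4) := by
  have hv : v ∈ L := by simp [hL]
  have hvP := hT.not_mem_left hL
  have hvW := hLW v hv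
  refine Cmd.runs_of_wp ?_
  simp only [pairBody₂, Cmd.wp, BExp.Holds, IExp.eval, h3, h4]
  refine ⟨fun hr => hC.step_root hr, fun hr => ⟨fun h0 => ⟨hvW, ?_⟩, fun h0 => ⟨by omega, hvW, ?_⟩⟩⟩
  · have := hC.step hvP hr (hT.closed v hv)
    rw [if_pos h0] at this
    simpa [Function.update_of_ne] using this
  · have := hC.step hvP hr (hT.closed v hv)
    rw [if_neg h0] at this
    simpa [Function.update_of_ne] using this

theorem pairUp_runs (h : Rep W m L) (hT : TreeList (m.iarr 2) L)
    (h0 : ∀ v ∈ L, m.iarr 3 v = 0 ∧ m.iarr 4 v = 0 ∧ m.iarr 5 v = 0 ∧ m.iarr 6 v = 0) :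
    Runs W pairUp m ((L.length + 1) * (pairBody₁.time + pairBody₂.time + 20)) fun m' =>
      PairInv (m.iarr 2) L L (m'.iarr 5) (m'.iarr 6) ∧
      ∀ v ∈ L, (Leaf (m.iarr 2) L v ↔ m'.iarr 4 v = 0) := by
  refine (h.forList (T := 3 + (pairBody₁.time + pairBody₂.time)) (fun P m' =>
    ChildInv (m.iarr 2) L P (m'.iarr 3) (m'.iarr 4) ∧
    PairInv (m.iarr 2) L P (m'.iarr 5) (m'.iarr 6)) (by decide) (by decide) (by decide)
    (fun _ _ _ h => h) (fun _ _ _ h => h) ⟨⟨?_, ?_, ?_, ?_⟩, ?_⟩ ?_).mono ?_ ?_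
  · simp
  · intro v hv c hc
    rw [(h0 v hv).2.1] at hc
    omega
  · simp
  · exact fun v hv hm => absurd (h0 v hv).1 hm
  · exact PairInv.nil (fun v hv => (h0 v hv).2.2.1) (fun v hv => (h0 v hv).2.2.2)
  · rintro P v Q m' hL ⟨hC, hP⟩ hF hv
    have hpar : m'.iarr 2 = m.iarr 2 := hF.iarr 2 (by decide)
    have hvL : v ∈ L := by simp [hL]
    refine (Runs.setI (Q := fun m₁ => m₁.ireg 3 = v ∧ m₁.ireg 4 = m.iarr 2 v ∧ m₁.iarr = m'.iarr)
      ?_ ⟨?_, ?_, rfl⟩).seq (T₂ := pairBody₁.time + pairBody₂.time) ?_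
    · simp only [IExp.eval, hv, hpar]
      exact (h.lt _ (hT.closed v hvL)).le
    · simp [hv]
    · simp [IExp.eval, hv, hpar]
    rintro m₁ ⟨e1, e2, e3⟩ -
    refine (pairBody₁_runs hT h.lt hL e1 e2 (by rwa [e3]) (by rwa [e3])).seq
      fun m₂ hP2 F2 => ?_
    have hC2 : ChildInv (m.iarr 2) L P (m₂.iarr 3) (m₂.iarr 4) := by
      rw [F2.iarr 3 (by decide), F2.iarr 4 (by decide), e3]
      exact hC
    refine (pairBody₂_runs hT h.lt hL (by rw [F2.ireg 3 (by decide), e1])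
      (by rw [F2.ireg 4 (by decide), e2]) hC2).mono le_rfl fun m₃ hC3 F3 => ⟨hC3, ?_⟩
    rw [F3.iarr 5 (by decide), F3.iarr 6 (by decide)]
    exact hP2
  · exact Nat.mul_le_mul_left _ (by omega)
  · rintro m' ⟨hC, hP⟩ -
    refine ⟨hP, fun v hv => ⟨fun hl => ?_, fun h0 => hC.none v hv h0⟩⟩
    by_contra h0
    obtain ⟨c, hc⟩ := Nat.exists_eq_succ_of_ne_zero h0
    obtain ⟨h1, h2, h3⟩ := hC.some v hv c hc
    exact h3 (hl c h1 h2)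

end

/-! ### The critical errors of the pairs -/

/-- The error at which the lower bounds of `x` and `t` cross. -/
noncomputable def crossLo (A S : ℕ → ℝ) (x t : ℕ) : ℝ := (A x - A t) / (S x - S t)

/-- The error at which the upper bounds of `x` and `t` cross. -/
noncomputable def crossUp (B R : ℕ → ℝ) (x t : ℕ) : ℝ := (B t - B x) / (R x - R t)

/-- The vertex `t` is the target of a pair one of whose critical errors satisfies `p`. -/
def HasCrossing (A S B R : ℕ → ℝ) (ch sr : ℕ → ℕ) (p : ℝ → Prop) (t : ℕ) : Prop :=
  sr t ≠ 0 ∧ (p (crossLo A S (sr t - 1) t) ∨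
    (ch (sr t - 1) ≠ 0 ∧ p (crossUp B R (sr t - 1) t)))

/-- Lists the critical errors of the pair with target `ireg 3` in real array `7`. -/
def crossBody : Cmd :=
  .ite (.ieq (.arr 6 (.reg 3)) (.const 0)) .skip
    (.setI 6 (.sub (.arr 6 (.reg 3)) (.const 1)) ;;
      .storeR 7 (.reg 5) (.div (.sub (.arr 3 (.reg 6)) (.arr 3 (.reg 3)))
        (.sub (.arr 4 (.reg 6)) (.arr 4 (.reg 3)))) ;;
      .setI 5 (.add (.reg 5) (.const 1)) ;;
      .ite (.ieq (.arr 4 (.reg 6)) (.const 0)) .skip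
        (.storeR 7 (.reg 5) (.div (.sub (.arr 5 (.reg 3)) (.arr 5 (.reg 6)))
          (.sub (.arr 6 (.reg 6)) (.arr 6 (.reg 3)))) ;;
        .setI 5 (.add (.reg 5) (.const 1))))

/-- Lists the critical errors of all pairs in real array `7`, their number in `ireg 5`. -/
def crossings : Cmd := .setI 5 (.const 0) ;; .forList 1 1 crossBody

theorem cnt_push (p : ℝ → Prop) [DecidablePred p] (Z : ℕ → ℝ) (N : ℕ) (z : ℝ) :
    cnt p (Function.update Z N z) (N + 1) = cnt p Z N + if p z then 1 else 0 := by
  rw [cnt_succ, Function.update_self, cnt_congr]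
  intro i hi
  rw [Function.update_of_ne hi.ne]

-- Each target contributes at most two list entries, and at least one satisfying `p` if one of its
-- critical errors does. Parallel bounds contribute the quotient `0`, which does no harm, as only an
-- upper bound for the number of unresolved pairs is needed.
open Classical in
theorem crossings_runs {W : ℕ} {m : Mem} {L : List ℕ} (h : Rep W m L)
    (hsr : ∀ v ∈ L, m.iarr 6 v ≤ W) :
    Runs W crossings m ((L.length + 1) * (crossBody.time + 20)) fun m' =>
      m'.ireg 5 ≤ 2 * L.countP (fun t => m.iarr 6 t ≠ 0) ∧ ∀ p : ℝ → Prop,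
        L.countP (fun t => HasCrossing (m.rarr 3) (m.rarr 4) (m.rarr 5) (m.rarr 6) (m.iarr 4)
          (m.iarr 6) p t) ≤ cnt p (m'.rarr 7) (m'.ireg 5) := by
  have hsz := h.size
  refine ((Runs.setI (Q := fun m₁ => Rep W m₁ L ∧ m₁.ireg 5 = 0 ∧ m₁.iarr = m.iarr ∧
    m₁.rarr = m.rarr) (by simp [IExp.eval]) ⟨⟨by simp [h.len], h.arr, h.lt, h.size⟩,
      by simp [IExp.eval], rfl, rfl⟩).seq (T₂ := (L.length + 1) * (crossBody.time + 13)) ?_).mono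
    (by simp only [IExp.cost]; nlinarith) fun _ h _ => h
  rintro m₁ ⟨hR, h50, hi, hr⟩ -
  rw [← hi, ← hr]
  rw [← hi] at hsr
  refine (hR.forList (fun P m' =>
    m'.ireg 5 ≤ 2 * P.countP (fun t => m₁.iarr 6 t ≠ 0) ∧ ∀ p : ℝ → Prop,
      P.countP (fun t => HasCrossing (m₁.rarr 3) (m₁.rarr 4) (m₁.rarr 5) (m₁.rarr 6) (m₁.iarr 4)
        (m₁.iarr 6) p t) ≤ cnt p (m'.rarr 7) (m'.ireg 5)) (by decide) (by decide) (by decide)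
    (fun _ _ _ h => h) (fun _ _ _ h => h) ?_ ?_).mono le_rfl fun _ h _ => h
  · exact ⟨by simp [h50], fun p => by simp⟩
  · rintro P v Q m' hL ⟨hN, hp⟩ hF hv
    have i6 : m'.iarr 6 = m₁.iarr 6 := hF.iarr 6 (by decide)
    have i4 : m'.iarr 4 = m₁.iarr 4 := hF.iarr 4 (by decide)
    have r3 : m'.rarr 3 = m₁.rarr 3 := hF.rarr 3 (by decide)
    have r4 : m'.rarr 4 = m₁.rarr 4 := hF.rarr 4 (by decide)
    have r5 : m'.rarr 5 = m₁.rarr 5 := hF.rarr 5 (by decide)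
    have r6 : m'.rarr 6 = m₁.rarr 6 := hF.rarr 6 (by decide)
    have hvL : v ∈ L := by simp [hL]
    have hPl : P.countP (fun t => m₁.iarr 6 t ≠ 0) + 1 ≤ L.length := by
      have h1 := List.countP_le_length (p := fun t => decide (m₁.iarr 6 t ≠ 0)) (l := P)
      rw [hL, List.length_append, List.length_cons]
      omega
    refine Cmd.runs_of_wp ?_
    simp only [crossBody, Cmd.wp, BExp.Holds, IExp.eval, RExp.eval, hv, Function.update_self,
      Function.update_of_ne (show (5 : ℕ) ≠ 6 by decide),
      Function.update_of_ne (show (3 : ℕ) ≠ 6 by decide),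
      Function.update_of_ne (show (3 : ℕ) ≠ 5 by decide),
      Function.update_of_ne (show (6 : ℕ) ≠ 5 by decide),
      Function.update_of_ne (show (6 : ℕ) ≠ 7 by decide),
      Function.update_of_ne (show (5 : ℕ) ≠ 7 by decide), i6, i4, r3, r4, r5, r6]
    simp only [List.countP_append, List.countP_singleton]
    have hvW := hsr v hvL
    refine ⟨fun h0 => ⟨by omega, fun p => ?_⟩, fun h0 => ⟨by omega, by omega,
      fun hc => ⟨?_, fun p => ?_⟩, fun hc => ⟨by omega, ?_, fun p => ?_⟩⟩⟩
    · rw [if_neg (by simp [HasCrossing, h0])]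
      exact hp p
    · rw [if_pos (by simpa using h0)]
      omega
    · rw [cnt_push]
      refine Nat.add_le_add (hp p) ?_
      have : HasCrossing (m₁.rarr 3) (m₁.rarr 4) (m₁.rarr 5) (m₁.rarr 6) (m₁.iarr 4)
        (m₁.iarr 6) p v → p (crossLo (m₁.rarr 3) (m₁.rarr 4) (m₁.iarr 6 v - 1) v) := by
        rintro ⟨-, h | h⟩
        · exact h
        · exact absurd hc h.1
      simp only [decide_eq_true_eq]
      split_ifs with h1 h2 h2
      · exact le_rfl
      · exact absurd (this h1) h2
      · exact Nat.zero_le _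
      · exact le_rfl
    · rw [if_pos (by simpa using h0)]
      omega
    · rw [cnt_push, cnt_push, add_assoc]
      refine Nat.add_le_add (hp p) ?_
      have : HasCrossing (m₁.rarr 3) (m₁.rarr 4) (m₁.rarr 5) (m₁.rarr 6) (m₁.iarr 4)
        (m₁.iarr 6) p v → p (crossLo (m₁.rarr 3) (m₁.rarr 4) (m₁.iarr 6 v - 1) v) ∨
          p (crossUp (m₁.rarr 5) (m₁.rarr 6) (m₁.iarr 6 v - 1) v) := by
        rintro ⟨-, h | h⟩
        · exact Or.inl h
        · exact Or.inr h.2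
      simp only [decide_eq_true_eq]
      split_ifs with h1 h2 h3 h3 h2 h3 h3
      all_goals first | omega | exact absurd (this h1) (by rintro (h | h) <;> contradiction)

/-! ### Narrowing the interval of errors -/

/-- Keeps those of the first `ireg 5` values of real array `7` that lie strictly between
`rreg 0` and `rreg 1`. -/
def filterCrossings : Cmd :=
  .setI 13 (.const 0) ;;
  .forLoop 2 5 (.ite (.and (.rlt (.reg 0) (.arr 7 (.reg 2))) (.rlt (.arr 7 (.reg 2)) (.reg 1)))
    (.storeR 7 (.reg 13) (.arr 7 (.reg 2)) ;; .setI 13 (.add (.reg 13) (.const 1))) .skip) ;;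
  .setI 5 (.reg 13)

theorem filterCrossings_runs {W N : ℕ} {m : Mem} (hN : m.ireg 5 = N) (hNW : N ≤ W) :
    Runs W filterCrossings m ((N + 1) * 60) fun m' => m'.ireg 5 ≤ N ∧ ∀ p,
      cnt p (m'.rarr 7) (m'.ireg 5) =
        cnt (fun x => p x ∧ m.rreg 0 < x ∧ x < m.rreg 1) (m.rarr 7) N := by
  classical
  refine ((Runs.setI (Q := fun m₁ => m₁.ireg 13 = 0 ∧ m₁.ireg 5 = N ∧ m₁.rarr = m.rarr ∧
    m₁.rreg = m.rreg) (by simp [IExp.eval]) ⟨by simp [IExp.eval], by simp [hN], rfl, rfl⟩).seq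
    (T₂ := (N + 1) * 50 + 5) ?_).mono (by simp only [IExp.cost]; omega) fun _ h _ => h
  rintro m₁ ⟨h13, h5, hr, hrr⟩ -
  rw [← hr, ← hrr]
  refine ((Runs.forLoop (i := 2) (r := 5) (T := 40) (fun j m' => m'.ireg 13 ≤ j ∧
    (∀ i ≥ j, m'.rarr 7 i = m₁.rarr 7 i) ∧ ∀ p, cnt p (m'.rarr 7) (m'.ireg 13) =
      cnt (fun x => p x ∧ m₁.rreg 0 < x ∧ x < m₁.rreg 1) (m₁.rarr 7) j) h5 hNW (by decide)
    (by decide) (by decide) (fun _ _ _ h => h) ⟨h13.le, fun _ _ => rfl, by simp [h13, cnt]⟩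
    ?_).seq (T₂ := 2) ?_).mono (by omega) fun _ h _ => h
  · rintro j m' hj ⟨g1, g2, g3⟩ hF hj2 -
    have r0 : m'.rreg 0 = m₁.rreg 0 := hF.rreg 0 (by decide)
    have r1 : m'.rreg 1 = m₁.rreg 1 := hF.rreg 1 (by decide)
    refine (Cmd.runs_of_wp ?_).mono (T := Cmd.time _) (by decide) fun _ h _ => h
    simp only [Cmd.wp, BExp.Holds, IExp.eval, RExp.eval, hj2, r0, r1, Function.update_self,
      g2 j le_rfl]
    refine ⟨fun hb => ⟨by omega, by omega, fun i hi => ?_, fun p => ?_⟩, fun hb => ⟨by omega,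
      fun i hi => g2 i (by omega), fun p => ?_⟩⟩
    · rw [Function.update_of_ne (by omega), g2 i (by omega)]
    · rw [cnt_push, cnt_succ, g3 p]
      simp [hb]
    · rw [cnt_succ, g3 p]
      simp [hb]
  · rintro m₂ ⟨g1, -, g3⟩ -
    refine Runs.setI (by simp only [IExp.eval]; omega) ?_
    simp only [IExp.eval, Function.update_self]
    exact ⟨g1, g3⟩

/-- Propagates the lower bound of the vertex `ireg 3` to its parent, and compares it with the upper
bound there. -/
def testBody : Cmd :=
  .setI 4 (.arr 2 (.reg 3)) ;;
  .ite (.ieq (.reg 4) (.reg 3)) .skip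
    (.ite (.rlt (.add (.arr 5 (.reg 4)) (.mul (.arr 6 (.reg 4)) (.reg 2))) (.arr 9 (.reg 3)))
      (.setI 7 (.const 0)) .skip ;;
    .ite (.rlt (.arr 9 (.reg 4)) (.arr 9 (.reg 3))) (.storeR 9 (.reg 4) (.arr 9 (.reg 3))) .skip)

/-- Tests whether the error `rreg 2` is feasible, and narrows the interval from `rreg 0` to
`rreg 1` accordingly. -/
def testPivot : Cmd :=
  .forList 1 1 (.storeR 9 (.reg 3) (.sub (.arr 3 (.reg 3)) (.mul (.arr 4 (.reg 3)) (.reg 2)))) ;;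
  .setI 7 (.const 1) ;;
  .forList 1 1 testBody ;;
  .ite (.ieq (.reg 7) (.const 1)) (.setR 1 (.reg 2)) (.setR 0 (.reg 2))

/-- When a vertex is processed, all its children have been, so its propagated value is final and can
be compared with the upper bound of its parent at once. One pass both propagates and tests. -/
theorem testPivot_runs {W : ℕ} {m : Mem} {L : List ℕ} (h : Rep W m L) (hT : TreeList (m.iarr 2) L) :
    Runs W testPivot m ((L.length + 1) * (testBody.time + 100)) fun m' =>
      (Feas L (m.iarr 2) (lo (m.rarr 3) (m.rarr 4) (m.rreg 2)) (up (m.rarr 5) (m.rarr 6) (m.rreg 2)) ∧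
        m'.rreg 0 = m.rreg 0 ∧ m'.rreg 1 = m.rreg 2) ∨
      (¬ Feas L (m.iarr 2) (lo (m.rarr 3) (m.rarr 4) (m.rreg 2))
        (up (m.rarr 5) (m.rarr 6) (m.rreg 2)) ∧ m'.rreg 0 = m.rreg 2 ∧ m'.rreg 1 = m.rreg 1) := by
  have hsz := h.size
  set par := m.iarr 2 with hpar
  set l := lo (m.rarr 3) (m.rarr 4) (m.rreg 2) with hl
  set u := up (m.rarr 5) (m.rarr 6) (m.rreg 2) with hu
  refine ((h.forList (T := 10) (fun P m' => ∀ v ∈ P, m'.rarr 9 v = l v) (by decide) (by decide)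
    (by decide) (fun _ _ _ h => h) (fun _ _ _ h => h) (by simp) ?_).seq
    (T₂ := 2 + ((L.length + 1) * (testBody.time + 13) + 20)) fun m₁ h9 F1 => ?_).mono
    (by nlinarith) fun _ h _ => h
  · rintro P v Q m' - hP hF hv
    refine (Cmd.runs_of_wp ?_).mono (T := Cmd.time _) (by decide) fun _ h _ => h
    simp only [Cmd.wp, IExp.eval, RExp.eval, hv, hF.rarr 3 (by decide), hF.rarr 4 (by decide),
      hF.rreg 2 (by decide), Function.update_self]
    intro w hw
    rw [Function.update_apply]
    split_ifs with hwv
    · rw [hwv, hl, lo]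
    · exact hP w (by simpa [hwv] using hw)
  refine (Runs.setI (Q := fun m₂ => m₂.ireg 7 = 1 ∧ m₂.rarr = m₁.rarr ∧ Rep W m₂ L ∧
    m₂.iarr 2 = par) (by simp only [IExp.eval]; omega) ⟨by simp [IExp.eval], rfl,
      ⟨by simp [(h.of_frame F1 (by decide) (by decide)).len],
        (h.of_frame F1 (by decide) (by decide)).arr, h.lt, h.size⟩,
      F1.iarr 2 (by decide)⟩).seq fun m₂ ⟨e7, er, hR2, ep⟩ F2 => ?_
  refine ((hR2.forList (T := testBody.time) (fun P m' =>
    Propagated par L P l (m'.rarr 9) ∧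
    (m'.ireg 7 = 1 ↔ ∀ v ∈ P, par v ≠ v → m'.rarr 9 v ≤ u (par v))) (by decide) (by decide)
    (by decide) (fun _ _ _ h => h) (fun _ _ _ h => h) ⟨?_, ?_⟩ ?_).seq
    (T₂ := 20) fun m₃ ⟨hP3, h73⟩ F3 => ?_).mono (by omega) fun _ h _ => h
  · refine Propagated.congr (Propagated.nil l) (fun v hv => ?_) (by simp) hT.closed
    rw [er, h9 v hv]
  · simp [e7]
  · rintro P v Q m' hL ⟨hP, h7⟩ hF hv
    have i2 : m'.iarr 2 = par := by rw [hF.iarr 2 (by decide), ep]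
    have r5 : m'.rarr 5 = m.rarr 5 := by
      rw [hF.rarr 5 (by decide), F2.rarr 5 (by decide), F1.rarr 5 (by decide)]
    have r6 : m'.rarr 6 = m.rarr 6 := by
      rw [hF.rarr 6 (by decide), F2.rarr 6 (by decide), F1.rarr 6 (by decide)]
    have rr : m'.rreg 2 = m.rreg 2 := by
      rw [hF.rreg 2 (by decide), F2.rreg 2 (by decide), F1.rreg 2 (by decide)]
    have hvL : v ∈ L := by simp [hL]
    have hvP := hT.not_mem_left hL
    have hpP := hT.par_not_mem hL
    have hstep := hP.step hT hL
    have hpW := h.lt _ (hT.closed v hvL)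
    refine Cmd.runs_of_wp ?_
    simp only [testBody, Cmd.wp, BExp.Holds, IExp.eval, RExp.eval, hv, i2, r5, r6, rr,
      Function.update_self, Function.update_of_ne (show (3 : ℕ) ≠ 4 by decide),
      Function.update_of_ne (show (4 : ℕ) ≠ 7 by decide),
      Function.update_of_ne (show (3 : ℕ) ≠ 7 by decide),
      Function.update_of_ne (show (7 : ℕ) ≠ 4 by decide)]
    have hux : ∀ x, m.rarr 5 x + m.rarr 6 x * m.rreg 2 = u x := fun x => rfl
    simp only [hux]
    have hlt : m'.rarr 9 (par v) < m'.rarr 9 v → Function.update (m'.rarr 9) (par v) (m'.rarr 9 v)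
        = if m'.rarr 9 (par v) < m'.rarr 9 v then
          Function.update (m'.rarr 9) (par v) (m'.rarr 9 v) else m'.rarr 9 := fun h => by
      rw [if_pos h]
    have hnlt : ¬ m'.rarr 9 (par v) < m'.rarr 9 v → m'.rarr 9
        = if m'.rarr 9 (par v) < m'.rarr 9 v then
          Function.update (m'.rarr 9) (par v) (m'.rarr 9 v) else m'.rarr 9 := fun h => by
      rw [if_neg h]
    -- A later raise at `par v` does not affect the recorded comparisons, because `par v` has not
    -- been processed yet.
    have hflag : ∀ f : ℕ → ℝ, (∀ x ∈ P, f x = m'.rarr 9 x) → (par v ≠ v → f v = m'.rarr 9 v) →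
        ((∀ w ∈ P ++ [v], par w ≠ w → f w ≤ u (par w)) ↔
          m'.ireg 7 = 1 ∧ (par v ≠ v → m'.rarr 9 v ≤ u (par v))) := by
      intro f h1 h2
      rw [h7]
      simp only [List.mem_append, List.mem_singleton, or_imp, forall_and, forall_eq]
      refine and_congr (forall₂_congr fun x hx => by rw [h1 x hx]) ?_
      exact forall_congr' fun h => by rw [h2 h]
    have hup1 : ∀ x ∈ P, Function.update (m'.rarr 9) (par v) (m'.rarr 9 v) x = m'.rarr 9 x :=
      fun x hx => Function.update_of_ne (fun h => hpP (by rwa [h] at hx)) _ _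
    have hup2 : par v ≠ v → Function.update (m'.rarr 9) (par v) (m'.rarr 9 v) v = m'.rarr 9 v :=
      fun h => Function.update_of_ne h.symm _ _
    refine ⟨hpW.le, fun hr => ⟨?_, ?_⟩, fun hr => ⟨fun hb => ⟨Nat.zero_le _, fun hc => ⟨?_, ?_⟩,
      fun hc => ⟨?_, ?_⟩⟩, fun hb => ⟨fun hc => ⟨?_, ?_⟩, fun hc => ⟨?_, ?_⟩⟩⟩⟩
    · rw [hnlt (by rw [hr]; exact lt_irrefl _)]
      exact hstep
    · rw [hflag _ (fun _ _ => rfl) fun _ => rfl]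
      simp [hr]
    · rw [hlt hc]
      exact hstep
    · rw [hflag _ hup1 hup2]
      simp [hr, hb]
    · rw [hnlt hc]
      exact hstep
    · rw [hflag _ (fun _ _ => rfl) fun _ => rfl]
      simp [hr, hb]
    · rw [hlt hc]
      exact hstep
    · rw [hflag _ hup1 hup2]
      simp [hr, not_lt.1 hb]
    · rw [hnlt hc]
      exact hstep
    · rw [hflag _ (fun _ _ => rfl) fun _ => rfl]
      simp [hr, not_lt.1 hb]
  · have z0 : m₃.rreg 0 = m.rreg 0 := by
      rw [F3.rreg 0 (by decide), F2.rreg 0 (by decide), F1.rreg 0 (by decide)]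
    have z1 : m₃.rreg 1 = m.rreg 1 := by
      rw [F3.rreg 1 (by decide), F2.rreg 1 (by decide), F1.rreg 1 (by decide)]
    have z2 : m₃.rreg 2 = m.rreg 2 := by
      rw [F3.rreg 2 (by decide), F2.rreg 2 (by decide), F1.rreg 2 (by decide)]
    refine (Cmd.runs_of_wp ?_).mono (T := Cmd.time _) (by decide) fun _ h _ => h
    rw [hP3.feas_iff, ← h73]
    simp only [Cmd.wp, BExp.Holds, IExp.eval, RExp.eval, z2, Function.update_self,
      Function.update_of_ne (show (0 : ℕ) ≠ 1 by decide),
      Function.update_of_ne (show (1 : ℕ) ≠ 0 by decide), z0, z1]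
    exact ⟨fun h => Or.inl ⟨h, by simp⟩, fun h => Or.inr ⟨h, by simp⟩⟩

/-- Drops the critical errors outside of the current interval, and narrows the interval by a test
of an approximate median of the others. -/
def narrow : Cmd :=
  filterCrossings ;; .ite (.ilt (.const 0) (.reg 5)) (pivot ;; testPivot) .skip

/-- Narrows the interval `k` times. -/
def narrowMany : ℕ → Cmd
  | 0 => .skip
  | k + 1 => narrow ;; narrowMany k

/-- The value lies strictly between `a` and `b`. -/
def Between (a b x : ℝ) : Prop := a < x ∧ x < b

/-- The bracket given by the contents of the memory. -/
def MemBracket (G : ℝ → Prop) (m : Mem) (L : List ℕ) : Prop :=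
  Bracket G (m.rreg 0) (m.rreg 1) (m.iarr 2) L (m.rarr 3) (m.rarr 4) (m.rarr 5) (m.rarr 6)

/-- The interval has been narrowed so that at most the fraction `p / q` of the listed critical
errors remains inside. -/
structure Narrowed (m m' : Mem) (p q : ℕ) : Prop where
  num : m'.ireg 5 ≤ m.ireg 5
  left : m.rreg 0 ≤ m'.rreg 0
  right : m'.rreg 1 ≤ m.rreg 1
  keep : ∀ c d, m'.rreg 0 ≤ c → d ≤ m'.rreg 1 →
    cnt (Between c d) (m.rarr 7) (m.ireg 5) = cnt (Between c d) (m'.rarr 7) (m'.ireg 5)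
  few : q * cnt (Between (m'.rreg 0) (m'.rreg 1)) (m'.rarr 7) (m'.ireg 5) ≤
    p * cnt (Between (m.rreg 0) (m.rreg 1)) (m.rarr 7) (m.ireg 5)

section
variable {W : ℕ} {m : Mem} {L : List ℕ} {G : ℝ → Prop}

/-- After filtering, the list holds exactly the critical errors inside the interval. The test moves
one end to the pivot, and at most three quarters of them lie strictly on the side that remains. -/
theorem narrow_runs (hG : ∀ ε ε', 0 ≤ ε → ε ≤ ε' → G ε → G ε') (h : Rep W m L)
    (hB : MemBracket G m L) (hN : m.ireg 5 ≤ 2 * L.length) :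
    Runs W narrow m ((L.length + 1) * (testBody.time + 300000)) fun m' =>
      MemBracket G m' L ∧ Narrowed m m' 3 4 := by
  have hsz := h.size
  have hab := hB.le
  have ht : (L.length + 1) * (testBody.time + 300000) =
      (L.length + 1) * (testBody.time + 100) + (L.length + 1) * 299900 := by ring
  rw [ht]
  refine ((filterCrossings_runs (W := W) rfl (by omega)).seq (T₂ := 10 + (2 * L.length * 100000 +
    (L.length + 1) * (testBody.time + 100))) fun m₁ ⟨n1, c1⟩ F1 => ?_).mono
    (by omega) fun _ h _ => h
  have hR1 : Rep W m₁ L := h.of_frame F1 (by decide) (by decide)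
  have a1 : m₁.rreg 0 = m.rreg 0 := F1.rreg 0 (by decide)
  have b1 : m₁.rreg 1 = m.rreg 1 := F1.rreg 1 (by decide)
  have hB1 : MemBracket G m₁ L := by
    unfold MemBracket
    rw [a1, b1, F1.iarr 2 (by decide), F1.rarr 3 (by decide), F1.rarr 4 (by decide),
      F1.rarr 5 (by decide), F1.rarr 6 (by decide)]
    exact hB
  have cin : ∀ c d, m.rreg 0 ≤ c → d ≤ m.rreg 1 →
      cnt (Between c d) (m.rarr 7) (m.ireg 5) = cnt (Between c d) (m₁.rarr 7) (m₁.ireg 5) := by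
    intro c d hc hd
    rw [c1]
    congr 1
    funext x
    refine propext ⟨fun hx => ⟨hx, hc.trans_lt hx.1, hx.2.trans_le hd⟩, fun hx => hx.1⟩
  have ctot : m₁.ireg 5 = cnt (Between (m.rreg 0) (m.rreg 1)) (m.rarr 7) (m.ireg 5) := by
    have := c1 fun _ => True
    rw [cnt_true] at this
    rw [this]
    congr 1
    funext x
    simp [Between]
  refine (Runs.ite (T := 2 * L.length * 100000 + (L.length + 1) * (testBody.time + 100))
    (fun hb => ?_) fun hb => ?_).mono (by simp [BExp.cost, IExp.cost]) fun _ h _ => h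
  · simp only [BExp.Holds, IExp.eval] at hb
    refine ((pivot_runs (W := W) rfl hb (by omega) (by omega)).mono
      (T' := 2 * L.length * 100000) (Nat.mul_le_mul_right _ (by omega))
      fun _ h _ => h).seq fun m₂ ⟨q1, q2⟩ F2 => ?_
    have hR2 : Rep W m₂ L := hR1.of_frame F2 (by decide) (by decide)
    have a2 : m₂.rreg 0 = m.rreg 0 := by rw [F2.rreg 0 (by decide), a1]
    have b2 : m₂.rreg 1 = m.rreg 1 := by rw [F2.rreg 1 (by decide), b1]
    have hB2 : MemBracket G m₂ L := by
      unfold MemBracket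
      rw [a2, b2, ← a1, ← b1, F2.iarr 2 (by decide), F2.rarr 3 (by decide),
        F2.rarr 4 (by decide), F2.rarr 5 (by decide), F2.rarr 6 (by decide)]
      exact hB1
    -- The pivot lies strictly inside the interval; otherwise all listed values would be on one side
    -- of it, against the bound of three quarters.
    have hlow : m.rreg 0 < m₂.rreg 2 := by
      by_contra hcon
      have : cnt (Between (m.rreg 0) (m.rreg 1)) (m₁.rarr 7) (m₁.ireg 5) ≤
          cnt (fun x => m₂.rreg 2 < x) (m₁.rarr 7) (m₁.ireg 5) :=
        cnt_mono fun x hx => (not_lt.1 hcon).trans_lt hx.1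
      rw [← cin _ _ le_rfl le_rfl, ← ctot] at this
      omega
    have hupp : m₂.rreg 2 < m.rreg 1 := by
      by_contra hcon
      have : cnt (Between (m.rreg 0) (m.rreg 1)) (m₁.rarr 7) (m₁.ireg 5) ≤
          cnt (fun x => x < m₂.rreg 2) (m₁.rarr 7) (m₁.ireg 5) :=
        cnt_mono fun x hx => hx.2.trans_le (not_lt.1 hcon)
      rw [← cin _ _ le_rfl le_rfl, ← ctot] at this
      omega
    refine (testPivot_runs hR2 hB2.tree).mono le_rfl fun m₃ h3 F3 => ?_
    have i5 : m₃.ireg 5 = m₁.ireg 5 := by rw [F3.ireg 5 (by decide), F2.ireg 5 (by decide)]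
    have r7 : m₃.rarr 7 = m₁.rarr 7 := by rw [F3.rarr 7 (by decide), F2.rarr 7 (by decide)]
    unfold MemBracket
    rw [F3.iarr 2 (by decide), F3.rarr 3 (by decide), F3.rarr 4 (by decide),
      F3.rarr 5 (by decide), F3.rarr 6 (by decide)]
    rcases h3 with ⟨hF, e0, e1⟩ | ⟨hF, e0, e1⟩
    · rw [e0, e1]
      refine ⟨hB2.of_feas (by rw [a2]; exact hlow.le) (by rw [b2]; exact hupp.le) hF,
        by rw [i5]; exact n1, by rw [e0, a2], by rw [e1]; exact hupp.le, ?_, ?_⟩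
      · intro c d hc hd
        rw [i5, r7]
        exact cin c d (by rwa [e0, a2] at hc) (hd.trans (by rw [e1]; exact hupp.le))
      · rw [i5, r7, ← ctot, e1]
        exact (Nat.mul_le_mul_left _ (cnt_mono fun x hx => hx.2)).trans q1
    · rw [e0, e1]
      refine ⟨hB2.of_not_feas hG (by rw [a2]; exact hlow.le) (by rw [b2]; exact hupp.le) hF,
        by rw [i5]; exact n1, by rw [e0]; exact hlow.le, by rw [e1, b2], ?_, ?_⟩
      · intro c d hc hd
        rw [i5, r7]
        exact cin c d (hlow.le.trans (by rwa [e0] at hc)) (by rwa [e1, b2] at hd)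
      · rw [i5, r7, ← ctot, e0]
        exact (Nat.mul_le_mul_left _ (cnt_mono fun x hx => hx.1)).trans q2
  · simp only [BExp.Holds, IExp.eval, not_lt, Nat.le_zero] at hb
    refine (Cmd.runs_of_wp (c := .skip) (Q := fun m' => MemBracket G m' L ∧ Narrowed m m' 3 4)
      ⟨hB1, n1, by rw [a1], by rw [b1], fun c d hc hd => ?_, ?_⟩).mono ?_ fun _ h _ => h
    · exact cin c d (by rwa [a1] at hc) (by rwa [b1] at hd)
    · have := cnt_le (Between (m₁.rreg 0) (m₁.rreg 1)) (m₁.rarr 7) (m₁.ireg 5)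
      omega
    · simp only [Cmd.time]
      nlinarith

theorem Narrowed.trans {m₁ m₂ m₃ : Mem} {p q p' q' : ℕ} (h : Narrowed m₁ m₂ p q)
    (h' : Narrowed m₂ m₃ p' q') : Narrowed m₁ m₃ (p' * p) (q' * q) := by
  refine ⟨h'.num.trans h.num, h.left.trans h'.left, h'.right.trans h.right, fun c d hc hd => ?_, ?_⟩
  · rw [h.keep c d (h'.left.trans hc) (hd.trans h'.right), h'.keep c d hc hd]
  · have h1 := Nat.mul_le_mul_left q h'.few
    have h2 := Nat.mul_le_mul_left p' h.few
    calc _ = q * (q' * cnt (Between (m₃.rreg 0) (m₃.rreg 1)) (m₃.rarr 7) (m₃.ireg 5)) := by ring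
      _ ≤ _ := h1
      _ = p' * (q * cnt (Between (m₂.rreg 0) (m₂.rreg 1)) (m₂.rarr 7) (m₂.ireg 5)) := by ring
      _ ≤ _ := h2
      _ = _ := by ring

theorem Narrowed.refl (m : Mem) : Narrowed m m 1 1 :=
  ⟨le_rfl, le_rfl, le_rfl, fun _ _ _ _ => rfl, le_rfl⟩

theorem narrowMany_runs (hG : ∀ ε ε', 0 ≤ ε → ε ≤ ε' → G ε → G ε') (k : ℕ) {m : Mem}
    (h : Rep W m L) (hB : MemBracket G m L) (hN : m.ireg 5 ≤ 2 * L.length) :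
    Runs W (narrowMany k) m (k * ((L.length + 1) * (testBody.time + 300000)) + 1) fun m' =>
      MemBracket G m' L ∧ Narrowed m m' (3 ^ k) (4 ^ k) := by
  induction k generalizing m with
  | zero => exact (Cmd.runs_of_wp (c := .skip) (Q := fun m' => MemBracket G m' L ∧
      Narrowed m m' 1 1) ⟨hB, Narrowed.refl m⟩).mono (by simp [Cmd.time]) fun _ h _ => h
  | succ k ih =>
    refine ((narrow_runs hG h hB hN).seq fun m₁ ⟨hB1, hN1⟩ F1 =>
      (ih (h.of_frame F1 (by decide) (by decide)) hB1 (hN1.num.trans hN)).mono le_rfl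
        fun m₂ ⟨hB2, hN2⟩ _ => ?_).mono (le_of_eq (by ring)) fun _ h _ => h
    rw [pow_succ, pow_succ]
    exact ⟨hB2, hN1.trans hN2⟩

end

/-! ### Merging the pairs -/

/-- The comparison of the bounds of the pair with target `t` has the same result at `a` and at
`b`. -/
def Resolved (A S B R : ℕ → ℝ) (ch sr : ℕ → ℕ) (a b : ℝ) (t : ℕ) : Prop :=
  sr t ≠ 0 ∧
  ((lo A S a (sr t - 1) ≤ lo A S a t ∧ lo A S b (sr t - 1) ≤ lo A S b t) ∨
    (lo A S a t ≤ lo A S a (sr t - 1) ∧ lo A S b t ≤ lo A S b (sr t - 1))) ∧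
  (ch (sr t - 1) = 0 ∨
    (up B R a t ≤ up B R a (sr t - 1) ∧ up B R b t ≤ up B R b (sr t - 1)) ∨
    (up B R a (sr t - 1) ≤ up B R a t ∧ up B R b (sr t - 1) ≤ up B R b t))

section
variable {par ch sr : ℕ → ℕ} {A S B R A' S' B' R' A'' S'' B'' R'' : ℕ → ℝ} {a b a' a'' : ℝ}
  {L P Q : List ℕ} {res : ℕ → Prop} {dead dead' : ℕ → ℕ} {v x : ℕ}

/-- A comparison that has different results at the two ends forces a crossing strictly in between,
by `crossing_mem`; for the lower bounds the slopes are `-S`. -/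
theorem hasCrossing_of_not_resolved (hab : a ≤ b) (h : sr v ≠ 0)
    (hr : ¬ Resolved A S B R ch sr a b v) : HasCrossing A S B R ch sr (Between a b) v := by
  refine ⟨h, ?_⟩
  by_contra hcon
  push Not at hcon
  refine hr ⟨h, ?_, ?_⟩
  · by_contra hlo
    push Not at hlo
    refine hcon.1 ?_
    have := crossing_mem (p := A (sr v - 1)) (q := -S (sr v - 1)) (p' := A v) (q' := -S v) hab
      (fun h => ?_) (fun h => ?_)
    · have e : crossLo A S (sr v - 1) v = (A v - A (sr v - 1)) / (-S (sr v - 1) - -S v) := by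
        unfold crossLo
        rw [← neg_sub (A v), ← neg_div_neg_eq, neg_neg]
        congr 1
        ring
      rw [Between, e]
      exact this
    · have h1 := hlo.1 (by simp only [lo]; linarith [h.1])
      simp only [lo] at h1
      linarith [h.2]
    · have h1 := hlo.2 (by simp only [lo]; linarith [h.1])
      simp only [lo] at h1
      linarith [h.2]
  · by_contra hup
    push Not at hup
    refine hcon.2 hup.1 ?_
    exact crossing_mem hab (fun h => absurd h.2 (not_le.2 (hup.2.2 h.1)))
      (fun h => absurd h.2 (not_le.2 (hup.2.1 h.1)))

/-- The pairs with targets in `P` have been merged if they are resolved. -/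
structure MergeInv (par ch sr : ℕ → ℕ) (A S B R : ℕ → ℝ) (a b : ℝ) (L P : List ℕ)
    (res : ℕ → Prop) (A' S' B' R' : ℕ → ℝ) (dead : ℕ → ℕ) (a' : ℝ) : Prop where
  same : ∀ t ∈ L, t ∉ P ∨ ¬ res t → A' t = A t ∧ S' t = S t ∧ B' t = B t ∧ R' t = R t
  lo : ∀ t ∈ P, ∀ x, sr t = x + 1 → res t → LoMax A S a b x t (A' t) (S' t)
  up1 : ∀ t ∈ P, ∀ x, sr t = x + 1 → res t → ch x = 0 → B' t = B t ∧ R' t = R t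
  up2 : ∀ t ∈ P, ∀ x, sr t = x + 1 → res t → ch x ≠ 0 → UpMin B R a b x t (B' t) (R' t)
  dead : ∀ x ∈ L, dead x ≠ 0 ↔ ∃ t ∈ P, sr t = x + 1 ∧ res t
  le : a ≤ a'
  ge : ∀ t ∈ P, ∀ x, sr t = x + 1 → res t → par x = t → (A x - B t) / (S x + R t) ≤ a'
  eq : a' = a ∨ ∃ t ∈ P, ∃ x, sr t = x + 1 ∧ res t ∧ par x = t ∧ a' = (A x - B t) / (S x + R t)

theorem MergeInv.skip (h : MergeInv par ch sr A S B R a b L P res A' S' B' R' dead a')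
    (hv : ¬ res v) : MergeInv par ch sr A S B R a b L (P ++ [v]) res A' S' B' R' dead a' := by
  have key : ∀ t ∈ P ++ [v], res t → t ∈ P := by
    intro t ht hr
    rcases List.mem_append.1 ht with ht | ht
    · exact ht
    · rw [List.mem_singleton] at ht
      exact absurd (ht ▸ hr) hv
  refine ⟨fun t ht hr => ?_, fun t ht x hx hr => h.lo t (key t ht hr) x hx hr,
    fun t ht x hx hr => h.up1 t (key t ht hr) x hx hr,
    fun t ht x hx hr => h.up2 t (key t ht hr) x hx hr, fun x hx => ?_, h.le,
    fun t ht x hx hr => h.ge t (key t ht hr) x hx hr, ?_⟩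
  · refine h.same t ht (hr.imp (fun h1 h2 => h1 (List.mem_append_left _ h2)) id)
  · rw [h.dead x hx]
    exact ⟨fun ⟨t, ht, h1⟩ => ⟨t, List.mem_append_left _ ht, h1⟩,
      fun ⟨t, ht, h1⟩ => ⟨t, key t ht h1.2, h1⟩⟩
  · exact h.eq.imp id fun ⟨t, ht, h1⟩ => ⟨t, List.mem_append_left _ ht, h1⟩

theorem MergeInv.step (h : MergeInv par ch sr A S B R a b L P res A' S' B' R' dead a')
    (hvP : v ∉ P) (hv : res v) (hx : sr v = x + 1)
    (hne : ∀ t ≠ v, A'' t = A' t ∧ S'' t = S' t ∧ B'' t = B' t ∧ R'' t = R' t)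
    (hlo : LoMax A S a b x v (A'' v) (S'' v)) (hup1 : ch x = 0 → B'' v = B v ∧ R'' v = R v)
    (hup2 : ch x ≠ 0 → UpMin B R a b x v (B'' v) (R'' v)) (hd : dead' = Function.update dead x 1)
    (ha1 : a' ≤ a'') (ha2 : par x = v → (A x - B v) / (S x + R v) ≤ a'')
    (ha3 : a'' = a' ∨ (par x = v ∧ a'' = (A x - B v) / (S x + R v))) :
    MergeInv par ch sr A S B R a b L (P ++ [v]) res A'' S'' B'' R'' dead' a'' := by
  have hmem : ∀ t, t ∈ P ++ [v] ↔ t ∈ P ∨ t = v := by simp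
  have hPne : ∀ t ∈ P, t ≠ v := fun t ht h' => hvP (h' ▸ ht)
  have hxx : ∀ y, sr v = y + 1 → y = x := fun y hy => by omega
  refine ⟨fun t ht hr => ?_, fun t ht y hy hr => ?_, fun t ht y hy hr => ?_,
    fun t ht y hy hr => ?_, fun y hy => ?_, h.le.trans ha1, fun t ht y hy hr hp => ?_, ?_⟩
  · have htv : t ≠ v := by
      rintro rfl
      rcases hr with hr | hr
      · exact hr (by simp)
      · exact hr hv
    obtain ⟨e1, e2, e3, e4⟩ := hne t htv
    rw [e1, e2, e3, e4]
    exact h.same t ht (hr.imp (fun h1 h2 => h1 (List.mem_append_left _ h2)) id)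
  · rcases (hmem t).1 ht with ht | rfl
    · rw [(hne t (hPne t ht)).1, (hne t (hPne t ht)).2.1]
      exact h.lo t ht y hy hr
    · rw [hxx y hy]
      exact hlo
  · rcases (hmem t).1 ht with ht | rfl
    · rw [(hne t (hPne t ht)).2.2.1, (hne t (hPne t ht)).2.2.2]
      exact h.up1 t ht y hy hr
    · rw [hxx y hy]
      exact hup1
  · rcases (hmem t).1 ht with ht | rfl
    · rw [(hne t (hPne t ht)).2.2.1, (hne t (hPne t ht)).2.2.2]
      exact h.up2 t ht y hy hr
    · rw [hxx y hy]
      exact hup2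
  · rw [hd, Function.update_apply]
    split_ifs with hyx
    · subst hyx
      simp only [ne_eq, one_ne_zero, not_false_eq_true, true_iff]
      exact ⟨v, by simp, hx, hv⟩
    · rw [h.dead y hy]
      constructor
      · exact fun ⟨t, ht, h1⟩ => ⟨t, List.mem_append_left _ ht, h1⟩
      · rintro ⟨t, ht, h1, h2⟩
        rcases (hmem t).1 ht with ht | rfl
        · exact ⟨t, ht, h1, h2⟩
        · exact absurd (hxx y h1) hyx
  · rcases (hmem t).1 ht with ht | rfl
    · exact (h.ge t ht y hy hr hp).trans ha1
    · have := hxx y hy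
      subst this
      exact ha2 hp
  · rcases ha3 with e | ⟨hp, e⟩
    · rw [e]
      exact h.eq.imp id fun ⟨t, ht, h1⟩ => ⟨t, List.mem_append_left _ ht, h1⟩
    · exact Or.inr ⟨v, by simp, x, hx, hv, hp, e⟩

end

/-! ### The commands that merge resolved pairs -/

/-- The lower bound of the vertex in integer register `v`, at the error in real register `r`. -/
def loExp (v r : ℕ) : RExp := .sub (.arr 3 (.reg v)) (.mul (.arr 4 (.reg v)) (.reg r))

/-- The upper bound of the vertex in integer register `v`, at the error in real register `r`. -/
def upExp (v r : ℕ) : RExp := .add (.arr 5 (.reg v)) (.mul (.arr 6 (.reg v)) (.reg r))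

/-- The first expression is at most the second one at both ends of the interval. -/
def leBoth (f g : ℕ → RExp) : BExp := .and (.not (.rlt (g 0) (f 0))) (.not (.rlt (g 1) (f 1)))

/-- Compares the lower bounds of the vertices `ireg 6` and `ireg 3`. -/
def compareLo : Cmd :=
  .ite (leBoth (loExp 6) (loExp 3)) (.setI 14 (.const 1))
    (.ite (leBoth (loExp 3) (loExp 6)) (.setI 14 (.const 2)) (.setI 14 (.const 0)))

/-- Compares the upper bounds of the vertices `ireg 6` and `ireg 3`, unless the former is a
leaf. -/
def compareUp : Cmd :=
  .ite (.ieq (.arr 4 (.reg 6)) (.const 0)) (.setI 15 (.const 1))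
    (.ite (leBoth (upExp 3) (upExp 6)) (.setI 15 (.const 1))
      (.ite (leBoth (upExp 6) (upExp 3)) (.setI 15 (.const 2)) (.setI 15 (.const 0))))

/-- Marks the vertex `ireg 6` as merged into `ireg 3`, and takes the constraint between the two
into account. -/
def markDead : Cmd :=
  .storeI 7 (.reg 6) (.const 1) ;;
  .ite (.ieq (.arr 2 (.reg 6)) (.reg 3))
    (.setR 7 (.div (.sub (.arr 3 (.reg 6)) (.arr 5 (.reg 3)))
      (.add (.arr 4 (.reg 6)) (.arr 6 (.reg 3)))) ;;
      .ite (.rlt (.reg 3) (.reg 7)) (.setR 3 (.reg 7)) .skip) .skip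

/-- Gives the vertex `ireg 3` the larger lower bound and the smaller upper bound of the pair. -/
def mergeBounds : Cmd :=
  .ite (.ieq (.reg 14) (.const 2)) (.storeR 3 (.reg 3) (.arr 3 (.reg 6)) ;;
    .storeR 4 (.reg 3) (.arr 4 (.reg 6))) .skip ;;
  .ite (.ieq (.reg 15) (.const 2)) (.storeR 5 (.reg 3) (.arr 5 (.reg 6)) ;;
    .storeR 6 (.reg 3) (.arr 6 (.reg 6))) .skip

/-- Merges the pair with target `ireg 3`, if it is resolved. -/
def mergeBody : Cmd :=
  .ite (.ieq (.arr 6 (.reg 3)) (.const 0)) .skip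
    (.setI 6 (.sub (.arr 6 (.reg 3)) (.const 1)) ;; compareLo ;; compareUp ;;
      .ite (.and (.not (.ieq (.reg 14) (.const 0))) (.not (.ieq (.reg 15) (.const 0))))
        (markDead ;; mergeBounds) .skip)

/-- Merges the resolved pairs. -/
def mergePairs : Cmd := .setR 3 (.reg 0) ;; .forList 1 1 mergeBody ;; .setR 0 (.reg 3)

section
variable {W : ℕ} {m : Mem} {t x : ℕ}

theorem compareLo_runs (hW : 2 ≤ W) (h3 : m.ireg 3 = t) (h6 : m.ireg 6 = x) :
    Runs W compareLo m compareLo.time fun m' =>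
      (m'.ireg 14 = 1 ∧ lo (m.rarr 3) (m.rarr 4) (m.rreg 0) x ≤ lo (m.rarr 3) (m.rarr 4) (m.rreg 0) t ∧
        lo (m.rarr 3) (m.rarr 4) (m.rreg 1) x ≤ lo (m.rarr 3) (m.rarr 4) (m.rreg 1) t) ∨
      (m'.ireg 14 = 2 ∧ lo (m.rarr 3) (m.rarr 4) (m.rreg 0) t ≤ lo (m.rarr 3) (m.rarr 4) (m.rreg 0) x ∧
        lo (m.rarr 3) (m.rarr 4) (m.rreg 1) t ≤ lo (m.rarr 3) (m.rarr 4) (m.rreg 1) x) ∨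
      (m'.ireg 14 = 0 ∧ ¬ ((lo (m.rarr 3) (m.rarr 4) (m.rreg 0) x ≤
            lo (m.rarr 3) (m.rarr 4) (m.rreg 0) t ∧
          lo (m.rarr 3) (m.rarr 4) (m.rreg 1) x ≤ lo (m.rarr 3) (m.rarr 4) (m.rreg 1) t) ∨
        (lo (m.rarr 3) (m.rarr 4) (m.rreg 0) t ≤ lo (m.rarr 3) (m.rarr 4) (m.rreg 0) x ∧
          lo (m.rarr 3) (m.rarr 4) (m.rreg 1) t ≤ lo (m.rarr 3) (m.rarr 4) (m.rreg 1) x))) := by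
  refine Cmd.runs_of_wp ?_
  simp only [compareLo, leBoth, loExp, Cmd.wp, BExp.Holds, IExp.eval, RExp.eval, h3, h6, not_lt,
    Function.update_self, lo]
  refine ⟨fun h1 => ⟨by omega, Or.inl ⟨trivial, h1⟩⟩, fun h1 => ⟨fun h2 => ⟨hW, Or.inr (Or.inl
    ⟨trivial, h2⟩)⟩, fun h2 => ⟨Nat.zero_le _, Or.inr (Or.inr ⟨trivial, ?_⟩)⟩⟩⟩
  exact fun h => h.elim h1 h2

theorem compareUp_runs (hW : 2 ≤ W) (h3 : m.ireg 3 = t) (h6 : m.ireg 6 = x) :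
    Runs W compareUp m compareUp.time fun m' =>
      (m'.ireg 15 = 1 ∧ (m.iarr 4 x = 0 ∨
        (up (m.rarr 5) (m.rarr 6) (m.rreg 0) t ≤ up (m.rarr 5) (m.rarr 6) (m.rreg 0) x ∧
          up (m.rarr 5) (m.rarr 6) (m.rreg 1) t ≤ up (m.rarr 5) (m.rarr 6) (m.rreg 1) x))) ∨
      (m'.ireg 15 = 2 ∧ m.iarr 4 x ≠ 0 ∧
        up (m.rarr 5) (m.rarr 6) (m.rreg 0) x ≤ up (m.rarr 5) (m.rarr 6) (m.rreg 0) t ∧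
        up (m.rarr 5) (m.rarr 6) (m.rreg 1) x ≤ up (m.rarr 5) (m.rarr 6) (m.rreg 1) t) ∨
      (m'.ireg 15 = 0 ∧ ¬ (m.iarr 4 x = 0 ∨
        (up (m.rarr 5) (m.rarr 6) (m.rreg 0) t ≤ up (m.rarr 5) (m.rarr 6) (m.rreg 0) x ∧
          up (m.rarr 5) (m.rarr 6) (m.rreg 1) t ≤ up (m.rarr 5) (m.rarr 6) (m.rreg 1) x) ∨
        (up (m.rarr 5) (m.rarr 6) (m.rreg 0) x ≤ up (m.rarr 5) (m.rarr 6) (m.rreg 0) t ∧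
        up (m.rarr 5) (m.rarr 6) (m.rreg 1) x ≤ up (m.rarr 5) (m.rarr 6) (m.rreg 1) t))) := by
  refine Cmd.runs_of_wp ?_
  simp only [compareUp, leBoth, upExp, Cmd.wp, BExp.Holds, IExp.eval, RExp.eval, h3, h6, not_lt,
    Function.update_self, up]
  refine ⟨fun h0 => ⟨by omega, Or.inl ⟨trivial, Or.inl h0⟩⟩, fun h0 => ⟨fun h1 => ⟨by omega,
    Or.inl ⟨trivial, Or.inr h1⟩⟩, fun h1 => ⟨fun h2 => ⟨hW, Or.inr (Or.inl
    ⟨trivial, h0, h2⟩)⟩, fun h2 => ⟨Nat.zero_le _, Or.inr (Or.inr ⟨trivial, ?_⟩)⟩⟩⟩⟩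
  rintro (h | h | h)
  exacts [h0 h, h1 h, h2 h]

theorem markDead_runs (hW : 1 ≤ W) (h3 : m.ireg 3 = t) (h6 : m.ireg 6 = x) :
    Runs W markDead m markDead.time fun m' =>
      m'.iarr 7 = Function.update (m.iarr 7) x 1 ∧ m.rreg 3 ≤ m'.rreg 3 ∧
      (m.iarr 2 x = t → (m.rarr 3 x - m.rarr 5 t) / (m.rarr 4 x + m.rarr 6 t) ≤ m'.rreg 3) ∧
      (m'.rreg 3 = m.rreg 3 ∨ (m.iarr 2 x = t ∧
        m'.rreg 3 = (m.rarr 3 x - m.rarr 5 t) / (m.rarr 4 x + m.rarr 6 t))) := by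
  refine Cmd.runs_of_wp ?_
  simp only [markDead, Cmd.wp, BExp.Holds, IExp.eval, RExp.eval, h3, h6, Function.update_self,
    Function.update_of_ne (show (2 : ℕ) ≠ 7 by decide),
    Function.update_of_ne (show (3 : ℕ) ≠ 7 by decide)]
  refine ⟨hW, fun hp => ⟨fun hlt => ?_, fun hlt => ?_⟩, fun hp => ?_⟩
  · exact ⟨trivial, hlt.le, fun _ => le_rfl, Or.inr ⟨hp, trivial⟩⟩
  · exact ⟨trivial, le_rfl, fun _ => not_lt.1 hlt, Or.inl trivial⟩
  · exact ⟨trivial, le_rfl, fun h => absurd h hp, Or.inl trivial⟩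

theorem mergeBounds_runs (h3 : m.ireg 3 = t) (h6 : m.ireg 6 = x) :
    Runs W mergeBounds m mergeBounds.time fun m' =>
      (∀ w ≠ t, m'.rarr 3 w = m.rarr 3 w ∧ m'.rarr 4 w = m.rarr 4 w ∧ m'.rarr 5 w = m.rarr 5 w ∧
        m'.rarr 6 w = m.rarr 6 w) ∧
      (m.ireg 14 = 2 → m'.rarr 3 t = m.rarr 3 x ∧ m'.rarr 4 t = m.rarr 4 x) ∧
      (m.ireg 14 ≠ 2 → m'.rarr 3 t = m.rarr 3 t ∧ m'.rarr 4 t = m.rarr 4 t) ∧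
      (m.ireg 15 = 2 → m'.rarr 5 t = m.rarr 5 x ∧ m'.rarr 6 t = m.rarr 6 x) ∧
      (m.ireg 15 ≠ 2 → m'.rarr 5 t = m.rarr 5 t ∧ m'.rarr 6 t = m.rarr 6 t) := by
  refine Cmd.runs_of_wp ?_
  simp only [mergeBounds, Cmd.wp, BExp.Holds, IExp.eval, RExp.eval, h3, h6]
  refine ⟨fun h14 => ⟨fun h15 => ?_, fun h15 => ?_⟩, fun h14 => ⟨fun h15 => ?_, fun h15 => ?_⟩⟩ <;>
    simp +contextual [h14, h15]

theorem mergePairs_runs {L : List ℕ} (h : Rep W m L) (hT : TreeList (m.iarr 2) L)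
    (hP : Pairing (m.iarr 2) L (m.iarr 6)) (hd : ∀ v ∈ L, m.iarr 7 v = 0) :
    Runs W mergePairs m ((L.length + 1) * (mergeBody.time + 30)) fun m' =>
      MergeInv (m.iarr 2) (m.iarr 4) (m.iarr 6) (m.rarr 3) (m.rarr 4) (m.rarr 5) (m.rarr 6)
        (m.rreg 0) (m.rreg 1) L L (Resolved (m.rarr 3) (m.rarr 4) (m.rarr 5) (m.rarr 6)
          (m.iarr 4) (m.iarr 6) (m.rreg 0) (m.rreg 1)) (m'.rarr 3) (m'.rarr 4) (m'.rarr 5)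
        (m'.rarr 6) (m'.iarr 7) (m'.rreg 0) := by
  have hsz := h.size
  set par := m.iarr 2
  set ch := m.iarr 4
  set sr := m.iarr 6
  set A := m.rarr 3
  set S := m.rarr 4
  set B := m.rarr 5
  set R := m.rarr 6
  set a := m.rreg 0
  set b := m.rreg 1
  set res := Resolved A S B R ch sr a b
  -- The rising left end is kept in real register `3` until the end, so that all pairs are compared
  -- on the same interval `[a, b]`.
  refine (Runs.setR (Q := fun m₁ => m₁.rreg 3 = a ∧ m₁.rreg 0 = a ∧ m₁.rreg 1 = b ∧
    m₁.iarr = m.iarr ∧ m₁.rarr = m.rarr ∧ Rep W m₁ L) ⟨by simp [RExp.eval, a], by simp [a],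
      by simp [b], rfl, rfl, ⟨h.len, h.arr, h.lt, h.size⟩⟩).seq
    (T₂ := (L.length + 1) * (mergeBody.time + 13) + 2) ?_ |>.mono
    (by simp only [RExp.cost]; nlinarith) fun _ h _ => h
  rintro m₁ ⟨e3, e0, e1, ei, er, hR⟩ -
  refine (hR.forList (T := mergeBody.time) (fun P m' => MergeInv par ch sr A S B R a b L P res
    (m'.rarr 3) (m'.rarr 4) (m'.rarr 5) (m'.rarr 6) (m'.iarr 7) (m'.rreg 3)) (by decide)
    (by decide) (by decide) (fun _ _ _ h => h) (fun _ _ _ h => h) ?_ ?_).seq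
    fun m₂ hM _ => Runs.setR (by simpa [RExp.eval] using hM)
  · rw [er, e3, ei]
    refine ⟨fun _ _ _ => ⟨rfl, rfl, rfl, rfl⟩, by simp, by simp, by simp, fun x hx => ?_, le_rfl,
      by simp, Or.inl rfl⟩
    simp [hd x hx]
  rintro P v Q m' hL hM hF hv
  have hvL : v ∈ L := by simp [hL]
  have hvP := hT.not_mem_left hL
  have i2 : m'.iarr 2 = par := by rw [hF.iarr 2 (by decide), ei]
  have i4 : m'.iarr 4 = ch := by rw [hF.iarr 4 (by decide), ei]
  have i6 : m'.iarr 6 = sr := by rw [hF.iarr 6 (by decide), ei]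
  have q0 : m'.rreg 0 = a := by rw [hF.rreg 0 (by decide), e0]
  have q1 : m'.rreg 1 = b := by rw [hF.rreg 1 (by decide), e1]
  refine Runs.ite (T := Cmd.time .skip + Cmd.time (.setI 6 (.sub (.arr 6 (.reg 3)) (.const 1)) ;;
    compareLo ;; compareUp ;; .ite (.and (.not (.ieq (.reg 14) (.const 0)))
      (.not (.ieq (.reg 15) (.const 0)))) (markDead ;; mergeBounds) .skip))
    (fun hb => ?_) (fun hb => ?_)
  · simp only [BExp.Holds, IExp.eval, hv, i6] at hb
    refine (Cmd.runs_of_wp (c := .skip) ?_).mono (by omega) fun _ h _ => h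
    exact hM.skip fun hr => hr.1 hb
  simp only [BExp.Holds, IExp.eval, hv, i6] at hb
  obtain ⟨x, hx⟩ := Nat.exists_eq_succ_of_ne_zero hb
  obtain ⟨hxL, hxv, hxx, hsx⟩ := hP.source v hvL x hx
  have hxlt := h.lt x hxL
  have hsx' : sr v - 1 = x := by omega
  refine (Runs.seq (T₁ := 5) (T₂ := compareLo.time + (compareUp.time + (10 +
    (markDead.time + mergeBounds.time)))) ?_ (Q := fun m₃ => m₃.ireg 3 = v ∧ m₃.ireg 6 = x ∧
      m₃.iarr = m'.iarr ∧ m₃.rarr = m'.rarr ∧ m₃.rreg = m'.rreg) ?_).mono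
    (by simp only [Cmd.time, BExp.cost, IExp.cost]; omega) fun _ h _ => h
  · refine Runs.setI (by simp only [IExp.eval, hv, i6]; omega) ⟨by simp [hv], ?_, rfl, rfl, rfl⟩
    simp [IExp.eval, hv, i6, hsx']
  rintro m₃ ⟨k3, k6, ki, kr, kq⟩ -
  refine (compareLo_runs (by omega) k3 k6).seq fun m₄ hlo F4 => ?_
  refine (compareUp_runs (by omega) (by rw [F4.ireg 3 (by decide), k3])
    (by rw [F4.ireg 6 (by decide), k6])).seq fun m₅ hup F5 => ?_
  have j14 : m₅.ireg 14 = m₄.ireg 14 := F5.ireg 14 (by decide)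
  have j3 : m₅.ireg 3 = v := by rw [F5.ireg 3 (by decide), F4.ireg 3 (by decide), k3]
  have j6 : m₅.ireg 6 = x := by rw [F5.ireg 6 (by decide), F4.ireg 6 (by decide), k6]
  have ji : ∀ y, m₅.iarr y = m'.iarr y := fun y => by
    rw [F5.iarr y (by simp [compareUp, Cmd.wIA]), F4.iarr y (by simp [compareLo, Cmd.wIA]), ki]
  have jr : ∀ y, m₅.rarr y = m'.rarr y := fun y => by
    rw [F5.rarr y (by simp [compareUp, Cmd.wRA]), F4.rarr y (by simp [compareLo, Cmd.wRA]), kr]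
  have jq : ∀ y, m₅.rreg y = m'.rreg y := fun y => by
    rw [F5.rreg y (by simp [compareUp, Cmd.wR]), F4.rreg y (by simp [compareLo, Cmd.wR]), kq]
  have lr : ∀ y, m₄.rarr y = m'.rarr y := fun y => by
    rw [F4.rarr y (by simp [compareLo, Cmd.wRA]), kr]
  have lq : ∀ y, m₄.rreg y = m'.rreg y := fun y => by
    rw [F4.rreg y (by simp [compareLo, Cmd.wR]), kq]
  have li : ∀ y, m₄.iarr y = m'.iarr y := fun y => by
    rw [F4.iarr y (by simp [compareLo, Cmd.wIA]), ki]
  -- The bounds are overwritten in place, but those read now are the original ones: `v` has not had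
  -- its turn, and a source is never a target.
  obtain ⟨sv1, sv2, sv3, sv4⟩ := hM.same v hvL (Or.inl hvP)
  obtain ⟨sx1, sx2, sx3, sx4⟩ := hM.same x hxL (Or.inr fun hr => hr.1 hsx)
  simp only [lo, kr, kq, q0, q1, sv1, sv2, sx1, sx2] at hlo
  simp only [up, lr, lq, li, i4, q0, q1, sv3, sv4, sx3, sx4] at hup
  have hres : res v ↔ m₅.ireg 14 ≠ 0 ∧ m₅.ireg 15 ≠ 0 := by
    simp only [res, Resolved, hsx', lo, up]
    rw [j14]
    constructor
    · rintro ⟨-, r1, r2⟩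
      constructor
      · rcases hlo with ⟨h, -⟩ | ⟨h, -⟩ | ⟨-, h⟩
        · omega
        · omega
        · exact absurd r1 h
      · rcases hup with ⟨h, -⟩ | ⟨h, -⟩ | ⟨-, h⟩
        · omega
        · omega
        · exact absurd r2 h
    · rintro ⟨r1, r2⟩
      refine ⟨hb, ?_, ?_⟩
      · rcases hlo with ⟨-, h⟩ | ⟨-, h⟩ | ⟨h, -⟩
        · exact Or.inl h
        · exact Or.inr h
        · exact absurd h r1
      · rcases hup with ⟨-, h | h⟩ | ⟨-, -, h⟩ | ⟨h, -⟩
        · exact Or.inl h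
        · exact Or.inr (Or.inl h)
        · exact Or.inr (Or.inr h)
        · exact absurd h r2
  refine (Runs.ite (T := markDead.time + mergeBounds.time) (fun hb => ?_) fun hb => ?_).mono
    (by simp only [BExp.cost, IExp.cost]; omega) fun _ h _ => h
  swap
  · refine (Cmd.runs_of_wp (c := .skip) ?_).mono (by simp [Cmd.time, markDead]; omega)
      fun _ h _ => h
    simp only [BExp.Holds, IExp.eval] at hb
    simp only [Cmd.wp, jr, ji, jq]
    exact hM.skip fun hr => hb (hres.1 hr)
  simp only [BExp.Holds, IExp.eval] at hb
  have hr := hres.2 hb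
  refine (markDead_runs (by omega) j3 j6).seq fun m₆ ⟨d1, d2, d3, d4⟩ F6 => ?_
  refine (mergeBounds_runs (t := v) (x := x) (by rw [F6.ireg 3 (by decide), j3])
    (by rw [F6.ireg 6 (by decide), j6])).mono le_rfl fun m₇ ⟨g1, g2, g3, g4, g5⟩ F7 => ?_
  have r6 : ∀ y, m₆.rarr y = m'.rarr y := fun y => by
    rw [F6.rarr y (by simp [markDead, Cmd.wRA]), jr]
  simp only [r6, F6.ireg 14 (by decide), F6.ireg 15 (by decide), j14, sv1, sv2, sv3, sv4, sx1, sx2,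
    sx3, sx4] at g1 g2 g3 g4 g5
  rw [ji] at d1 d3 d4
  rw [i2] at d3 d4
  simp only [jr, jq, sv3, sv4, sx1, sx2] at d2 d3 d4
  rw [F7.iarr 7 (by decide), F7.rreg 3 (by decide)]
  refine hM.step hvP hr hx g1 ?_ ?_ ?_ d1 d2 d3 d4
  · rcases hlo with ⟨h, h1, h2⟩ | ⟨h, h1, h2⟩ | ⟨h, -⟩
    · exact Or.inl ⟨h1, h2, g3 (by omega)⟩
    · exact Or.inr ⟨h1, h2, g2 h⟩
    · exact absurd (j14.trans h) hb.1
  · intro h0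
    refine g5 ?_
    rcases hup with ⟨h, -⟩ | ⟨-, h, -⟩ | ⟨h, -⟩
    · omega
    · exact absurd h0 h
    · omega
  · intro h0
    rcases hup with ⟨h, h1⟩ | ⟨h, -, h1, h2⟩ | ⟨h, -⟩
    · obtain ⟨h2, h3⟩ := h1.resolve_left h0
      exact Or.inl ⟨h2, h3, g5 (by omega)⟩
    · exact Or.inr ⟨h1, h2, g4 h⟩
    · exact absurd h hb.2

end

/-! ### Removing the merged vertices from the list -/

/-- Copies the first `ireg r` cells of integer array `a` to integer array `d`. -/
def copyArr (d a r : ℕ) : Cmd := .forLoop 2 r (.storeI d (.reg 2) (.arr a (.reg 2)))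

theorem copyArr_runs {W d a r : ℕ} {m : Mem} {L : List ℕ} (hd : a ≠ d) (hr2 : r ≠ 2)
    (hr : m.ireg r = L.length) (hL : InArr (m.iarr a) L) (hW : L.length ≤ W)
    (hLW : ∀ v ∈ L, v ≤ W) :
    Runs W (copyArr d a r) m ((L.length + 1) * 14) fun m' => InArr (m'.iarr d) L := by
  refine (Runs.forLoop (i := 2) (r := r) (T := 4) (fun j m' => ∀ i v, i < j → L[i]? = some v →
    m'.iarr d i = v) hr hW (by simp [Cmd.wI]) (by simp [Cmd.wI]) hr2 (fun _ _ _ h => h)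
    (fun i v hi => by omega) ?_).mono le_rfl fun m' h _ j v hj =>
      h j v (List.getElem?_eq_some_iff.1 hj).1 hj
  intro j m' hj hI hF h2 _
  have ha : m'.iarr a = m.iarr a := hF.iarr a (by simpa [Cmd.forLoop, Cmd.wIA] using hd)
  have hv : m'.iarr a j = L[j] := by rw [ha]; exact hL j _ (List.getElem?_eq_getElem hj)
  refine (Cmd.runs_of_wp ?_).mono (T := Cmd.time _) (by simp [Cmd.time, IExp.cost])
    fun _ h _ => h
  simp only [Cmd.wp, IExp.eval, h2, hv, Function.update_self]
  refine ⟨hLW _ (List.getElem_mem hj), fun i v hi hiv => ?_⟩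
  rw [Function.update_apply]
  split_ifs with hij
  · subst hij
    rw [List.getElem?_eq_getElem hj] at hiv
    exact Option.some.inj hiv
  · exact hI i v (by omega) hiv

/-- Appends the vertex `ireg 3` to the new list unless it is dead, and replaces its parent if that
one is dead. -/
def contractBody : Cmd :=
  .ite (.ieq (.arr 7 (.reg 3)) (.const 0))
    (.setI 4 (.arr 2 (.reg 3)) ;;
      .ite (.ieq (.arr 7 (.reg 4)) (.const 0)) .skip (.storeI 2 (.reg 3) (.arr 2 (.reg 4))) ;;
      .storeI 1 (.reg 13) (.reg 3) ;; .setI 13 (.add (.reg 13) (.const 1))) .skip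

/-- Removes the dead vertices from the list. -/
def contractList : Cmd :=
  copyArr 10 1 1 ;; .setI 13 (.const 0) ;; .forList 10 1 contractBody ;; .setI 1 (.reg 13)

theorem contractBody_runs {W v : ℕ} {m : Mem} {P Q L : List ℕ} {par : ℕ → ℕ}
    (hLW : ∀ v ∈ L, v < W) (hW : L.length ≤ W) (hc : ∀ v ∈ L, par v ∈ L) (hL : L = P ++ v :: Q)
    (hvP : v ∉ P) (h3 : m.ireg 3 = v)
    (hpar : ∀ x, m.iarr 2 x = if x ∈ P ∧ m.iarr 7 x = 0 ∧ m.iarr 7 (par x) ≠ 0 then par (par x)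
      else par x)
    (ha : InArr (m.iarr 1) (P.filter fun x => m.iarr 7 x = 0))
    (h13 : m.ireg 13 = (P.filter fun x => m.iarr 7 x = 0).length) :
    Runs W contractBody m contractBody.time fun m' =>
      (∀ x, m'.iarr 2 x = if x ∈ P ++ [v] ∧ m.iarr 7 x = 0 ∧ m.iarr 7 (par x) ≠ 0 then par (par x)
        else par x) ∧
      InArr (m'.iarr 1) ((P ++ [v]).filter fun x => m.iarr 7 x = 0) ∧
      m'.ireg 13 = ((P ++ [v]).filter fun x => m.iarr 7 x = 0).length := by
  have hvL : v ∈ L := by simp [hL]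
  have hpv : m.iarr 2 v = par v := by rw [hpar, if_neg fun h => hvP h.1]
  have hlt : (P.filter fun x => m.iarr 7 x = 0).length + 1 ≤ W := by
    have h1 := List.length_filter_le (fun x => decide (m.iarr 7 x = 0)) P
    have h2 : L.length = P.length + (Q.length + 1) := by simp [hL]
    omega
  refine Cmd.runs_of_wp ?_
  simp only [contractBody, Cmd.wp, BExp.Holds, IExp.eval, h3, Function.update_self, hpv,
    Function.update_of_ne (show (3 : ℕ) ≠ 4 by decide),
    Function.update_of_ne (show (13 : ℕ) ≠ 4 by decide),
    Function.update_of_ne (show (2 : ℕ) ≠ 1 by decide),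
    Function.update_of_ne (show (1 : ℕ) ≠ 2 by decide), h13]
  refine ⟨fun hd => ⟨(hLW _ (hc v hvL)).le, fun hp => ⟨(hLW v hvL).le, hlt, ?_, ?_, ?_⟩,
    fun hp => ⟨?_, (hLW v hvL).le, hlt, ?_, ?_, ?_⟩⟩, fun hd => ⟨?_, ?_, ?_⟩⟩
  · intro x
    rw [hpar]
    refine if_congr ?_ rfl rfl
    simp only [List.mem_append, List.mem_singleton]
    constructor
    · exact fun h => ⟨Or.inl h.1, h.2⟩
    · rintro ⟨h1 | rfl, h2⟩
      · exact ⟨h1, h2⟩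
      · exact absurd hp h2.2
  · rw [List.filter_append, List.filter_singleton, decide_eq_true hd]
    exact ha.append v
  · rw [List.filter_append, List.filter_singleton, decide_eq_true hd]
    simp
  · rw [hpar (par v)]
    split_ifs
    · exact (hLW _ (hc _ (hc _ (hc v hvL)))).le
    · exact (hLW _ (hc _ (hc v hvL))).le
  · intro x
    rw [Function.update_apply]
    by_cases hxv : x = v
    · subst hxv
      -- The parent entry of a dead vertex is never rewritten, so it still names the original
      -- grandparent.
      rw [if_pos rfl, if_pos ⟨by simp, hd, hp⟩, hpar, if_neg fun h => hp h.2.1]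
    · rw [if_neg hxv, hpar]
      refine if_congr ?_ rfl rfl
      simp [hxv]
  · rw [List.filter_append, List.filter_singleton, decide_eq_true hd]
    exact ha.append v
  · rw [List.filter_append, List.filter_singleton, decide_eq_true hd]
    simp
  · intro x
    rw [hpar]
    refine if_congr ?_ rfl rfl
    simp only [List.mem_append, List.mem_singleton]
    constructor
    · exact fun h => ⟨Or.inl h.1, h.2⟩
    · rintro ⟨h1 | rfl, h2⟩
      · exact ⟨h1, h2⟩
      · exact absurd h2.1 hd
  · rw [List.filter_append, List.filter_singleton, decide_eq_false hd]
    simpa using ha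
  · rw [List.filter_append, List.filter_singleton, decide_eq_false hd]
    simp

theorem contractList_runs {W : ℕ} {m : Mem} {L : List ℕ} (h : Rep W m L)
    (hc : ∀ v ∈ L, m.iarr 2 v ∈ L) (hnd : L.Nodup) :
    Runs W contractList m ((L.length + 1) * (contractBody.time + 40)) fun m' =>
      Rep W m' (L.filter fun x => m.iarr 7 x = 0) ∧ ∀ v ∈ L, m.iarr 7 v = 0 → m'.iarr 2 v =
        if m.iarr 7 (m.iarr 2 v) ≠ 0 then m.iarr 2 (m.iarr 2 v) else m.iarr 2 v := by
  have hsz := h.size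
  set par := m.iarr 2 with hpar
  set dd := m.iarr 7 with hdd
  set L' := L.filter fun x => dd x = 0 with hL'
  have hlen : L'.length ≤ L.length := List.length_filter_le _ _
  -- The old list is read from a copy while the new one overwrites it.
  refine ((copyArr_runs (by decide) (by decide) h.len h.arr (by omega)
    fun v hv => (h.lt v hv).le).seq (T₂ := 2 + ((L.length + 1) * (contractBody.time + 13) + 2))
    fun m₁ h10 F1 => ?_).mono (by nlinarith) fun _ h _ => h
  refine (Runs.setI (Q := fun m₂ => m₂.ireg 13 = 0 ∧ m₂.ireg 1 = L.length ∧ m₂.iarr = m₁.iarr)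
    (by simp [IExp.eval]) ⟨by simp [IExp.eval], ?_, rfl⟩).seq ?_
  · simp only [Function.update_of_ne (show (1 : ℕ) ≠ 13 by decide)]
    rw [F1.ireg 1 (by decide), h.len]
  rintro m₂ ⟨e13, e1, ei⟩ -
  have p2 : m₂.iarr 2 = par := by rw [ei, F1.iarr 2 (by decide)]
  have p7 : m₂.iarr 7 = dd := by rw [ei, F1.iarr 7 (by decide)]
  have key := Runs.forList (W := W) (la := 10) (r := 1) (T := contractBody.time)
    (c := contractBody) (L := L) (m := m₂) (fun P m' =>
      (∀ x, m'.iarr 2 x = if x ∈ P ∧ dd x = 0 ∧ dd (par x) ≠ 0 then par (par x) else par x) ∧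
      InArr (m'.iarr 1) (P.filter fun x => dd x = 0) ∧
      m'.ireg 13 = (P.filter fun x => dd x = 0).length) e1 (by rwa [ei]) (by omega)
    (fun v hv => (h.lt v hv).le) (by decide) (by decide) (by decide) (by decide) (by decide)
    (fun _ _ _ h => h) (fun _ _ _ h => h) ⟨fun x => by simp [p2], by simp [InArr], by simp [e13]⟩
    (by
      rintro P v Q m' hL ⟨h1, h2, h3⟩ hF hv
      have i7 : m'.iarr 7 = dd := by rw [hF.iarr 7 (by decide), p7]
      have := contractBody_runs (P := P) (Q := Q) h.lt (by omega) hc hL (by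
        rintro hvP
        rw [hL, List.nodup_append] at hnd
        exact hnd.2.2 v hvP v (by simp) rfl) hv (by rwa [i7]) (by rwa [i7]) (by rwa [i7])
      rwa [i7] at this)
  refine key.seq fun m₃ ⟨k1, k2, k3⟩ F3 => ?_
  refine Runs.setI (by rw [IExp.eval, k3]; exact hlen.trans (by omega)) ⟨⟨by simp [IExp.eval, k3, hL'], k2,
    fun v hv => h.lt v (List.mem_of_mem_filter hv), by omega⟩, fun v hv hv0 => ?_⟩
  rw [k1]
  refine if_congr ?_ rfl rfl
  simp [hv, hv0]

/-! ### One round of the contraction -/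

/-- One round: pairs the vertices, narrows the interval, merges the resolved pairs. -/
def round : Cmd :=
  clear ;; pairUp ;; crossings ;; narrowMany 5 ;; mergePairs ;; contractList

/-- The time per vertex of a round. -/
def roundTime : ℕ :=
  50 + (pairBody₁.time + pairBody₂.time + 20) + (crossBody.time + 20) +
    5 * (testBody.time + 300000) + 1 + (mergeBody.time + 30) + (contractBody.time + 40)

theorem MemBracket.of_frame {G : ℝ → Prop} {m m' : Mem} {L : List ℕ} {c : Cmd}
    (h : MemBracket G m L) (F : Frame c m m') (h0 : 0 ∉ c.wR) (h1 : 1 ∉ c.wR) (h2 : 2 ∉ c.wIA)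
    (h3 : 3 ∉ c.wRA) (h4 : 4 ∉ c.wRA) (h5 : 5 ∉ c.wRA) (h6 : 6 ∉ c.wRA) :
    MemBracket G m' L := by
  unfold MemBracket
  rw [F.rreg 0 h0, F.rreg 1 h1, F.iarr 2 h2, F.rarr 3 h3, F.rarr 4 h4, F.rarr 5 h5, F.rarr 6 h6]
  exact h

theorem countP_le_add {α : Type*} {L : List α} {p q r : α → Prop} [DecidablePred p]
    [DecidablePred q] [DecidablePred r] (h : ∀ t ∈ L, p t → q t ∨ r t) :
    L.countP (fun t => p t) ≤ L.countP (fun t => q t) + L.countP fun t => r t := by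
  induction L with
  | nil => simp
  | cons x L ih =>
    have := ih fun t ht => h t (List.mem_cons_of_mem _ ht)
    have hx := h x List.mem_cons_self
    simp only [List.countP_cons, decide_eq_true_eq]
    split_ifs <;> first | omega | tauto

open Classical in
theorem round_runs {W : ℕ} {m : Mem} {L : List ℕ} {G : ℝ → Prop}
    (hG : ∀ ε ε', 0 ≤ ε → ε ≤ ε' → G ε → G ε') (h : Rep W m L) (hB : MemBracket G m L)
    (h2 : 2 ≤ L.length) :
    Runs W round m ((L.length + 1) * roundTime) fun m' => ∃ L', Rep W m' L' ∧
      MemBracket G m' L' ∧ 8 * L'.length ≤ 7 * L.length := by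
  refine ((clear_runs h).seq (T₂ := (L.length + 1) * (pairBody₁.time + pairBody₂.time + 20) +
    ((L.length + 1) * (crossBody.time + 20) + ((5 * ((L.length + 1) * (testBody.time + 300000)) + 1) +
    ((L.length + 1) * (mergeBody.time + 30) + (L.length + 1) * (contractBody.time + 40)))))
    fun m₁ c1 F1 => ?_).mono (by unfold roundTime; nlinarith) fun _ h _ => h
  have R1 := h.of_frame F1 (by decide) (by decide)
  have B1 := hB.of_frame F1 (by decide) (by decide) (by decide) (by decide) (by decide)
    (by decide) (by decide)
  refine (pairUp_runs R1 B1.tree fun v hv => ?_).seq fun m₂ ⟨hP, hleaf⟩ F2 => ?_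
  · obtain ⟨e3, e4, e5, e6, -⟩ := c1 v hv
    exact ⟨e3, e4, e5, e6⟩
  have R2 := R1.of_frame F2 (by decide) (by decide)
  have B2 := B1.of_frame F2 (by decide) (by decide) (by decide) (by decide) (by decide)
    (by decide) (by decide)
  rw [← F2.iarr 2 (by decide)] at hP hleaf
  have d2 : ∀ v ∈ L, m₂.iarr 7 v = 0 := fun v hv => by
    rw [F2.iarr 7 (by decide)]
    exact (c1 v hv).2.2.2.2
  clear c1 F1 F2 R1 B1
  refine (crossings_runs R2 fun v hv => ?_).seq fun m₃ ⟨hN, hX⟩ F3 => ?_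
  · rcases Nat.eq_zero_or_pos (m₂.iarr 6 v) with h0 | h0
    · omega
    · obtain ⟨x, hx⟩ := Nat.exists_eq_succ_of_ne_zero h0.ne'
      have := R2.lt x (hP.pairing.source v hv x hx).1
      omega
  have R3 := R2.of_frame F3 (by decide) (by decide)
  have B3 := B2.of_frame F3 (by decide) (by decide) (by decide) (by decide) (by decide)
    (by decide) (by decide)
  refine (narrowMany_runs hG 5 R3 B3 (hN.trans (Nat.mul_le_mul_left _ List.countP_le_length))).seq
    fun m₄ ⟨B4, hNar⟩ F4 => ?_
  have R4 := R3.of_frame F4 (by decide) (by decide)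
  have i4 : ∀ y ∈ [2, 4, 6, 7], m₄.iarr y = m₂.iarr y := by
    intro y hy
    rw [F4.iarr y (by revert y; decide), F3.iarr y (by revert y; decide)]
  have r4 : ∀ y ∈ [3, 4, 5, 6], m₄.rarr y = m₂.rarr y := by
    intro y hy
    rw [F4.rarr y (by revert y; decide), F3.rarr y (by revert y; decide)]
  rw [← i4 2 (by decide), ← i4 6 (by decide)] at hP
  rw [← i4 6 (by decide)] at hN
  rw [← i4 2 (by decide), ← i4 4 (by decide)] at hleaf
  rw [← i4 4 (by decide), ← i4 6 (by decide), ← r4 3 (by decide), ← r4 4 (by decide),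
    ← r4 5 (by decide), ← r4 6 (by decide)] at hX
  rw [← i4 7 (by decide)] at d2
  clear R2 B2 R3 B3 F3 F4 i4 r4
  refine (mergePairs_runs R4 B4.tree hP.pairing d2).seq fun m₅ hM F5 => ?_
  have R5 := R4.of_frame F5 (by decide) (by decide)
  have p5 : m₅.iarr 2 = m₄.iarr 2 := F5.iarr 2 (by decide)
  have b5 : m₅.rreg 1 = m₄.rreg 1 := F5.rreg 1 (by decide)
  set res := Resolved (m₄.rarr 3) (m₄.rarr 4) (m₄.rarr 5) (m₄.rarr 6) (m₄.iarr 4) (m₄.iarr 6)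
    (m₄.rreg 0) (m₄.rreg 1) with hres
  refine (contractList_runs R5 (by rw [p5]; exact B4.tree.closed) B4.tree.nodup).mono le_rfl
    fun m₆ ⟨R6, hpar⟩ F6 => ⟨_, R6, ?_⟩
  rw [p5] at hpar
  have hC : Contracted (m₄.iarr 2) L (m₄.iarr 6) res (fun x => m₅.iarr 7 x ≠ 0) (m₆.iarr 2)
      (L.filter fun x => m₅.iarr 7 x = 0) := by
    refine ⟨hM.dead, fun v hv h0 hp => ?_, fun v hv h0 hp => ?_, fun v => by simp,
      List.filter_sublist⟩
    · rw [hpar v hv (not_not.1 h0), if_neg hp]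
    · rw [hpar v hv (not_not.1 h0), if_pos hp]
  have hrs : ∀ t ∈ L, res t → m₄.iarr 6 t ≠ 0 := fun t _ hr => hr.1
  refine ⟨?_, ?_⟩
  · unfold MemBracket
    rw [F6.rreg 0 (by decide), F6.rreg 1 (by decide), F6.rarr 3 (by decide),
      F6.rarr 4 (by decide), F6.rarr 5 (by decide), F6.rarr 6 (by decide), b5]
    exact B4.contract hP.pairing hC hrs (fun t ht hr => hM.same t ht (Or.inr hr)) hM.lo
      (fun t ht x hx hr hl => hM.up1 t ht x hx hr
        ((hleaf x (hP.pairing.source t ht x hx).1).1 hl))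
      (fun t ht x hx hr hl => hM.up2 t ht x hx hr
        fun h0 => hl ((hleaf x (hP.pairing.source t ht x hx).1).2 h0)) hM.le hM.ge hM.eq
  · have hlen := hC.length_add_le B4.tree hP.pairing hrs
    have hq := B4.tree.length_le_four_mul (src := m₄.iarr 6) h2 (fun v hv hne hl => by
      rcases hP.leaf v hv hne hl with h' | h' | ⟨h', -⟩
      · exact Or.inl h'
      · exact Or.inr h'
      · exact absurd (B4.tree.closed v hv) h') hP.unary
    -- The list made before the narrowing still counts the crossings inside the narrowed interval,
    -- since only values outside have been dropped.
    have hun := hX (Between (m₄.rreg 0) (m₄.rreg 1))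
    rw [hNar.keep _ _ le_rfl le_rfl] at hun
    have hfew := hNar.few
    have hcl := cnt_le (Between (m₃.rreg 0) (m₃.rreg 1)) (m₃.rarr 7) (m₃.ireg 5)
    have hsplit : L.countP (fun t => m₄.iarr 6 t ≠ 0) ≤ L.countP (fun t => res t) +
        L.countP (fun t => HasCrossing (m₄.rarr 3) (m₄.rarr 4) (m₄.rarr 5) (m₄.rarr 6) (m₄.iarr 4)
          (m₄.iarr 6) (Between (m₄.rreg 0) (m₄.rreg 1)) t) := by
      refine countP_le_add fun t _ h0 => ?_
      by_cases hr : res t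
      · exact Or.inl hr
      · exact Or.inr (hasCrossing_of_not_resolved B4.le h0 hr)
    -- With `q` targets there are at most `2 q` listed values, and `(3/4)^5 = 243/1024 < 1/4` of
    -- them remain, so fewer than `q / 2` targets stay unresolved if `q > 0`. At least `q / 2 ≥
    -- L.length / 8` vertices disappear.
    norm_num at hfew
    omega

/-- The main loop: rounds until one vertex is left. -/
def rounds : Cmd := .loop (.ilt (.const 1) (.reg 1)) round

theorem rounds_runs {W : ℕ} {m : Mem} {L : List ℕ} {G : ℝ → Prop}
    (hG : ∀ ε ε', 0 ≤ ε → ε ≤ ε' → G ε → G ε') (h : Rep W m L) (hB : MemBracket G m L) :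
    Runs W rounds m (16 * (roundTime + 10) * (L.length + 1)) fun m' => 0 ≤ m'.rreg 0 ∧
      G (m'.rreg 0) ∧ ∀ ε, 0 ≤ ε → ε < m'.rreg 0 → ¬ G ε := by
  -- A round on `k ≥ 2` vertices removes at least `k / 8` of them, which releases at least `2 k ≥ k
  -- + 1` times `roundTime + 10` of the potential; this is the reason for the factor `16`.
  have := Runs.loop (W := W) (b := .ilt (.const 1) (.reg 1)) (c := round) (m := m)
    (fun m' => ∃ L', Rep W m' L' ∧ MemBracket G m' L')
    (fun m' => 16 * (roundTime + 10) * (m'.ireg 1 + 1)) ⟨L, h, hB⟩ (fun m' _ _ => ?_) ?_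
  · rw [← h.len]
    refine this.mono le_rfl fun m' ⟨⟨L', hR, hB'⟩, hb⟩ _ => ⟨hB'.nonneg, hB'.holds_left ?_,
      hB'.not_holds⟩
    simpa [BExp.Holds, IExp.eval, hR.len] using hb
  · simp only [BExp.cost, IExp.cost]
    nlinarith
  · rintro m' ⟨L', hR, hB'⟩ - hb
    simp only [BExp.Holds, IExp.eval, hR.len] at hb
    refine ⟨_, (round_runs hG hR hB' hb).mono le_rfl
      fun m'' ⟨L'', hR', hB'', hlen⟩ _ => ⟨⟨L'', hR', hB''⟩, ?_⟩⟩
    rw [hR.len, hR'.len]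
    simp only [BExp.cost, IExp.cost]
    nlinarith

/-! ### Loading the data -/

/-- The memory holds the tree and the data in its input arrays. -/
structure Loaded {n : ℕ} (T : ParentTree n) (y w : Fin n → ℝ) (m : Mem) : Prop where
  num : m.ireg 0 = n
  par : ∀ i < n, m.iarr 0 i = T.par i
  val : ∀ i < n, m.rarr 0 i = extend y i
  weight : ∀ i < n, m.rarr 1 i = extend w i

section
variable {W n : ℕ} {T : ParentTree n} {y w : Fin n → ℝ} {m : Mem}

theorem loaded_input : Loaded T y w (input T y w) :=
  ⟨rfl, fun i hi => by simp [input, ParentTree.par, hi], fun i hi => by simp [input, extend, hi],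
    fun i hi => by simp [input, extend, hi]⟩

theorem Loaded.of_frame {m' : Mem} {c : Cmd} (h : Loaded T y w m) (F : Frame c m m')
    (h0 : 0 ∉ c.wI) (h1 : 0 ∉ c.wIA) (h2 : 0 ∉ c.wRA) (h3 : 1 ∉ c.wRA) : Loaded T y w m' :=
  ⟨by rw [F.ireg 0 h0, h.num], by rw [F.iarr 0 h1]; exact h.par, by rw [F.rarr 0 h2]; exact h.val,
    by rw [F.rarr 1 h3]; exact h.weight⟩

theorem ParentTree.par_lt (T : ParentTree n) {i : ℕ} (hi : i < n) : T.par i < n := by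
  simp [ParentTree.par, hi]

/-- Bounds for the values and the weights. -/
def scan : Cmd :=
  .forLoop 2 0 (.ite (.rlt (.arr 0 (.reg 2)) (.reg 4)) (.setR 4 (.arr 0 (.reg 2))) .skip ;;
    .ite (.rlt (.reg 5) (.arr 0 (.reg 2))) (.setR 5 (.arr 0 (.reg 2))) .skip ;;
    .ite (.rlt (.reg 6) (.arr 1 (.reg 2))) (.setR 6 (.arr 1 (.reg 2))) .skip)

/-- The registers start at `0`, so the bounds also enclose `0` and need not be attained; only `c ≤ y
≤ d` matters later. -/
theorem scan_runs (h : Loaded T y w m) (hW : n ≤ W) (h4 : m.rreg 4 = 0) (h5 : m.rreg 5 = 0)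
    (h6 : m.rreg 6 = 0) :
    Runs W scan m ((n + 1) * 50) fun m' => m'.rreg 4 ≤ m'.rreg 5 ∧ 0 ≤ m'.rreg 6 ∧
      ∀ i < n, m'.rreg 4 ≤ extend y i ∧ extend y i ≤ m'.rreg 5 ∧ extend w i ≤ m'.rreg 6 := by
  refine (Runs.forLoop (i := 2) (r := 0) (T := 40) (fun j m' => m'.rreg 4 ≤ m'.rreg 5 ∧
    0 ≤ m'.rreg 6 ∧ ∀ i < j, m'.rreg 4 ≤ extend y i ∧ extend y i ≤ m'.rreg 5 ∧
      extend w i ≤ m'.rreg 6) h.num hW (by decide) (by decide) (by decide) (fun _ _ _ h => h)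
    ⟨by rw [h4, h5], h6.ge, fun i hi => by omega⟩ ?_).mono le_rfl fun _ h _ => h
  rintro j m' hj ⟨h45, hw0, hI⟩ F hj2 -
  have hL := h.of_frame F (by decide) (by decide) (by decide) (by decide)
  refine (Cmd.runs_of_wp ?_).mono (T := Cmd.time _) (by decide) fun _ h _ => h
  have key : ∀ a b c, a ≤ m'.rreg 4 → m'.rreg 5 ≤ b → m'.rreg 6 ≤ c → a ≤ extend y j →
      extend y j ≤ b → extend w j ≤ c → a ≤ b ∧ 0 ≤ c ∧ ∀ i < j + 1, a ≤ extend y i ∧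
        extend y i ≤ b ∧ extend w i ≤ c := by
    intro a b c ha hb hc h1 h2 h3
    refine ⟨h1.trans h2, hw0.trans hc, fun i hi => ?_⟩
    rcases Nat.lt_succ_iff_lt_or_eq.1 hi with hi | rfl
    · obtain ⟨e1, e2, e3⟩ := hI i hi
      exact ⟨ha.trans e1, e2.trans hb, e3.trans hc⟩
    · exact ⟨h1, h2, h3⟩
  simp only [Cmd.wp, BExp.Holds, IExp.eval, RExp.eval, hj2, hL.val j hj, hL.weight j hj, not_lt,
    Function.update_self, Function.update_of_ne (show (5 : ℕ) ≠ 4 by decide),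
    Function.update_of_ne (show (6 : ℕ) ≠ 4 by decide),
    Function.update_of_ne (show (6 : ℕ) ≠ 5 by decide),
    Function.update_of_ne (show (4 : ℕ) ≠ 5 by decide),
    Function.update_of_ne (show (5 : ℕ) ≠ 6 by decide),
    Function.update_of_ne (show (4 : ℕ) ≠ 6 by decide)]
  refine ⟨fun c1 => ⟨fun c2 => ⟨fun c3 => ?_, fun c3 => ?_⟩, fun c2 => ⟨fun c3 => ?_, fun c3 => ?_⟩⟩,
    fun c1 => ⟨fun c2 => ⟨fun c3 => ?_, fun c3 => ?_⟩, fun c2 => ⟨fun c3 => ?_, fun c3 => ?_⟩⟩⟩ <;>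
    apply key <;> first | assumption | exact le_rfl | exact le_of_lt (by assumption)

/-- Stores the lower and upper bounds of the vertices, and copies the parents. -/
def fill : Cmd :=
  .forLoop 2 0 (.storeI 2 (.reg 2) (.arr 0 (.reg 2)) ;;
    .ite (.rlt (.ofInt (.const 0)) (.arr 1 (.reg 2)))
      (.storeR 3 (.reg 2) (.arr 0 (.reg 2)) ;; .storeR 5 (.reg 2) (.arr 0 (.reg 2)) ;;
        .storeR 4 (.reg 2) (.div (.ofInt (.const 1)) (.arr 1 (.reg 2))) ;;
        .storeR 6 (.reg 2) (.div (.ofInt (.const 1)) (.arr 1 (.reg 2))))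
      (.storeR 3 (.reg 2) (.reg 4) ;; .storeR 5 (.reg 2) (.reg 5) ;;
        .storeR 4 (.reg 2) (.ofInt (.const 0)) ;; .storeR 6 (.reg 2) (.ofInt (.const 0))))

theorem fill_runs (h : Loaded T y w m) (hW : n ≤ W) :
    Runs W fill m ((n + 1) * 70) fun m' => ∀ i < n, m'.iarr 2 i = T.par i ∧
      m'.rarr 3 i = dataVal y w (m.rreg 4) i ∧ m'.rarr 4 i = dataSlope w i ∧
      m'.rarr 5 i = dataVal y w (m.rreg 5) i ∧ m'.rarr 6 i = dataSlope w i := by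
  refine (Runs.forLoop (i := 2) (r := 0) (T := 60) (fun j m' => ∀ i < j, m'.iarr 2 i = T.par i ∧
      m'.rarr 3 i = dataVal y w (m.rreg 4) i ∧ m'.rarr 4 i = dataSlope w i ∧
      m'.rarr 5 i = dataVal y w (m.rreg 5) i ∧ m'.rarr 6 i = dataSlope w i)
    h.num hW (by decide) (by decide) (by decide) (fun _ _ _ h => h)
    (fun i hi => by omega) ?_).mono le_rfl fun _ h _ => h
  rintro j m' hj hI F hj2 -
  have hL := h.of_frame F (by decide) (by decide) (by decide) (by decide)
  have r4 : m'.rreg 4 = m.rreg 4 := F.rreg 4 (by decide)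
  have r5 : m'.rreg 5 = m.rreg 5 := F.rreg 5 (by decide)
  refine (Cmd.runs_of_wp ?_).mono (T := Cmd.time _) (by decide) fun _ h _ => h
  simp only [Cmd.wp, BExp.Holds, IExp.eval, RExp.eval, hj2, hL.val j hj, hL.weight j hj,
    hL.par j hj, Function.update_self, Nat.cast_zero, Nat.cast_one, Function.update_apply,
    Nat.reduceEqDiff, if_false, r4, r5]
  refine ⟨(T.par_lt hj).le.trans hW, fun hw => fun i hi => ?_, fun hw => fun i hi => ?_⟩ <;>
  · rcases Nat.lt_succ_iff_lt_or_eq.1 hi with hi | rfl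
    · simpa [hi.ne] using hI i hi
    · simp [dataVal, dataSlope, hw]

/-! ### A topological order -/

/-- The children of `p` among the numbers below `n` that are not in the list `D`. -/
def children (par : ℕ → ℕ) (n : ℕ) (D : List ℕ) (p : ℕ) : Finset ℕ :=
  (Finset.range n).filter fun c => par c = p ∧ c ≠ p ∧ c ∉ D

theorem card_children_succ (par : ℕ → ℕ) (j p : ℕ) :
    (children par (j + 1) [] p).card =
      (children par j [] p).card + if par j = p ∧ j ≠ p then 1 else 0 := by
  unfold children
  rw [Finset.range_add_one, Finset.filter_insert]
  split_ifs with h1 h2 h2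
  · rw [Finset.card_insert_of_notMem (by simp)]
  · simp at h1; tauto
  · simp at h1; tauto
  · rfl

theorem card_children_append {par : ℕ → ℕ} {n v : ℕ} {D : List ℕ} (hv : v < n) (hD : v ∉ D)
    (hp : par v ≠ v) (p : ℕ) : (children par n (D ++ [v]) p).card =
      (children par n D p).card - if p = par v then 1 else 0 := by
  split_ifs with h
  · subst h
    have : children par n (D ++ [v]) (par v) = (children par n D (par v)).erase v := by
      ext c
      simp only [children, Finset.mem_filter, Finset.mem_range, List.mem_append,
        List.mem_singleton, Finset.mem_erase]
      tauto
    rw [this, Finset.card_erase_of_mem (by simp [children, hv, hD, hp.symm])]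
  · rw [Nat.sub_zero]
    congr 1
    ext c
    simp only [children, Finset.mem_filter, Finset.mem_range, List.mem_append, List.mem_singleton]
    constructor
    · tauto
    · rintro ⟨h1, h2, h3, h4⟩
      refine ⟨h1, h2, h3, ?_⟩
      rintro (h5 | rfl)
      · exact h4 h5
      · exact h h2.symm

theorem card_children_append_root {par : ℕ → ℕ} {n v : ℕ} {D : List ℕ}
    (hp : par v = v) (p : ℕ) : (children par n (D ++ [v]) p).card = (children par n D p).card := by
  congr 1
  ext c
  simp only [children, Finset.mem_filter, Finset.mem_range, List.mem_append, List.mem_singleton]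
  constructor
  · tauto
  · rintro ⟨h1, h2, h3, h4⟩
    refine ⟨h1, h2, h3, ?_⟩
    rintro (h5 | rfl)
    · exact h4 h5
    · exact h3 (hp.symm.trans h2)

/-- The list `q` holds the vertices that have no children outside of `D`. -/
structure Queue (par : ℕ → ℕ) (n : ℕ) (D q : List ℕ) : Prop where
  nodup : q.Nodup
  ordered : q.Pairwise fun x y => par y ≠ x
  mem : ∀ v, v ∈ q ↔ v < n ∧ (children par n D v).card = 0

theorem exists_of_card_children_ne_zero {par : ℕ → ℕ} {n v : ℕ} {D : List ℕ}
    (h : (children par n D v).card ≠ 0) : ∃ c < n, par c = v ∧ c ≠ v ∧ c ∉ D := by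
  obtain ⟨c, hc⟩ := Finset.card_ne_zero.1 h
  simp only [children, Finset.mem_filter, Finset.mem_range] at hc
  exact ⟨c, hc⟩

theorem mem_of_card_children_eq_zero {par : ℕ → ℕ} {n v c : ℕ} {D : List ℕ}
    (h : (children par n D v).card = 0) (hc : c < n) (hp : par c = v) (hne : c ≠ v) : c ∈ D := by
  by_contra hD
  have : c ∈ children par n D v := by simp [children, *]
  rw [Finset.card_eq_zero.1 h] at this
  simp at this

/-- The parent of `v` was not in the queue, since its child `v` was not in `D`. No earlier member
`x` is the parent of the new one: `x` has all its children in `D`, so `par v` would have been in the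
queue already. -/
theorem Queue.push {par : ℕ → ℕ} {D q : List ℕ} {v : ℕ} (h : Queue par n D q) (hv : v < n)
    (hD : v ∉ D) (hDq : ∀ x ∈ D, x ∈ q) (hp : par v ≠ v) (hpn : par v < n) :
    Queue par n (D ++ [v])
      (if (children par n (D ++ [v]) (par v)).card = 0 then q ++ [par v] else q) := by
  have hpq : par v ∉ q := fun hq =>
    hD (mem_of_card_children_eq_zero ((h.mem _).1 hq).2 hv rfl hp.symm)
  have hne : ∀ x, x ≠ par v →
      (children par n (D ++ [v]) x).card = (children par n D x).card := fun x hx => by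
    rw [card_children_append hv hD hp, if_neg hx, Nat.sub_zero]
  split_ifs with h0
  · refine ⟨?_, ?_, fun x => ?_⟩
    · rw [List.nodup_append]
      refine ⟨h.nodup, by simp, fun x hx z hz => ?_⟩
      rw [List.mem_singleton] at hz
      exact fun hxz => hpq (hz ▸ hxz ▸ hx)
    · rw [List.pairwise_append]
      refine ⟨h.ordered, by simp, fun x hx z hz => ?_⟩
      rw [List.mem_singleton] at hz
      subst hz
      intro hxp
      exact hpq (hDq _ (mem_of_card_children_eq_zero ((h.mem _).1 hx).2 hpn hxp
        fun hxz => hpq (hxz ▸ hx)))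
    · rw [List.mem_append, List.mem_singleton, h.mem]
      by_cases hx : x = par v
      · subst hx
        simp [h0, hpn]
      · rw [hne x hx]
        simp [hx]
  · refine ⟨h.nodup, h.ordered, fun x => ?_⟩
    by_cases hx : x = par v
    · subst hx
      simp [h0, hpq]
    · rw [hne x hx, h.mem]

theorem Queue.push_root {par : ℕ → ℕ} {D q : List ℕ} {v : ℕ} (h : Queue par n D q)
    (hp : par v = v) : Queue par n (D ++ [v]) q :=
  ⟨h.nodup, h.ordered, fun x => by rw [h.mem, card_children_append_root hp]⟩

/-- A vertex that is missing in the end has a child that is missing too, and this one is farther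
from the root; so a missing vertex of greatest depth cannot exist. -/
theorem Queue.mem_iff {q : List ℕ} (h : Queue T.par n q q) (v : ℕ) : v ∈ q ↔ v < n := by
  refine ⟨fun hv => ((h.mem v).1 hv).1, fun hv => ?_⟩
  classical
  by_contra hvq
  have : Nonempty {x : Fin n // (x : ℕ) ∉ q} := ⟨⟨⟨v, hv⟩, hvq⟩⟩
  obtain ⟨⟨x, hx⟩, hmax⟩ := Finite.exists_max fun x : {x : Fin n // (x : ℕ) ∉ q} =>
    Nat.find (T.reaches_root x)
  obtain ⟨c, hc, hcx, hne, hcq⟩ := exists_of_card_children_ne_zero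
    fun h0 => hx ((h.mem x).2 ⟨x.2, h0⟩)
  have hpc : T.parent ⟨c, hc⟩ = x := Fin.ext (by rw [← T.par_coe, ← hcx])
  have h1 := hmax ⟨⟨c, hc⟩, hcq⟩
  have h2 := Nat.find_spec (T.reaches_root ⟨c, hc⟩)
  simp only at h1
  rcases hk : Nat.find (T.reaches_root ⟨c, hc⟩) with _ | k
  · rw [hk] at h2
    have h3 : (⟨c, hc⟩ : Fin n) = T.root := h2
    have h4 := T.parent_root
    rw [← h3, hpc] at h4
    exact hne (by rw [h4])
  · rw [hk, Function.iterate_succ_apply, hpc] at h2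
    have := Nat.find_min' (T.reaches_root x) h2
    omega

theorem Queue.treeList {q : List ℕ} (h : Queue T.par n q q) : TreeList T.par q := by
  refine ⟨h.nodup, fun v hv => (h.mem_iff _).2 (T.par_lt ((h.mem_iff v).1 hv)), h.ordered,
    T.root, (h.mem_iff _).2 T.root.2, fun v hv => ?_⟩
  have := T.parent_eq_self_iff ⟨v, (h.mem_iff v).1 hv⟩
  rw [Fin.ext_iff, Fin.ext_iff, ← T.par_coe] at this
  exact this

end

section
variable {W n : ℕ} {T : ParentTree n} {y w : Fin n → ℝ} {m : Mem}

/-- Counts the children of every vertex. -/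
def degrees : Cmd :=
  .forLoop 2 0 (.setI 4 (.arr 0 (.reg 2)) ;; .ite (.ieq (.reg 4) (.reg 2)) .skip
    (.storeI 8 (.reg 4) (.add (.arr 8 (.reg 4)) (.const 1))))

theorem card_children_le (par : ℕ → ℕ) (j : ℕ) (D : List ℕ) (p : ℕ) :
    (children par j D p).card ≤ j :=
  (Finset.card_filter_le _ _).trans (Finset.card_range j).le

theorem degrees_runs (h : Loaded T y w m) (hW : n ≤ W) (h8 : ∀ i < n, m.iarr 8 i = 0) :
    Runs W degrees m ((n + 1) * 40) fun m' =>
      ∀ p < n, m'.iarr 8 p = (children T.par n [] p).card := by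
  refine (Runs.forLoop (i := 2) (r := 0) (T := 30) (fun j m' => ∀ p < n, m'.iarr 8 p =
    (children T.par j [] p).card) h.num hW (by decide) (by decide) (by decide) (fun _ _ _ h => h)
    (fun p hp => by simp [h8 p hp, children]) ?_).mono le_rfl fun _ h _ => h
  rintro j m' hj hI F hj2 -
  have hL := h.of_frame F (by decide) (by decide) (by decide) (by decide)
  have hpn := T.par_lt hj
  have hle := card_children_le T.par j [] (T.par j)
  refine (Cmd.runs_of_wp ?_).mono (T := Cmd.time _) (by decide) fun _ h _ => h
  simp only [Cmd.wp, BExp.Holds, IExp.eval, hj2, hL.par j hj, hI _ hpn, Function.update_self,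
    Function.update_of_ne (show (2 : ℕ) ≠ 4 by decide)]
  refine ⟨by omega, fun hp p hp' => ?_, fun hp => ⟨by omega, fun p hp' => ?_⟩⟩
  · rw [card_children_succ, hI p hp', if_neg (fun h' => h'.2 (hp.symm.trans h'.1)), add_zero]
  · rw [card_children_succ, Function.update_apply]
    split_ifs with h1 h2 h2
    · rw [h1]
    · exact absurd ⟨h1.symm, h1 ▸ Ne.symm hp⟩ h2
    · exact absurd h2.1.symm h1
    · rw [hI p hp', add_zero]

/-- Puts the leaves into the queue. -/
def leaves : Cmd :=
  .forLoop 2 0 (.ite (.ieq (.arr 8 (.reg 2)) (.const 0))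
    (.storeI 9 (.reg 11) (.reg 2) ;; .setI 11 (.add (.reg 11) (.const 1))) .skip)

theorem leaves_runs (h0 : m.ireg 0 = n) (hW : n ≤ W) (h11 : m.ireg 11 = 0)
    (h8 : ∀ p < n, m.iarr 8 p = (children T.par n [] p).card) :
    Runs W leaves m ((n + 1) * 30) fun m' => ∃ q, Queue T.par n [] q ∧ InArr (m'.iarr 9) q ∧
      m'.ireg 11 = q.length := by
  set L : ℕ → List ℕ := fun j => (List.range j).filter fun v => (children T.par n [] v).card = 0
    with hL
  have hlen : ∀ j, (L j).length ≤ j := fun j =>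
    (List.length_filter_le _ _).trans List.length_range.le
  have hsucc : ∀ j, L (j + 1) = if (children T.par n [] j).card = 0 then L j ++ [j] else L j := by
    intro j
    simp only [hL, List.range_succ, List.filter_append, List.filter_singleton]
    split_ifs <;> simp_all
  refine (Runs.forLoop (i := 2) (r := 0) (T := 20) (fun j m' => InArr (m'.iarr 9) (L j) ∧
    m'.ireg 11 = (L j).length) h0 hW (by decide) (by decide) (by decide) (fun _ _ _ h => h)
    ⟨by simp [InArr, hL], by simp [h11, hL]⟩ ?_).mono le_rfl
    fun m' ⟨h1, h2⟩ _ => ⟨L n, ⟨?_, ?_, ?_⟩, h1, h2⟩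
  · rintro j m' hj ⟨h1, h2⟩ F hj2 -
    have i8 : m'.iarr 8 = m.iarr 8 := F.iarr 8 (by decide)
    have := hlen j
    refine (Cmd.runs_of_wp ?_).mono (T := Cmd.time _) (by decide) fun _ h _ => h
    simp only [Cmd.wp, BExp.Holds, IExp.eval, hj2, i8, h8 j hj, h2, Function.update_self, hsucc]
    refine ⟨fun hd => ⟨by omega, by omega, ?_, ?_⟩, fun hd => ⟨?_, ?_⟩⟩
    · rw [if_pos hd]
      exact h1.append j
    · rw [if_pos hd]
      simp
    · rwa [if_neg hd]
    · rw [if_neg hd]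
  · exact List.nodup_range.filter _
  · refine (List.pairwise_lt_range.filter _).imp_of_mem fun {x z} hx hz hxz hp => ?_
    rw [List.mem_filter, decide_eq_true_eq] at hx
    rw [List.mem_filter, List.mem_range] at hz
    simpa using mem_of_card_children_eq_zero hx.2 hz.1 hp hxz.ne'
  · intro v
    simp [hL]

/-- Takes a vertex from the queue, and puts its parent into the queue if this was the last child. -/
def dequeue : Cmd :=
  .setI 3 (.arr 9 (.reg 12)) ;; .setI 12 (.add (.reg 12) (.const 1)) ;; .setI 4 (.arr 0 (.reg 3)) ;;
    .ite (.ieq (.reg 4) (.reg 3)) .skip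
      (.storeI 8 (.reg 4) (.sub (.arr 8 (.reg 4)) (.const 1)) ;;
        .ite (.ieq (.arr 8 (.reg 4)) (.const 0))
          (.storeI 9 (.reg 11) (.reg 4) ;; .setI 11 (.add (.reg 11) (.const 1))) .skip)

/-- The state of the queue: the list `q` has been filled, `h` of its members have been taken. -/
structure QueueState (T : ParentTree n) (m : Mem) (q : List ℕ) (h : ℕ) : Prop where
  le : h ≤ q.length
  queue : Queue T.par n (q.take h) q
  arr : InArr (m.iarr 9) q
  tail : m.ireg 11 = q.length
  head : m.ireg 12 = h
  deg : ∀ p < n, m.iarr 8 p = (children T.par n (q.take h) p).card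

theorem Queue.length_le {D q : List ℕ} (h : Queue T.par n D q) : q.length ≤ n := by
  rw [← List.toFinset_card_of_nodup h.nodup, ← Finset.card_range n]
  refine Finset.card_le_card fun v hv => ?_
  rw [List.mem_toFinset, h.mem] at hv
  exact Finset.mem_range.2 hv.1

theorem dequeue_runs {q : List ℕ} {h : ℕ} (hL : Loaded T y w m) (hW : n ≤ W)
    (hQ : QueueState T m q h) (hlt : h < q.length) :
    Runs W dequeue m 50 fun m' => ∃ q', QueueState T m' q' (h + 1) := by
  have hqn := hQ.queue.length_le
  obtain ⟨v, hv⟩ : ∃ v, q[h]? = some v := ⟨_, List.getElem?_eq_getElem hlt⟩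
  have hvq : v ∈ q := List.mem_of_getElem? hv
  have hvn : v < n := ((hQ.queue.mem v).1 hvq).1
  have hpn := T.par_lt hvn
  have htake : q.take (h + 1) = q.take h ++ [v] := by rw [List.take_add_one, hv]; rfl
  have htake' : ∀ z, (q ++ [z]).take (h + 1) = q.take h ++ [v] := fun z => by
    rw [List.take_append_of_le_length (by omega), htake]
  have hD : v ∉ q.take h := by
    intro hvD
    obtain ⟨i, hi, hiv⟩ := List.getElem_of_mem hvD
    rw [List.getElem_take] at hiv
    rw [List.length_take] at hi
    have := (List.getElem?_eq_some_iff.1 hv).2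
    have := (hQ.queue.nodup.getElem_inj_iff).1 (hiv.trans this.symm)
    omega
  have h9 : m.iarr 9 h = v := hQ.arr h v hv
  have hcl := card_children_le T.par n (q.take h) (T.par v)
  refine (Cmd.runs_of_wp ?_).mono (T := Cmd.time _) (by decide) fun _ h _ => h
  simp only [dequeue, Cmd.wp, BExp.Holds, IExp.eval, hQ.head, h9, hL.par v hvn, hQ.tail,
    hQ.deg _ hpn, Function.update_self, Function.update_of_ne (show (3 : ℕ) ≠ 4 by decide),
    Function.update_of_ne (show (3 : ℕ) ≠ 12 by decide),
    Function.update_of_ne (show (12 : ℕ) ≠ 3 by decide),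
    Function.update_of_ne (show (11 : ℕ) ≠ 4 by decide),
    Function.update_of_ne (show (11 : ℕ) ≠ 12 by decide),
    Function.update_of_ne (show (11 : ℕ) ≠ 3 by decide)]
  refine ⟨by omega, by omega, by omega, fun hp => ⟨q, ⟨hlt, ?_, hQ.arr, ?_, ?_, ?_⟩⟩,
    fun hp => ⟨by omega, fun h0 => ⟨by omega, ?_, q ++ [T.par v], ⟨?_, ?_, ?_, ?_, ?_, ?_⟩⟩,
      fun h0 => ⟨q, ⟨hlt, ?_, hQ.arr, ?_, ?_, ?_⟩⟩⟩⟩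
  · rw [htake]
    exact hQ.queue.push_root hp
  · simp [hQ.tail]
  · simp
  · intro p hp'
    rw [htake, card_children_append_root hp, hQ.deg p hp']
  all_goals
    -- In the remaining cases `v` is not the root: taking it lowers the number of outstanding
    -- children of its parent by one, and the parent joins the queue when none is left.
    have hcard := card_children_append hvn hD hp
    have hpush := hQ.queue.push hvn hD (fun x hx => List.mem_of_mem_take hx) hp hpn
    have hcp := hcard (T.par v)
    rw [if_pos rfl] at hcp
    rw [hcp] at hpush
  · rw [if_pos h0] at hpush
    have := hpush.length_le
    simpa using this.trans hW
  · simp; omega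
  · rw [htake']
    rwa [if_pos h0] at hpush
  · exact hQ.arr.append _
  · simp
  · simp
  · intro p hp'
    rw [htake', hcard]
    simp only [Function.update_of_ne (show (8 : ℕ) ≠ 9 by decide), Function.update_self,
      Function.update_apply]
    split_ifs with h1
    · rw [h1]
    · rw [hQ.deg p hp', Nat.sub_zero]
  · rw [htake]
    rwa [if_neg h0] at hpush
  · simp [hQ.tail]
  · simp
  · intro p hp'
    rw [htake, hcard]
    simp only [Function.update_self, Function.update_apply]
    split_ifs with h1
    · rw [h1]
    · rw [hQ.deg p hp', Nat.sub_zero]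

/-- Computes a list of the vertices, children before parents, in integer array `9`. -/
def topSort : Cmd := degrees ;; leaves ;; .loop (.ilt (.reg 12) (.reg 11)) dequeue

theorem topSort_runs (h : Loaded T y w m) (hW : n ≤ W) (h8 : ∀ i < n, m.iarr 8 i = 0)
    (h11 : m.ireg 11 = 0) (h12 : m.ireg 12 = 0) :
    Runs W topSort m ((n + 1) * 200) fun m' => ∃ q, TreeList T.par q ∧ (∀ v, v ∈ q ↔ v < n) ∧
      InArr (m'.iarr 9) q := by
  refine ((degrees_runs h hW h8).seq (T₂ := (n + 1) * 30 + (n * 60 + 60)) fun m₁ d1 F1 => ?_).mono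
    (by omega) fun _ h _ => h
  have L1 := h.of_frame F1 (by decide) (by decide) (by decide) (by decide)
  refine (leaves_runs L1.num hW (by rw [F1.ireg 11 (by decide), h11]) d1).seq
    fun m₂ ⟨q, hq, ha, ht⟩ F2 => ?_
  have L2 := L1.of_frame F2 (by decide) (by decide) (by decide) (by decide)
  have e12 : m₂.ireg 12 = 0 := by rw [F2.ireg 12 (by decide), F1.ireg 12 (by decide), h12]
  have := Runs.loop (W := W) (b := .ilt (.reg 12) (.reg 11)) (c := dequeue) (m := m₂)
    (fun m' => ∃ q h, QueueState T m' q h) (fun m' => (n - m'.ireg 12) * 60 + 60)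
    ⟨q, 0, Nat.zero_le _, by simpa using hq, ha, ht, e12, by
      rw [F2.iarr 8 (by decide)]
      simpa using d1⟩ (fun m' _ _ => by simp only [BExp.cost, IExp.cost]; omega) ?_
  · refine this.mono (by omega) fun m' ⟨⟨q, h, hQ⟩, hb⟩ _ => ⟨q, ?_⟩
    simp only [BExp.Holds, IExp.eval, hQ.head, hQ.tail] at hb
    have hq := hQ.queue
    rw [List.take_of_length_le (by omega)] at hq
    exact ⟨hq.treeList, hq.mem_iff, hQ.arr⟩
  · rintro m' ⟨q, h, hQ⟩ F hb
    simp only [BExp.Holds, IExp.eval, hQ.head, hQ.tail] at hb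
    have hqn := hQ.queue.length_le
    refine ⟨_, (dequeue_runs (L2.of_frame F (by decide) (by decide) (by decide) (by decide)) hW hQ
      hb).mono le_rfl fun m'' ⟨q', hQ'⟩ _ => ⟨⟨q', h + 1, hQ'⟩, ?_⟩⟩
    rw [hQ.head, hQ'.head]
    simp only [BExp.cost, IExp.cost]
    omega

end

/-! ### The initial interval, the output, and the whole program -/

section
variable {W n : ℕ} {T : ParentTree n} {y w : Fin n → ℝ} {m : Mem} {q : List ℕ}

/-- Starts with the list of all vertices and an interval that contains the optimal error. -/
def start : Cmd :=
  copyArr 1 9 0 ;; .setI 1 (.reg 0) ;; .setR 0 (.ofInt (.const 0)) ;;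
    .setR 1 (.mul (.sub (.reg 5) (.reg 4)) (.reg 6))

theorem start_runs (h : Loaded T y w m) (hW : 4 * n + 40 ≤ W) (hT : TreeList T.par q)
    (hq : ∀ v, v ∈ q ↔ v < n) (h9 : InArr (m.iarr 9) q) (hlen : q.length = n)
    (h45 : m.rreg 4 ≤ m.rreg 5) (h6 : 0 ≤ m.rreg 6)
    (hb : ∀ i < n, m.rreg 4 ≤ extend y i ∧ extend y i ≤ m.rreg 5 ∧ extend w i ≤ m.rreg 6)
    (hf : ∀ i < n, m.iarr 2 i = T.par i ∧ m.rarr 3 i = dataVal y w (m.rreg 4) i ∧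
      m.rarr 4 i = dataSlope w i ∧ m.rarr 5 i = dataVal y w (m.rreg 5) i ∧
      m.rarr 6 i = dataSlope w i) :
    Runs W start m ((n + 1) * 40) fun m' => Rep W m' q ∧
      MemBracket (DataFeas T y w (m.rreg 4) (m.rreg 5) q) m' q := by
  refine ((copyArr_runs (d := 1) (a := 9) (r := 0) (L := q) (by decide) (by decide)
    (by rw [h.num, hlen]) h9 (by omega) fun v hv => ((hq v).1 hv).le.trans (by omega)).seq
    (T₂ := 20) fun m₁ e1 F1 => ?_).mono (by rw [hlen]; omega) fun _ h _ => h
  have i0 : m₁.ireg 0 = n := by rw [F1.ireg 0 (by decide), h.num]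
  refine (Cmd.runs_of_wp ?_).mono (T := Cmd.time _) (by decide) fun _ h _ => h
  simp only [Cmd.wp, IExp.eval, RExp.eval, i0, Nat.cast_zero,
    Function.update_of_ne (show (5 : ℕ) ≠ 0 by decide),
    Function.update_of_ne (show (4 : ℕ) ≠ 0 by decide),
    Function.update_of_ne (show (6 : ℕ) ≠ 0 by decide)]
  refine ⟨by omega, ⟨by simp [hlen], e1, fun v hv => ((hq v).1 hv).trans_le (by omega),
    by omega⟩, ?_⟩
  simp only [MemBracket, Function.update_self, Function.update_of_ne (show (0 : ℕ) ≠ 1 by decide)]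
  rw [F1.rreg 4 (by decide), F1.rreg 5 (by decide), F1.rreg 6 (by decide), F1.iarr 2 (by decide),
    F1.rarr 3 (by decide), F1.rarr 4 (by decide), F1.rarr 5 (by decide), F1.rarr 6 (by decide)]
  have hB : Bracket (DataFeas T y w (m.rreg 4) (m.rreg 5) q) 0
      ((m.rreg 5 - m.rreg 4) * m.rreg 6) T.par q (dataVal y w (m.rreg 4)) (dataSlope w)
      (dataVal y w (m.rreg 5)) (dataSlope w) := by
    refine ⟨hT, le_rfl, mul_nonneg (sub_nonneg.2 h45) h6, ?_, fun ε h0 h1 => absurd h1 h0.not_gt,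
      fun _ _ _ => Iff.rfl, fun v _ => dataSlope_nonneg v, fun v _ => dataSlope_nonneg v⟩
    exact dataFeas_of_large h45 (fun v => extend_coe y v ▸ (hb v v.2).1)
      (fun v => extend_coe y v ▸ (hb v v.2).2.1) h6 (fun v => extend_coe w v ▸ (hb v v.2).2.2)
      fun v hv => (hq v).1 hv
  have hf' := fun v (hv : v ∈ q) => hf v ((hq v).1 hv)
  exact hB.congr (fun v hv => (hf' v hv).1.symm) (fun v hv => (hf' v hv).2.1.symm)
    (fun v hv => (hf' v hv).2.2.1.symm) (fun v hv => (hf' v hv).2.2.2.1.symm)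
    (fun v hv => (hf' v hv).2.2.2.2.symm)

/-- Stores the lower bounds of the vertices, and propagates them towards the root. -/
def finish : Cmd :=
  .forLoop 2 0 (.ite (.rlt (.ofInt (.const 0)) (.arr 1 (.reg 2)))
    (.storeR 2 (.reg 2) (.sub (.arr 0 (.reg 2))
      (.mul (.div (.ofInt (.const 1)) (.arr 1 (.reg 2))) (.reg 0))))
    (.storeR 2 (.reg 2) (.reg 4))) ;;
  .forList 9 0 (.setI 4 (.arr 0 (.reg 3)) ;;
    .ite (.rlt (.arr 2 (.reg 4)) (.arr 2 (.reg 3))) (.storeR 2 (.reg 4) (.arr 2 (.reg 3))) .skip)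

/-- The merges have overwritten the working bounds, the contraction the working list and parents.
The lower bounds at the optimal error are therefore recomputed from the input and propagated along
the full topological order, which the rounds leave intact. -/
theorem finish_runs (h : Loaded T y w m) (hW : n ≤ W) (hT : TreeList T.par q)
    (hq : ∀ v, v ∈ q ↔ v < n) (h9 : InArr (m.iarr 9) q) (hlen : q.length = n) :
    Runs W finish m ((n + 1) * 100) fun m' =>
      Propagated T.par q q (lo (dataVal y w (m.rreg 4)) (dataSlope w) (m.rreg 0)) (m'.rarr 2) := by
  set l := lo (dataVal y w (m.rreg 4)) (dataSlope w) (m.rreg 0) with hl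
  refine ((Runs.forLoop (i := 2) (r := 0) (T := 30) (fun j m' => ∀ i < j, m'.rarr 2 i = l i) h.num
    hW (by decide) (by decide) (by decide) (fun _ _ _ h => h) (fun i hi => by omega) ?_).seq
    (T₂ := (n + 1) * 60) fun m₁ e1 F1 => ?_).mono (by omega) fun _ h _ => h
  · rintro j m' hj hI F hj2 -
    have hL := h.of_frame F (by decide) (by decide) (by decide) (by decide)
    refine (Cmd.runs_of_wp ?_).mono (T := Cmd.time _) (by decide) fun _ h _ => h
    simp only [Cmd.wp, BExp.Holds, IExp.eval, RExp.eval, hj2, hL.val j hj, hL.weight j hj,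
      F.rreg 0 (by decide), F.rreg 4 (by decide), Nat.cast_zero, Nat.cast_one,
      Function.update_self]
    refine ⟨fun hw i hi => ?_, fun hw i hi => ?_⟩ <;>
    · rw [Function.update_apply]
      split_ifs with hij
      · simp [hij, hl, lo, dataVal, dataSlope, hw]
      · exact hI i (by omega)
  · have L1 := h.of_frame F1 (by decide) (by decide) (by decide) (by decide)
    refine (Runs.forList (L := q) (T := 40) (fun P m' => Propagated T.par q P l (m'.rarr 2))
      (by rw [L1.num, hlen]) (by rw [F1.iarr 9 (by decide)]; exact h9) (by omega)
      (fun v hv => ((hq v).1 hv).le.trans hW) (by decide) (by decide) (by decide) (by decide)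
      (by decide) (fun _ _ _ h => h) (fun _ _ _ h => h)
      ((Propagated.nil l).congr (fun v hv => (e1 v ((hq v).1 hv)).symm) (by simp) hT.closed)
      ?_).mono (by rw [hlen]; omega) fun _ h _ => h
    rintro P v Q m' hL hP F hv
    have L2 := L1.of_frame F (by decide) (by decide) (by decide) (by decide)
    have hvn : v < n := (hq v).1 (by simp [hL])
    have hpn := T.par_lt hvn
    have hstep := hP.step hT hL
    refine (Cmd.runs_of_wp ?_).mono (T := Cmd.time _) (by decide) fun _ h _ => h
    simp only [Cmd.wp, BExp.Holds, IExp.eval, RExp.eval, hv, L2.par v hvn, Function.update_self,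
      Function.update_of_ne (show (3 : ℕ) ≠ 4 by decide)]
    refine ⟨hpn.le.trans hW, fun hlt => ?_, fun hlt => ?_⟩
    · rwa [if_pos hlt] at hstep
    · rwa [if_neg hlt] at hstep

/-- The regression program. -/
def regression : Cmd := scan ;; fill ;; topSort ;; start ;; rounds ;; finish

theorem regression_runs (hw : ∀ v, 0 ≤ w v) (hW : 4 * n + 40 ≤ W) :
    Runs W regression (input T y w) ((n + 1) * (500 + 16 * (roundTime + 10))) fun m' =>
      IsLinftyIsotonicRegression T.Edge y w (output n m') := by
  have h : Loaded T y w (input T y w) := loaded_input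
  refine ((scan_runs h (by omega) rfl rfl rfl).seq (T₂ := (n + 1) * 70 + ((n + 1) * 200 +
    ((n + 1) * 40 + (16 * (roundTime + 10) * (n + 1) + (n + 1) * 100)))) fun m₁ ⟨a1, a2, a3⟩ F1 =>
    ?_).mono (by nlinarith) fun _ h _ => h
  have h1 := h.of_frame F1 (by decide) (by decide) (by decide) (by decide)
  refine (fill_runs h1 (by omega)).seq fun m₂ b1 F2 => ?_
  have h2 := h1.of_frame F2 (by decide) (by decide) (by decide) (by decide)
  refine (topSort_runs h2 (by omega) (fun i hi => ?_) ?_ ?_).seq fun m₃ ⟨q, c1, c2, c3⟩ F3 => ?_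
  · rw [F2.iarr 8 (by decide), F1.iarr 8 (by decide)]
    simp [input]
  · rw [F2.ireg 11 (by decide), F1.ireg 11 (by decide)]
    simp [input]
  · rw [F2.ireg 12 (by decide), F1.ireg 12 (by decide)]
    simp [input]
  have h3 := h2.of_frame F3 (by decide) (by decide) (by decide) (by decide)
  have hlen : q.length = n := by
    rw [← List.toFinset_card_of_nodup c1.nodup, ← Finset.card_range n]
    congr 1
    ext v
    simp [c2]
  have r4 : m₃.rreg 4 = m₁.rreg 4 := by rw [F3.rreg 4 (by decide), F2.rreg 4 (by decide)]
  have r5 : m₃.rreg 5 = m₁.rreg 5 := by rw [F3.rreg 5 (by decide), F2.rreg 5 (by decide)]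
  have r6 : m₃.rreg 6 = m₁.rreg 6 := by rw [F3.rreg 6 (by decide), F2.rreg 6 (by decide)]
  refine (start_runs h3 hW c1 c2 c3 hlen (by rwa [r4, r5]) (by rwa [r6]) (by rwa [r4, r5, r6])
    (by rw [F3.iarr 2 (by decide), F3.rarr 3 (by decide), F3.rarr 4 (by decide),
      F3.rarr 5 (by decide), F3.rarr 6 (by decide), r4, r5]; exact b1)).seq fun m₄ ⟨d1, d2⟩ F4 => ?_
  rw [r4, r5] at d2
  have h4 := h3.of_frame F4 (by decide) (by decide) (by decide) (by decide)
  refine ((rounds_runs (fun ε ε' _ hε => DataFeas.mono hε) d1 d2).mono (by rw [hlen])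
    fun _ h _ => h).seq fun m₅ ⟨e1, e2, e3⟩ F5 => ?_
  have h5 := h4.of_frame F5 (by decide) (by decide) (by decide) (by decide)
  refine (finish_runs h5 (by omega) c1 c2 (by
    rw [F5.iarr 9 (by decide), F4.iarr 9 (by decide)]; exact c3) hlen).mono le_rfl fun m₆ f1 _ => ?_
  rw [F5.rreg 4 (by decide), F4.rreg 4 (by decide), r4] at f1
  exact isRegression_of_propagated a1 (fun v => extend_coe y v ▸ (a3 v v.2).1)
    (fun v => extend_coe y v ▸ (a3 v v.2).2.1) hw c2 e1 e2 e3 f1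

end

end LinftyIso

/-- The `L_∞` isotonic regression problem on rooted trees of `n` vertices has time complexity
`Θ(n)`: some program solves it in at most `C * n` steps, with integers of size `O(n)`; and
every program that solves it, whatever its word bound, needs at least `n` steps on some data
on each tree of `n` vertices. -/
theorem theorem2 :
    (∃ (P : LinftyIso.Prog) (K C : ℕ),
      ∀ (n : ℕ) (T : LinftyIso.ParentTree n) (y w : Fin n → ℝ), (∀ v, 0 ≤ w v) →
        ∃ (t : ℕ) (f : Fin n → ℝ), P.Halts (K * n) T y w t f ∧ t ≤ C * n ∧
          LinftyIso.IsLinftyIsotonicRegression T.Edge y w f) ∧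
    (∀ (P : LinftyIso.Prog) (W : ℕ → ℕ), P.Solves W →
      ∀ (n : ℕ) (T : LinftyIso.ParentTree n), ∃ y w : Fin n → ℝ, (∀ v, 0 ≤ w v) ∧
        ∀ (t : ℕ) (f : Fin n → ℝ), P.Halts (W n) T y w t f → n ≤ t) := by
  -- A rooted tree has `n ≥ 1`, so `4 n + 40 ≤ 44 n`, and `n + 1 ≤ 2 n` accounts for the factor `2`
  -- in the time.
  refine ⟨⟨⟨[], LinftyIso.regression⟩, 44, 2 * (500 + 16 * (LinftyIso.roundTime + 10)),
    fun n T y w hw => ?_⟩, fun P W hP n T => ⟨fun _ => 1, fun _ => 1, fun _ => zero_le_one,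
      fun t f h => hP.le_time n T h⟩⟩
  have hn : 0 < n := T.root.pos
  obtain ⟨t, m, he, ht, hr⟩ := LinftyIso.regression_runs (W := 44 * n) (T := T) (y := y) hw
    (by omega)
  exact ⟨t, _, ⟨m, he, rfl⟩, ht.trans (by nlinarith), hr⟩
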